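/- Let $(Z,\mathcal Z)$ be a standard Borel space with a positive, $\sigma$-finite, non-atomic measure $\mu$, and let $\mathcal Z_\mu$ be the class of sets $B\in\mathcal Z$ with $\mu(B)<\infty$. Let $\widehat N=\{\widehat N(B):B\in\mathcal Z_\mu\}$ be a compensated Poisson random measure with control $\mu$ on a probability space $(\Omega,\mathcal F,\mathbb P)$: the $\widehat N(B)$ are square-integrable, $\mathbb E[\widehat N(B)\widehat N(C)]=\mu(B\cap C)$ for all $B,C\in\mathcal Z_\mu$, $\widehat N(B_1),\dots,\widehat N(B_m)$ are independent whenever $B_1,\dots,B_m\in\mathcal Z_\mu$ are pairwise disjoint, and $\widehat N(B)$ has the law of $N-\mu(B)$ with $N$ Poisson of parameter $\mu(B)$. Let $L^2_s(\mu^2)$ be the space of symmetric functions in $L^2(\mu^2)$, and $L^2_{s,0}(\mu^2)$ the subspace of those that vanish on the diagonal. The double integral $I_2$ is the unique linear continuous map $L^2_{s,0}(\mu^2)\to L^2(\mathbb P)$ such that $I_2(f)=2\widehat N(A)\widehat N(B)$ when $f(x,y)=\mathbf 1_A(x)\mathbf 1_B(y)+\mathbf 1_A(y)\mathbf 1_B(x)$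 with disjoint $A,B\in\mathcal Z_\mu$. For kernels $f,g$ on $Z^2$ write $$(f\star_1^0 g)(\gamma,t,s)=f(\gamma,t)g(\gamma,s),\qquad (f\star_1^1 g)(t,s)=\int_Z f(z,t)g(z,s)\,\mu(dz),\qquad (f\star_2^1 g)(\gamma)=\int_Z f(z,\gamma)g(z,\gamma)\,\mu(dz).$$ Let $f_n\in L^2_{s,0}(\mu^2)$ and $F_n=I_2(f_n)$, $n\ge1$. Assume that - $\int_Z f_n(z,\cdot)^2\,\mu(dz)\in L^2(\mu)$ for every $n$; - $2\int_Z\int_Z f_n(z,z')^2\,\mu(dz)\mu(dz')\to1$ as $n\to\infty$; - $\int_Z\int_Z f_n(z,z')^4\,\mu(dz)\mu(dz')\to0$ as $n\to\infty$; - for every $n$ there is a family $\{Z_{n,t}:t\in[0,1]\}\subset\mathcal Z$ with $Z_{n,0}=\varnothing$, $Z_{n,1}=Z$, $Z_{n,s}\subseteq Z_{n,t}$ for $s<t$, and $\lim_{s\to t}\int_{Z_{n,s}}g\,d\mu=\int_{Z_{n,t}}g\,d\mu$ for every $g\in L^1(\mu)$ and $t\in[0,1]$. Then $f_n\star_1^0f_n\in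 L^2(\mu^3)$ and $f_n\star_1^1f_n\in L^2_s(\mu^2)$ for every $n$, and moreover: 1. if $$\text{(G}^*)\qquad f_n\star_1^1f_n\to0\ \text{ in }L^2(\mu^2)\quad\text{and}\quad f_n\star_2^1f_n\to0\ \text{ in }L^2(\mu),$$ then $F_n$ converges in law to the standard Gaussian distribution $N(0,1)$; 2. if $F_n\in L^4(\mathbb P)$ for every $n$ and $\mathbb E(F_n^4)\to3$, then (G$^*$) holds; 3. if the sequence $\{F_n^4:n\ge1\}$ is uniformly integrable, then the following three conditions are equivalent: (G$^*$); $F_n\to N(0,1)$ in law; $\mathbb E(F_n^4)\to3$. -/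

import Mathlib

open MeasureTheory ProbabilityTheory Filter Topology

namespace PoissonCLT

/-- `M` is a compensated Poisson random measure with control `μ`, defined on the probability
space `(Ω, P)`. It is a family of random variables indexed by the measurable sets of finite
`μ`-measure (the values of `M` on other sets are irrelevant) which is an independently scattered
random measure with control `μ`, and `M B` is distributed as `N - μ B` with `N` a Poisson
variable of parameter `μ B`. -/
structure IsCompensatedPoisson {Z Ω : Type*} [MeasurableSpace Z] [MeasurableSpace Ω]
    (μ : Measure Z) (P : Measure Ω) (M : Set Z → Ω → ℝ) : Prop where
  /-- square integrability -/
  memLp : ∀ B, MeasurableSet B → μ B < ⊤ → MemLp (M B) 2 P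
  /-- independence over disjoint sets -/
  indep : ∀ (m : ℕ) (B : Fin m → Set Z), (∀ i, MeasurableSet (B i)) → (∀ i, μ (B i) < ⊤) →
    Pairwise (fun i j => Disjoint (B i) (B j)) → iIndepFun (fun i => M (B i)) P
  /-- covariance -/
  cov : ∀ B C, MeasurableSet B → μ B < ⊤ → MeasurableSet C → μ C < ⊤ →
    ∫ ω, M B ω * M C ω ∂P = μ.real (B ∩ C)
  /-- centered Poisson marginals -/
  law : ∀ B, MeasurableSet B → μ B < ⊤ →
    HasLaw (M B) ((poissonMeasure (μ B).toNNReal).map (fun k : ℕ => (k : ℝ) - μ.real B)) P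

/-- The data of a simple symmetric kernel vanishing on the diagonal, that is, of a linear
combination `∑ i, c i * (1_{A i}(x) 1_{B i}(y) + 1_{A i}(y) 1_{B i}(x))` where, for each `i`,
`A i` and `B i` are disjoint measurable sets of finite measure. -/
structure SimpleKernel {Z : Type*} [MeasurableSpace Z] (μ : Measure Z) where
  /-- number of terms -/
  m : ℕ
  /-- coefficients -/
  c : Fin m → ℝ
  /-- first sets -/
  A : Fin m → Set Z
  /-- second sets -/
  B : Fin m → Set Z
  measurable_A : ∀ i, MeasurableSet (A i)
  measurable_B : ∀ i, MeasurableSet (B i)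
  finite_A : ∀ i, μ (A i) < ⊤
  finite_B : ∀ i, μ (B i) < ⊤
  disjoint : ∀ i, Disjoint (A i) (B i)

/-- The function on `Z × Z` given by a simple kernel. -/
noncomputable def SimpleKernel.toFun {Z : Type*} [MeasurableSpace Z] {μ : Measure Z}
    (g : SimpleKernel μ) (p : Z × Z) : ℝ :=
  ∑ i, g.c i * ((g.A i).indicator (fun _ => (1 : ℝ)) p.1 * (g.B i).indicator (fun _ => 1) p.2
    + (g.A i).indicator (fun _ => (1 : ℝ)) p.2 * (g.B i).indicator (fun _ => 1) p.1)

/-- The double integral `∑ i, c i * (2 M(A i) M(B i))` of a simple kernel. -/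
noncomputable def SimpleKernel.integral {Z Ω : Type*} [MeasurableSpace Z] {μ : Measure Z}
    (g : SimpleKernel μ) (M : Set Z → Ω → ℝ) (ω : Ω) : ℝ :=
  ∑ i, g.c i * (2 * (M (g.A i) ω * M (g.B i) ω))

/-- `F` is (a version of) the double integral `I₂(f)` of `f` with respect to `M`: the linear
extension by `L²`-continuity of the integral of simple kernels, i.e. `F` is the `L²(P)`-limit of
the integrals of simple kernels that converge to `f` in `L²(μ ⊗ μ)`. -/
def IsDoubleIntegral {Z Ω : Type*} [MeasurableSpace Z] [MeasurableSpace Ω]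
    (μ : Measure Z) (P : Measure Ω) (M : Set Z → Ω → ℝ) (f : Z × Z → ℝ) (F : Ω → ℝ) : Prop :=
  MemLp F 2 P ∧ ∃ g : ℕ → SimpleKernel μ,
    Tendsto (fun k => eLpNorm (fun p => f p - (g k).toFun p) 2 (μ.prod μ)) atTop (𝓝 0) ∧
    Tendsto (fun k => eLpNorm (fun ω => F ω - (g k).integral M ω) 2 P) atTop (𝓝 0)

/-- `L²_s(μ²)`: square-integrable symmetric kernels (symmetry is a.e., as for classes). -/
def MemL2Symm {Z : Type*} [MeasurableSpace Z] (μ : Measure Z) (f : Z × Z → ℝ) : Prop :=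
  MemLp f 2 (μ.prod μ) ∧ ∀ᵐ p ∂(μ.prod μ), f p.swap = f p

/-- `L²_{s,0}(μ²)`: square-integrable symmetric kernels vanishing on the diagonal. -/
def MemL2SymmZero {Z : Type*} [MeasurableSpace Z] (μ : Measure Z) (f : Z × Z → ℝ) : Prop :=
  MemL2Symm μ f ∧ ∀ z, f (z, z) = 0

/-- The contraction `(f ⋆₁⁰ g)(γ, t, s) = f(γ, t) g(γ, s)`. -/
def contr10 {Z : Type*} (f g : Z × Z → ℝ) (p : Z × Z × Z) : ℝ :=
  f (p.1, p.2.1) * g (p.1, p.2.2)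

/-- The contraction `(f ⋆₁¹ g)(t, s) = ∫ f(z, t) g(z, s) μ(dz)`. -/
noncomputable def contr11 {Z : Type*} [MeasurableSpace Z] (μ : Measure Z) (f g : Z × Z → ℝ)
    (p : Z × Z) : ℝ :=
  ∫ z, f (z, p.1) * g (z, p.2) ∂μ

/-- The contraction `(f ⋆₂¹ g)(γ) = ∫ f(z, γ) g(z, γ) μ(dz)`. -/
noncomputable def contr21 {Z : Type*} [MeasurableSpace Z] (μ : Measure Z) (f g : Z × Z → ℝ)
    (γ : Z) : ℝ :=
  ∫ z, f (z, γ) * g (z, γ) ∂μ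

/-- `S` is a continuous increasing family of measurable sets from `∅` to the whole space. -/
structure IsContinuousFamily {Z : Type*} [MeasurableSpace Z] (μ : Measure Z)
    (S : unitInterval → Set Z) : Prop where
  measurable : ∀ t, MeasurableSet (S t)
  zero : S 0 = ∅
  one : S 1 = Set.univ
  mono : ∀ s t, s < t → S s ⊆ S t
  tendsto : ∀ g : Z → ℝ, Integrable g μ → ∀ t,
    Tendsto (fun s => ∫ x in S s, g x ∂μ) (𝓝 t) (𝓝 (∫ x in S t, g x ∂μ))

/-- Assumption N on a sequence of kernels. The fourth moments are integrals with values in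
`[0, ∞]`. -/
structure AssumptionN {Z : Type*} [MeasurableSpace Z] (μ : Measure Z) (f : ℕ → Z × Z → ℝ) :
    Prop where
  /-- integrability: `z' ↦ ∫ f_n(z, z')² μ(dz)` is in `L²(μ)` -/
  integrability : ∀ n, MemLp (fun z' => ∫ z, f n (z, z') ^ 2 ∂μ) 2 μ
  /-- normalization -/
  normalization : Tendsto (fun n => 2 * ∫ z, ∫ z', f n (z, z') ^ 2 ∂μ ∂μ) atTop (𝓝 1)
  /-- fourth moments -/
  fourth_moment : Tendsto (fun n => ∫⁻ z, ∫⁻ z', ENNReal.ofReal (f n (z, z') ^ 4) ∂μ ∂μ)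
    atTop (𝓝 0)
  /-- continuous increasing families of sets -/
  family : ∀ _n : ℕ, ∃ S : unitInterval → Set Z, IsContinuousFamily μ S

/-- `f_n ⋆₁¹ f_n → 0` in `L²(μ²)` and `f_n ⋆₂¹ f_n → 0` in `L²(μ)`. -/
def ContractionsVanish {Z : Type*} [MeasurableSpace Z] (μ : Measure Z) (f : ℕ → Z × Z → ℝ) :
    Prop :=
  Tendsto (fun n => eLpNorm (contr11 μ (f n) (f n)) 2 (μ.prod μ)) atTop (𝓝 0) ∧
    Tendsto (fun n => eLpNorm (contr21 μ (f n) (f n)) 2 μ) atTop (𝓝 0)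

end PoissonCLT

open PoissonCLT

/-! On simple kernels everything is explicit. Over disjoint cells the double integral is, in law, a
quadratic form Q = Σ a_ij X_i X_j with zero diagonal in independent centred Poisson variables X_i of
parameters r_i. The only probabilistic tool is E[X G(N)] = r E[G(N+1) − G(N)], where X = N − r
(`integral_centered_smul`). Adding a point to cell i changes Q by exactly 2 L_i, where L_i = Σ_j
a_ij X_j does not involve X_i.

Two computations follow. The first is an exact fourth moment (`integral_quadForm_pow_four`): E Q⁴ =
12‖f‖⁴ + 48‖f⋆₁¹f‖² + 48‖f⋆₂¹f‖² + 96⟨f⋆₁¹f, f²⟩ + 8∫f⁴. The second is a bound on ψ(t) = E exp(itQ)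
(`norm_integral_quadChar_sub_le`). Integration by parts gives ψ'(t) ≈ −t E[T exp(itQ)] with T = 2 Σ
r_i L_i² and a remainder cubic in the L_i. Now T has mean 2‖f‖² and variance 8‖f⋆₁¹f‖² + 4‖f⋆₂¹f‖²,
so ψ' ≈ −tψ, and ψ(t) is close to exp(−t²/2) as soon as the contractions and ∫f⁴ are small and 2‖f‖²
is near 1.

To reach general kernels, a simple approximation is replaced by the averages of f over its
off-diagonal blocks (`SimpleKernel.exists_isDominated`). This is still close to f in L², and by
Jensen it increases neither ∫f⁴ nor ‖f⋆₂¹f‖, quantities that L² convergence alone does not control.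
The bound on the characteristic function then passes to the limit. For the fourth moment the
approximating integrals must converge in L⁴: this comes from a Scheffé-type argument on the kernels
(`tendsto_integral_of_le`), a fourth-moment bound applied to differences, and Fatou.

Under the assumptions ‖f_n‖² → 1/2 and ∫f_n⁴ → 0. Vanishing contractions give the limit law by
Lévy's theorem. Conversely 12‖f_n‖⁴ → 3 and the cross term tends to 0 by Cauchy–Schwarz, so E F_n⁴ →
3 leaves no room for the two squared contraction norms. Uniform integrability carries convergence in
law over to fourth moments, which closes the cycle. -/

namespace PoissonCLT

open scoped NNReal ENNReal

/-! ### Integration by parts for independent Poisson variables -/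

section PoissonCalculus

variable {ι : Type*} [Fintype ι] {E : Type*} [NormedAddCommGroup E]

/-- The law of a family of independent Poisson variables with parameters `r i`. -/
noncomputable def piPoisson (r : ι → ℝ≥0) : Measure (ι → ℕ) :=
  Measure.pi fun i => poissonMeasure (r i)

instance (r : ι → ℝ≥0) : IsProbabilityMeasure (piPoisson r) := by
  unfold piPoisson; infer_instance

/-- Functions on `ι → ℕ` of at most exponential growth. -/
def ExpBdd (G : (ι → ℕ) → E) : Prop :=
  ∃ C r : ℝ, 0 ≤ C ∧ 0 ≤ r ∧ ∀ k, ‖G k‖ ≤ C * Real.exp (r * ∑ i, (k i : ℝ))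

lemma measurable_nat_pi {β : Type*} [MeasurableSpace β] (G : (ι → ℕ) → β) :
    Measurable G := by
  have : Countable (ι → ℕ) := inferInstance
  exact Measurable.of_discrete

/-- The exponential of a sum over cells factors into one-dimensional exponentials, and Σ (r eˢ)ⁿ/n!
converges. The class is closed under sums, products and shifts, so it supplies every integrability
condition met below. -/
lemma ExpBdd.integrable [NormedSpace ℝ E] {G : (ι → ℕ) → E} (hG : ExpBdd G) (r : ι → ℝ≥0) :
    Integrable G (piPoisson r) := by
  obtain ⟨C, s, hC, hs, h⟩ := hG
  have h1 : Integrable (fun k : ι → ℕ => ∏ i, Real.exp (s * (k i : ℝ))) (piPoisson r) := by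
    refine Integrable.fintype_prod (f := fun _ (n : ℕ) => Real.exp (s * (n : ℝ))) fun i => ?_
    rw [integrable_poissonMeasure_iff]
    have := (Real.summable_pow_div_factorial ((r i : ℝ) * Real.exp s)).mul_left
      (Real.exp (-(r i : ℝ)))
    refine this.congr fun n => ?_
    rw [Real.norm_of_nonneg (Real.exp_pos _).le, mul_pow, ← Real.exp_nat_mul, mul_comm s]
    ring
  refine (h1.const_mul C).mono' ?_ (ae_of_all _ fun k => ?_)
  · have : Countable (ι → ℕ) := inferInstance
    exact (StronglyMeasurable.of_discrete).aestronglyMeasurable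
  · rw [← Real.exp_sum, ← Finset.mul_sum]
    exact h k

lemma ExpBdd.of_bounded {G : (ι → ℕ) → E} (C : ℝ) (h : ∀ k, ‖G k‖ ≤ C) : ExpBdd G :=
  ⟨C, 0, (norm_nonneg _).trans (h 0), le_rfl, by simpa using h⟩

lemma ExpBdd.const (c : E) : ExpBdd (fun _ : ι → ℕ => c) :=
  .of_bounded ‖c‖ fun _ => le_rfl

lemma ExpBdd.add {G H : (ι → ℕ) → E} (hG : ExpBdd G) (hH : ExpBdd H) :
    ExpBdd (fun k => G k + H k) := by
  obtain ⟨C, s, hC, hs, h⟩ := hG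
  obtain ⟨D, t, hD, ht, h'⟩ := hH
  refine ⟨C + D, s + t, by positivity, by positivity, fun k => (norm_add_le _ _).trans ?_⟩
  have hk : 0 ≤ ∑ i, (k i : ℝ) := Finset.sum_nonneg fun i _ => by positivity
  rw [add_mul]
  refine add_le_add ((h k).trans ?_) ((h' k).trans ?_) <;> gcongr <;> linarith

lemma ExpBdd.mul {G H : (ι → ℕ) → ℝ} (hG : ExpBdd G) (hH : ExpBdd H) :
    ExpBdd (fun k => G k * H k) := by
  obtain ⟨C, s, hC, hs, h⟩ := hG
  obtain ⟨D, t, hD, ht, h'⟩ := hH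
  refine ⟨C * D, s + t, by positivity, by positivity, fun k => ?_⟩
  rw [norm_mul, add_mul, Real.exp_add, mul_mul_mul_comm]
  exact mul_le_mul (h k) (h' k) (norm_nonneg _) (by positivity)

lemma ExpBdd.smul [NormedSpace ℝ E] {G : (ι → ℕ) → ℝ} {H : (ι → ℕ) → E}
    (hG : ExpBdd G) (hH : ExpBdd H) : ExpBdd (fun k => G k • H k) := by
  obtain ⟨C, s, hC, hs, h⟩ := hG
  obtain ⟨D, t, hD, ht, h'⟩ := hH
  refine ⟨C * D, s + t, by positivity, by positivity, fun k => ?_⟩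
  rw [norm_smul, add_mul, Real.exp_add, mul_mul_mul_comm]
  exact mul_le_mul (h k) (h' k) (norm_nonneg _) (by positivity)

lemma ExpBdd.neg {G : (ι → ℕ) → E} (hG : ExpBdd G) : ExpBdd (fun k => -G k) := by
  obtain ⟨C, s, hC, hs, h⟩ := hG
  exact ⟨C, s, hC, hs, by simpa using h⟩

lemma ExpBdd.sub {G H : (ι → ℕ) → E} (hG : ExpBdd G) (hH : ExpBdd H) :
    ExpBdd (fun k => G k - H k) := by
  simpa [sub_eq_add_neg] using hG.add hH.neg

lemma ExpBdd.pow {G : (ι → ℕ) → ℝ} (hG : ExpBdd G) (n : ℕ) : ExpBdd (fun k => G k ^ n) := by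
  induction n with
  | zero => simpa using ExpBdd.const (ι := ι) (1 : ℝ)
  | succ n ih => simpa [pow_succ] using ih.mul hG

lemma ExpBdd.sum {κ : Type*} {s : Finset κ} {G : κ → (ι → ℕ) → E}
    (hG : ∀ i ∈ s, ExpBdd (G i)) : ExpBdd (fun k => ∑ i ∈ s, G i k) := by
  classical
  induction s using Finset.induction_on with
  | empty => simpa using ExpBdd.const (ι := ι) (0 : E)
  | insert a s ha ih =>
    simp only [Finset.sum_insert ha]
    exact (hG a (by simp)).add (ih fun i hi => hG i (by simp [hi]))

lemma ExpBdd.norm {G : (ι → ℕ) → E} (hG : ExpBdd G) : ExpBdd (fun k => ‖G k‖) := by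
  obtain ⟨C, s, hC, hs, h⟩ := hG
  exact ⟨C, s, hC, hs, by simpa using h⟩

lemma ExpBdd.coord (i : ι) : ExpBdd (fun k : ι → ℕ => (k i : ℝ)) := by
  refine ⟨1, 1, zero_le_one, zero_le_one, fun k => ?_⟩
  rw [one_mul, one_mul, Real.norm_of_nonneg (by positivity)]
  have h1 : (k i : ℝ) ≤ ∑ i, (k i : ℝ) :=
    Finset.single_le_sum (f := fun i => (k i : ℝ)) (fun i _ => by positivity) (Finset.mem_univ i)
  linarith [Real.add_one_le_exp (∑ i, (k i : ℝ))]

variable [DecidableEq ι]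

/-- Adding a point in the cell `i`. -/
def addPoint (i : ι) (k : ι → ℕ) : ι → ℕ := k + Pi.single i 1

lemma ExpBdd.comp_addPoint {G : (ι → ℕ) → E} (hG : ExpBdd G) (i : ι) :
    ExpBdd (fun k => G (addPoint i k)) := by
  obtain ⟨C, s, hC, hs, h⟩ := hG
  refine ⟨C * Real.exp s, s, by positivity, hs, fun k => (h _).trans (le_of_eq ?_)⟩
  have : ∑ j, ((addPoint i k j : ℕ) : ℝ) = ∑ j, (k j : ℝ) + 1 := by
    simp [addPoint, Finset.sum_add_distrib, Pi.single_apply]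
  rw [this, mul_add, Real.exp_add]
  ring_nf

/-- Mecke's formula as an identity of measures. On singletons it is k · rᵏ/k! = r · rᵏ⁻¹/(k−1)! in
the coordinate i, the other factors being untouched. -/
lemma piPoisson_withDensity (r : ι → ℝ≥0) (i : ι) :
    (piPoisson r).withDensity (fun k => ((k i : ℝ≥0) : ℝ≥0∞))
      = (r i : ℝ≥0∞) • (piPoisson r).map (addPoint i) := by
  have hc : Countable (ι → ℕ) := inferInstance
  refine Measure.ext_of_singleton fun k => ?_
  rw [withDensity_apply _ (measurableSet_singleton k), lintegral_singleton,
    Measure.smul_apply, Measure.map_apply (measurable_nat_pi _) (measurableSet_singleton k)]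
  -- With no point in cell i the density is zero, and no configuration is shifted onto k.
  rcases Nat.eq_zero_or_pos (k i) with h0 | h0
  · have : addPoint i ⁻¹' {k} = ∅ := by
      ext l
      simp only [Set.mem_preimage, Set.mem_singleton_iff, Set.mem_empty_iff_false, iff_false]
      rintro rfl
      simp [addPoint] at h0
    simp [this, h0]
  · obtain ⟨l, rfl⟩ : ∃ l, addPoint i l = k := by
      refine ⟨k - Pi.single i 1, ?_⟩
      ext j
      by_cases hj : j = i
      · subst hj; simp [addPoint]; omega
      · simp [addPoint, hj]
    have : addPoint i ⁻¹' {addPoint i l} = {l} := by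
      ext l'
      simp [addPoint]
    rw [this]
    have hs : ∀ m : ι → ℕ, piPoisson r {m} = poissonMeasure (r i) {m i} *
        ∏ j ∈ Finset.univ.erase i, poissonMeasure (r j) {m j} := by
      intro m
      rw [piPoisson, Measure.pi_singleton, Finset.mul_prod_erase _
        (fun j => poissonMeasure (r j) {m j}) (Finset.mem_univ i)]
    rw [hs, hs]
    have hp : ∏ j ∈ Finset.univ.erase i, poissonMeasure (r j) {addPoint i l j}
        = ∏ j ∈ Finset.univ.erase i, poissonMeasure (r j) {l j} := by
      refine Finset.prod_congr rfl fun j hj => ?_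
      simp [addPoint, (Finset.mem_erase.1 hj).1]
    rw [hp, smul_eq_mul, ← mul_assoc, ← mul_assoc]
    congr 1
    have hl : addPoint i l i = l i + 1 := by simp [addPoint]
    rw [hl, poissonMeasure_singleton, poissonMeasure_singleton]
    rw [← ENNReal.ofReal_coe_nnreal, ← ENNReal.ofReal_coe_nnreal,
      ← ENNReal.ofReal_mul (by positivity), ← ENNReal.ofReal_mul (by positivity)]
    congr 1
    rw [Nat.factorial_succ]
    push_cast
    field_simp
    ring

variable [NormedSpace ℝ E]

/-- No growth condition on G is needed, because two measures are being identified. -/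
lemma integral_coord_smul (r : ι → ℝ≥0) (i : ι) (G : (ι → ℕ) → E) :
    ∫ k, (k i : ℝ) • G k ∂(piPoisson r) = (r i : ℝ) • ∫ k, G (addPoint i k) ∂(piPoisson r) := by
  have hc : Countable (ι → ℕ) := inferInstance
  have h := integral_withDensity_eq_integral_smul (μ := piPoisson r)
    (f := fun k : ι → ℕ => (k i : ℝ≥0)) (measurable_nat_pi _) G
  rw [piPoisson_withDensity, integral_smul_measure, integral_map
    (measurable_nat_pi _).aemeasurable (StronglyMeasurable.of_discrete).aestronglyMeasurable] at h
  simpa [NNReal.smul_def] using h.symm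

/-- The centered coordinate. -/
noncomputable def centered (r : ι → ℝ≥0) (i : ι) (k : ι → ℕ) : ℝ := k i - r i

lemma ExpBdd.centered (r : ι → ℝ≥0) (i : ι) : ExpBdd (centered r i) :=
  (ExpBdd.coord i).sub (ExpBdd.const _)

lemma centered_addPoint (r : ι → ℝ≥0) (i j : ι) (k : ι → ℕ) :
    centered r j (addPoint i k) = centered r j k + if j = i then 1 else 0 := by
  simp [PoissonCLT.centered, addPoint, Pi.single_apply]
  split_ifs <;> ring

/-- Integration by parts for Poisson variables. -/
lemma integral_centered_smul (r : ι → ℝ≥0) (i : ι) {G : (ι → ℕ) → E} (hG : ExpBdd G) :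
    ∫ k, centered r i k • G k ∂(piPoisson r)
      = (r i : ℝ) • ∫ k, (G (addPoint i k) - G k) ∂(piPoisson r) := by
  simp only [PoissonCLT.centered, sub_smul]
  rw [integral_sub (((ExpBdd.coord i).smul hG).integrable r)
      (((ExpBdd.const (r i : ℝ)).smul hG).integrable r),
    integral_sub ((hG.comp_addPoint i).integrable r) (hG.integrable r), integral_coord_smul,
    integral_smul, smul_sub]

end PoissonCalculus

/-! ### Moments of linear forms (first chaos) -/

section LinearForms

variable {ι : Type*} [Fintype ι] [DecidableEq ι] (r : ι → ℝ≥0)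

/-- The linear form `∑ j, b j * X j` in centered Poisson variables. -/
noncomputable def linForm (b : ι → ℝ) (k : ι → ℕ) : ℝ := ∑ j, b j * centered r j k

lemma ExpBdd.linForm (b : ι → ℝ) : ExpBdd (linForm r b) :=
  ExpBdd.sum fun j _ => (ExpBdd.const (b j)).mul (ExpBdd.centered r j)

lemma linForm_addPoint (b : ι → ℝ) (i : ι) (k : ι → ℕ) :
    linForm r b (addPoint i k) = linForm r b k + b i := by
  simp [PoissonCLT.linForm, centered_addPoint, mul_add, Finset.sum_add_distrib]

lemma ExpBdd.integral_add {E : Type*} [NormedAddCommGroup E] [NormedSpace ℝ E]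
    {G H : (ι → ℕ) → E} (hG : ExpBdd G) (hH : ExpBdd H) :
    ∫ k, (G k + H k) ∂(piPoisson r) = ∫ k, G k ∂(piPoisson r) + ∫ k, H k ∂(piPoisson r) :=
  MeasureTheory.integral_add (hG.integrable r) (hH.integrable r)

lemma ExpBdd.const_mul {G : (ι → ℕ) → ℝ} (hG : ExpBdd G) (c : ℝ) : ExpBdd (fun k => c * G k) :=
  (ExpBdd.const c).mul hG

lemma integral_linForm_smul {E : Type*} [NormedAddCommGroup E] [NormedSpace ℝ E]
    (b : ι → ℝ) {G : (ι → ℕ) → E} (hG : ExpBdd G) :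
    ∫ k, linForm r b k • G k ∂(piPoisson r)
      = ∑ j, (b j * r j) • ∫ k, (G (addPoint j k) - G k) ∂(piPoisson r) := by
  simp only [PoissonCLT.linForm, Finset.sum_smul]
  rw [integral_finsetSum _ fun j _ =>
    (((ExpBdd.const (b j)).mul (ExpBdd.centered r j)).smul hG).integrable r]
  refine Finset.sum_congr rfl fun j _ => ?_
  simp only [mul_smul]
  rw [integral_smul, integral_centered_smul r j hG]

lemma integral_linForm (b : ι → ℝ) : ∫ k, linForm r b k ∂(piPoisson r) = 0 := by
  have := integral_linForm_smul r b (ExpBdd.const (ι := ι) (1 : ℝ))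
  simpa using this

lemma integral_linForm_mul (b c : ι → ℝ) :
    ∫ k, linForm r b k * linForm r c k ∂(piPoisson r) = ∑ j, b j * c j * r j := by
  have := integral_linForm_smul r b (ExpBdd.linForm r c)
  simp only [smul_eq_mul, linForm_addPoint, add_sub_cancel_left, integral_const, probReal_univ,
    one_mul] at this
  rw [this]
  exact Finset.sum_congr rfl fun j _ => by ring

lemma integral_linForm_mul_sq (b c : ι → ℝ) :
    ∫ k, linForm r b k * linForm r c k ^ 2 ∂(piPoisson r) = ∑ j, b j * c j ^ 2 * r j := by
  have := integral_linForm_smul r b ((ExpBdd.linForm r c).pow 2)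
  simp only [smul_eq_mul, linForm_addPoint] at this
  rw [this]
  refine Finset.sum_congr rfl fun j _ => ?_
  have h : ∀ k, (linForm r c k + c j) ^ 2 - linForm r c k ^ 2 = 2 * c j * linForm r c k + c j ^ 2 :=
    fun k => by ring
  simp only [h]
  rw [integral_add (((ExpBdd.linForm r c).integrable r).const_mul _) (integrable_const _),
    integral_const_mul, integral_linForm]
  simp
  ring

/-- Three times the squared variance, as for a Gaussian, plus the fourth cumulant of a weighted sum
of independent Poisson variables. -/
lemma integral_linForm_pow_four (b : ι → ℝ) :
    ∫ k, linForm r b k ^ 4 ∂(piPoisson r)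
      = 3 * (∑ j, b j ^ 2 * r j) ^ 2 + ∑ j, b j ^ 4 * r j := by
  have := integral_linForm_smul r b ((ExpBdd.linForm r b).pow 3)
  simp only [smul_eq_mul, linForm_addPoint] at this
  simp only [pow_succ' _ 3]
  rw [this]
  have hL := (ExpBdd.linForm r b)
  have h2 : ∫ k, linForm r b k ^ 2 ∂(piPoisson r) = ∑ j, b j ^ 2 * r j := by
    simp only [pow_two]
    exact integral_linForm_mul r b b
  have h : ∀ j, ∫ k, ((linForm r b k + b j) ^ 3 - linForm r b k ^ 3) ∂(piPoisson r)
      = 3 * b j * (∑ j, b j ^ 2 * r j) + b j ^ 3 := by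
    intro j
    have h : ∀ k, (linForm r b k + b j) ^ 3 - linForm r b k ^ 3
        = 3 * b j * linForm r b k ^ 2 + (3 * b j ^ 2 * linForm r b k + b j ^ 3) :=
      fun k => by ring
    simp only [h]
    rw [((hL.pow 2).const_mul _).integral_add r ((hL.const_mul _).add (ExpBdd.const _)),
      (hL.const_mul _).integral_add r (ExpBdd.const _),
      integral_const_mul, integral_const_mul, integral_linForm, h2]
    simp
  simp only [h, mul_add, Finset.sum_add_distrib]
  rw [pow_two, Finset.sum_mul, Finset.mul_sum]
  congr 1 <;> refine Finset.sum_congr rfl fun j _ => by ring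

end LinearForms

/-! ### Moments of quadratic forms (second chaos) -/

section QuadraticForms

variable {ι : Type*} [Fintype ι] [DecidableEq ι] (r : ι → ℝ≥0) (a : ι → ι → ℝ)

/-- The quadratic form `∑ i j, a i j * X i * X j` in centered Poisson variables. -/
noncomputable def quadForm (k : ι → ℕ) : ℝ := ∑ i, centered r i k * linForm r (a i) k

/-- The contraction `∑ l, r l * a l i * a l j`. -/
def matContr (i j : ι) : ℝ := ∑ l, r l * a l i * a l j

/-- The squared norm of a matrix with weights `r`. -/
def matSq : ℝ := ∑ i, r i * matContr r a i i

lemma ExpBdd.quadForm : ExpBdd (quadForm r a) :=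
  ExpBdd.sum fun i _ => (ExpBdd.centered r i).mul (ExpBdd.linForm r _)

variable {a} (hs : ∀ i j, a i j = a j i) (h0 : ∀ i, a i i = 0)

include hs h0 in
-- The zero diagonal removes the second-order term a_ii, and symmetry merges the row and the column
-- into one linear form.
lemma quadForm_addPoint (i : ι) (k : ι → ℕ) :
    quadForm r a (addPoint i k) = quadForm r a k + 2 * linForm r (a i) k := by
  simp only [PoissonCLT.quadForm, centered_addPoint, linForm_addPoint, add_mul, mul_add,
    Finset.sum_add_distrib, ite_mul, one_mul, zero_mul, Finset.sum_ite_eq', Finset.mem_univ,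
    if_true, h0, add_zero]
  have : ∑ j, centered r j k * a j i = linForm r (a i) k :=
    Finset.sum_congr rfl fun j _ => by rw [hs j i, mul_comm]
  rw [this]
  ring

include h0 in
-- Since a_ii = 0, the row form L_i ignores a point added in cell i and factors out of the
-- difference. Only one of the two factors X_i X_j is integrated by parts; the other remains inside
-- L_i.
lemma integral_quadForm_smul {E : Type*} [NormedAddCommGroup E] [NormedSpace ℝ E]
    {G : (ι → ℕ) → E} (hG : ExpBdd G) :
    ∫ k, quadForm r a k • G k ∂(piPoisson r)
      = ∑ i, (r i : ℝ) • ∫ k, linForm r (a i) k • (G (addPoint i k) - G k) ∂(piPoisson r) := by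
  simp only [PoissonCLT.quadForm, Finset.sum_smul, mul_smul]
  rw [integral_finsetSum _ fun i _ =>
    ((ExpBdd.centered r i).smul ((ExpBdd.linForm r _).smul hG)).integrable r]
  refine Finset.sum_congr rfl fun i _ => ?_
  rw [integral_centered_smul r i ((ExpBdd.linForm r _).smul hG)]
  simp only [linForm_addPoint, h0, add_zero, smul_sub]

include h0 in
lemma integral_quadForm : ∫ k, quadForm r a k ∂(piPoisson r) = 0 := by
  have := integral_quadForm_smul r h0 (ExpBdd.const (ι := ι) (1 : ℝ))
  simpa using this

include h0 in
lemma integral_quadForm_mul_linForm (b : ι → ℝ) :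
    ∫ k, quadForm r a k * linForm r b k ∂(piPoisson r) = 0 := by
  have := integral_quadForm_smul r h0 (ExpBdd.linForm r b)
  simp only [smul_eq_mul, linForm_addPoint, add_sub_cancel_left, integral_mul_const,
    integral_linForm] at this
  simpa using this

include hs in
lemma integral_row_mul (i j : ι) :
    ∫ k, linForm r (a i) k * linForm r (a j) k ∂(piPoisson r) = matContr r a i j := by
  rw [integral_linForm_mul]
  exact Finset.sum_congr rfl fun l _ => by rw [hs i l, hs j l]; ring

include hs h0 in
lemma integral_quadForm_sq : ∫ k, quadForm r a k ^ 2 ∂(piPoisson r) = 2 * matSq r a := by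
  have := integral_quadForm_smul r h0 (ExpBdd.quadForm r a)
  simp only [smul_eq_mul, quadForm_addPoint r hs h0, add_sub_cancel_left] at this
  simp only [pow_two]
  rw [this, matSq, Finset.mul_sum]
  refine Finset.sum_congr rfl fun i _ => ?_
  have h : ∀ k, linForm r (a i) k * (2 * linForm r (a i) k)
    = 2 * (linForm r (a i) k * linForm r (a i) k) := fun k => by ring
  simp only [h]
  rw [integral_const_mul, integral_row_mul r hs]
  ring

/-- Half the integral of the squared difference operator of the quadratic form. -/
noncomputable def halfGrad (a : ι → ι → ℝ) (k : ι → ℕ) : ℝ := 2 * ∑ i, r i * linForm r (a i) k ^ 2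

lemma ExpBdd.halfGrad (a : ι → ι → ℝ) : ExpBdd (halfGrad r a) :=
  (ExpBdd.const 2).mul (ExpBdd.sum fun i _ => (ExpBdd.const _).mul ((ExpBdd.linForm r _).pow 2))

include hs in
-- This is a quadratic form in the contracted matrix, whose diagonal does not vanish in general. It
-- therefore needs two integrations by parts with a diagonal correction, unlike `quadForm`.
lemma halfGrad_eq (k : ι → ℕ) : halfGrad r a k
    = 2 * ∑ i, ∑ j, matContr r a i j * (centered r i k * centered r j k) := by
  simp only [PoissonCLT.halfGrad, PoissonCLT.linForm, matContr, pow_two, Finset.sum_mul_sum,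
    Finset.mul_sum, Finset.sum_mul]
  rw [Finset.sum_comm]
  refine Finset.sum_congr rfl fun i _ => ?_
  rw [Finset.sum_comm]
  refine Finset.sum_congr rfl fun j _ => Finset.sum_congr rfl fun l _ => ?_
  rw [hs l i, hs l j]
  ring

include hs in
lemma integral_halfGrad : ∫ k, halfGrad r a k ∂(piPoisson r) = 2 * matSq r a := by
  simp only [PoissonCLT.halfGrad]
  rw [integral_const_mul, integral_finsetSum _ fun i _ =>
    (((ExpBdd.const (r i : ℝ)).mul ((ExpBdd.linForm r (a i)).pow 2)).integrable r), matSq]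
  congr 1
  refine Finset.sum_congr rfl fun i _ => ?_
  rw [integral_const_mul]
  simp only [pow_two]
  rw [integral_row_mul r hs]

/-- Integrate by parts in i, then in j. The extra term for i = j appears because X_i itself jumps by
1 when a point is added in cell i. -/
lemma integral_centered_mul_centered_mul (i j : ι) {G : (ι → ℕ) → ℝ} (hG : ExpBdd G) :
    ∫ k, centered r i k * centered r j k * G k ∂(piPoisson r)
      = r i * r j * ∫ k, (G (addPoint i (addPoint j k)) - G (addPoint j k) -
          (G (addPoint i k) - G k)) ∂(piPoisson r)
        + if j = i then r i * ∫ k, G (addPoint i k) ∂(piPoisson r) else 0 := by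
  have h1 := integral_centered_smul r i ((ExpBdd.centered r j).mul hG)
  simp only [smul_eq_mul, centered_addPoint] at h1
  simp only [mul_assoc] at h1 ⊢
  rw [h1]
  have hD := (hG.comp_addPoint i).sub hG
  have h2 := integral_centered_smul r j hD
  simp only [smul_eq_mul] at h2
  have h3 : ∀ k, (centered r j k + if j = i then 1 else 0) * G (addPoint i k) - centered r j k * G k
    = centered r j k * (G (addPoint i k) - G k) + (if j = i then G (addPoint i k) else 0) := by
    intro k; split_ifs <;> ring
  simp only [h3]
  rw [integral_add (((ExpBdd.centered r j).mul hD).integrable r), h2]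
  · split_ifs
    · ring
    · simp
  · split_ifs
    · exact (hG.comp_addPoint i).integrable r
    · exact integrable_zero _ _ _

include hs in
lemma integral_halfGrad_mul {G : (ι → ℕ) → ℝ} (hG : ExpBdd G) :
    ∫ k, halfGrad r a k * G k ∂(piPoisson r)
      = 2 * ∑ i, ∑ j, matContr r a i j * (r i * r j) *
          ∫ k, (G (addPoint i (addPoint j k)) - G (addPoint j k) -
          (G (addPoint i k) - G k)) ∂(piPoisson r)
        + 2 * ∑ i, matContr r a i i * (r i * ∫ k, G (addPoint i k) ∂(piPoisson r)) := by
  simp only [halfGrad_eq r hs, mul_assoc, Finset.sum_mul]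
  rw [integral_const_mul, integral_finsetSum _ fun i _ => ?_, ← mul_add,
    ← Finset.sum_add_distrib]
  · congr 1
    refine Finset.sum_congr rfl fun i _ => ?_
    rw [integral_finsetSum _ fun j _ => ?_]
    · have : ∀ j, ∫ k, matContr r a i j * (centered r i k * (centered r j k * G k)) ∂(piPoisson r)
        = matContr r a i j * (r i * (r j *
          ∫ k, (G (addPoint i (addPoint j k)) - G (addPoint j k) -
          (G (addPoint i k) - G k)) ∂(piPoisson r)))
        + if j = i then matContr r a i j * (r i * ∫ k, G (addPoint i k) ∂(piPoisson r))
          else 0 := by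
        intro j
        rw [integral_const_mul]
        simp only [← mul_assoc (centered r i _)]
        rw [integral_centered_mul_centered_mul r i j hG]
        split_ifs <;> ring
      simp only [this, Finset.sum_add_distrib]
      simp
    · exact ((ExpBdd.const _).mul ((ExpBdd.centered r i).mul
        ((ExpBdd.centered r j).mul hG))).integrable r
  · exact (ExpBdd.sum fun j _ => ((ExpBdd.const _).mul ((ExpBdd.centered r i).mul
        ((ExpBdd.centered r j).mul hG)))).integrable r

lemma halfGrad_addPoint (i : ι) (k : ι → ℕ) : halfGrad r a (addPoint i k)
    = halfGrad r a k + (4 * ∑ l, r l * a l i * linForm r (a l) k + 2 * matContr r a i i) := by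
  simp only [PoissonCLT.halfGrad, linForm_addPoint, matContr, Finset.mul_sum,
    ← Finset.sum_add_distrib]
  exact Finset.sum_congr rfl fun l _ => by ring

include hs in
-- The second differences of `halfGrad` are the constants 4 c_ij, where c is the contracted matrix.
-- The terms after the squared mean are thus the variance: small exactly when both contractions are
-- small.
lemma integral_halfGrad_sq : ∫ k, halfGrad r a k ^ 2 ∂(piPoisson r)
    = (2 * matSq r a) ^ 2 + 8 * ∑ i, ∑ j, r i * r j * matContr r a i j ^ 2
      + 4 * ∑ i, r i * matContr r a i i ^ 2 := by
  have h := integral_halfGrad_mul r hs (ExpBdd.halfGrad r a)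
  simp only [pow_two (PoissonCLT.halfGrad r a _)]
  rw [h]
  have h1 : ∀ i j k, halfGrad r a (addPoint i (addPoint j k)) - halfGrad r a (addPoint j k) -
      (halfGrad r a (addPoint i k) - halfGrad r a k) = 4 * matContr r a i j := by
    intro i j k
    rw [halfGrad_addPoint r i (addPoint j k), halfGrad_addPoint r i k]
    simp only [linForm_addPoint, mul_add, Finset.sum_add_distrib, matContr]
    ring
  have h2 : ∀ i, ∫ k, halfGrad r a (addPoint i k) ∂(piPoisson r)
      = 2 * matSq r a + 2 * matContr r a i i := by
    intro i
    simp only [halfGrad_addPoint r i]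
    have hb : ExpBdd (fun k => ∑ l, r l * a l i * linForm r (a l) k) :=
      ExpBdd.sum fun l _ => (ExpBdd.const _).mul (ExpBdd.linForm r _)
    rw [(ExpBdd.halfGrad r a).integral_add r ((hb.const_mul _).add (ExpBdd.const _)),
      (hb.const_mul _).integral_add r (ExpBdd.const _), integral_const_mul,
      integral_finsetSum _ fun l _ => ((ExpBdd.linForm r _).integrable r).const_mul _]
    simp [integral_const_mul, integral_linForm, integral_halfGrad r hs]
  simp only [h1, h2, integral_const, probReal_univ, smul_eq_mul, one_mul]
  have e1 : ∑ i, matContr r a i i * (r i * (2 * matSq r a + 2 * matContr r a i i))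
    = 2 * matSq r a * matSq r a + 2 * ∑ i, r i * matContr r a i i ^ 2 := by
    conv_rhs => enter [1, 2]; rw [matSq]
    rw [Finset.mul_sum, Finset.mul_sum, ← Finset.sum_add_distrib]
    exact Finset.sum_congr rfl fun i _ => by ring
  have e2 : ∑ i, ∑ j, matContr r a i j * (r i * r j) * (4 * matContr r a i j)
    = 4 * ∑ i, ∑ j, r i * r j * matContr r a i j ^ 2 := by
    simp only [Finset.mul_sum]
    exact Finset.sum_congr rfl fun i _ => Finset.sum_congr rfl fun j _ => by ring
  rw [e1, e2]
  ring

include hs h0 in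
lemma integral_halfGrad_mul_quadForm_sq :
    ∫ k, halfGrad r a k * quadForm r a k ^ 2 ∂(piPoisson r)
    = 16 * (∑ i, ∑ j, r i * r j * matContr r a i j ^ 2)
      + 8 * (∑ i, ∑ j, r i * r j * (matContr r a i j * a i j ^ 2))
      + 4 * matSq r a ^ 2 + 8 * ∑ i, r i * matContr r a i i ^ 2 := by
  have hQ := ExpBdd.quadForm r a
  rw [integral_halfGrad_mul r hs (hQ.pow 2)]
  have h1 : ∀ i j, ∫ k, (quadForm r a (addPoint i (addPoint j k)) ^ 2
      - quadForm r a (addPoint j k) ^ 2 -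
      (quadForm r a (addPoint i k) ^ 2 - quadForm r a k ^ 2)) ∂(piPoisson r)
      = 8 * matContr r a i j + 4 * a i j ^ 2 := by
    intro i j
    have hi := ExpBdd.linForm r (a i)
    have hj := ExpBdd.linForm r (a j)
    -- The terms are grouped so that the second bracket, made of Q and of linear forms, has mean
    -- zero.
    have : ∀ k, quadForm r a (addPoint i (addPoint j k)) ^ 2
      - quadForm r a (addPoint j k) ^ 2 -
      (quadForm r a (addPoint i k) ^ 2 - quadForm r a k ^ 2)
      = (8 * (linForm r (a i) k * linForm r (a j) k) + 4 * a i j ^ 2)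
        + (4 * a i j * quadForm r a k +
          8 * a i j * (linForm r (a i) k + linForm r (a j) k)) := by
      intro k
      simp only [quadForm_addPoint r hs h0, linForm_addPoint]
      ring
    simp only [this]
    rw [(((hi.mul hj).const_mul _).add (ExpBdd.const _)).integral_add r
        ((hQ.const_mul _).add ((hi.add hj).const_mul _)),
      ((hi.mul hj).const_mul _).integral_add r (ExpBdd.const _),
      (hQ.const_mul _).integral_add r ((hi.add hj).const_mul _),
      integral_const_mul, integral_const_mul, integral_const_mul, integral_const_mul, integral_row_mul r hs,
      integral_quadForm r h0, hi.integral_add r hj,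
      integral_linForm, integral_linForm]
    simp
  have h2 : ∀ i, ∫ k, quadForm r a (addPoint i k) ^ 2 ∂(piPoisson r)
      = 2 * matSq r a + 4 * matContr r a i i := by
    intro i
    have hi := ExpBdd.linForm r (a i)
    have : ∀ k, quadForm r a (addPoint i k) ^ 2 = quadForm r a k ^ 2
      + (4 * (quadForm r a k * linForm r (a i) k)
        + 4 * (linForm r (a i) k * linForm r (a i) k)) := by
      intro k
      rw [quadForm_addPoint r hs h0]
      ring
    simp only [this]
    rw [(hQ.pow 2).integral_add r (((hQ.mul hi).const_mul _).add ((hi.mul hi).const_mul _)),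
      ((hQ.mul hi).const_mul _).integral_add r ((hi.mul hi).const_mul _), integral_const_mul, integral_const_mul,
      integral_quadForm_mul_linForm r h0, integral_row_mul r hs, integral_quadForm_sq r hs h0]
    ring
  simp only [h1, h2]
  have e1 : ∑ i, matContr r a i i * (r i * (2 * matSq r a + 4 * matContr r a i i))
    = 2 * matSq r a * matSq r a + 4 * ∑ i, r i * matContr r a i i ^ 2 := by
    conv_rhs => enter [1, 2]; rw [matSq]
    rw [Finset.mul_sum, Finset.mul_sum, ← Finset.sum_add_distrib]
    exact Finset.sum_congr rfl fun i _ => by ring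
  have e2 : ∑ i, ∑ j, matContr r a i j * (r i * r j) * (8 * matContr r a i j + 4 * a i j ^ 2)
    = 8 * (∑ i, ∑ j, r i * r j * matContr r a i j ^ 2)
      + 4 * (∑ i, ∑ j, r i * r j * (matContr r a i j * a i j ^ 2)) := by
    simp only [Finset.mul_sum, ← Finset.sum_add_distrib]
    exact Finset.sum_congr rfl fun i _ => Finset.sum_congr rfl fun j _ => by ring
  rw [e1, e2]
  ring

include hs h0 in
-- Integrating Q by parts against L_i³ leaves two terms. After renaming summation indices each of
-- them is 3⟨c, a²⟩, with c the contracted matrix.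
lemma sum_integral_quadForm_mul_row_pow_three :
    ∑ i, r i * ∫ k, quadForm r a k * linForm r (a i) k ^ 3 ∂(piPoisson r)
    = 6 * ∑ i, ∑ j, r i * r j * (matContr r a i j * a i j ^ 2) := by
  have h : ∀ i, ∫ k, quadForm r a k * linForm r (a i) k ^ 3 ∂(piPoisson r)
      = ∑ j, r j * (3 * a i j * (∑ l, a j l * a i l ^ 2 * r l)
          + 3 * a i j ^ 2 * matContr r a i j) := by
    intro i
    have hi := ExpBdd.linForm r (a i)
    have := integral_quadForm_smul r h0 (hi.pow 3)
    simp only [smul_eq_mul, linForm_addPoint] at this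
    rw [this]
    refine Finset.sum_congr rfl fun j _ => ?_
    have hj := ExpBdd.linForm r (a j)
    have e : ∀ k, linForm r (a j) k * ((linForm r (a i) k + a i j) ^ 3 - linForm r (a i) k ^ 3)
      = 3 * a i j * (linForm r (a j) k * linForm r (a i) k ^ 2)
        + (3 * a i j ^ 2 * (linForm r (a i) k * linForm r (a j) k)
          + a i j ^ 3 * linForm r (a j) k) := by intro k; ring
    simp only [e]
    rw [((hj.mul (hi.pow 2)).const_mul _).integral_add r
        (((hi.mul hj).const_mul _).add (hj.const_mul _)),
      ((hi.mul hj).const_mul _).integral_add r (hj.const_mul _),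
      integral_const_mul, integral_const_mul, integral_const_mul, integral_row_mul r hs,
      integral_linForm, integral_linForm_mul_sq]
    ring
  simp only [h, mul_add, Finset.sum_add_distrib, Finset.mul_sum]
  have e1 : ∑ i, ∑ j, ∑ l, (r i : ℝ) * (r j * (3 * a i j * (a j l * a i l ^ 2 * r l)))
      = 3 * ∑ i, ∑ l, r i * r l * (matContr r a i l * a i l ^ 2) := by
    simp only [matContr, Finset.mul_sum, Finset.sum_mul]
    refine Finset.sum_congr rfl fun i _ => ?_
    rw [Finset.sum_comm]
    refine Finset.sum_congr rfl fun l _ => Finset.sum_congr rfl fun j _ => ?_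
    rw [hs j i]
    ring
  have e2 : ∑ i, ∑ j, (r i : ℝ) * (r j * (3 * a i j ^ 2 * matContr r a i j))
      = 3 * ∑ i, ∑ l, r i * r l * (matContr r a i l * a i l ^ 2) := by
    simp only [Finset.mul_sum]
    exact Finset.sum_congr rfl fun i _ => Finset.sum_congr rfl fun l _ => by ring
  rw [e1, e2]
  simp only [Finset.mul_sum, ← Finset.sum_add_distrib]
  exact Finset.sum_congr rfl fun i _ => Finset.sum_congr rfl fun l _ => by ring

include hs in
lemma sum_integral_row_pow_four :
    ∑ i, r i * ∫ k, linForm r (a i) k ^ 4 ∂(piPoisson r)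
    = 3 * (∑ i, r i * matContr r a i i ^ 2) + ∑ i, ∑ j, r i * r j * a i j ^ 4 := by
  simp only [integral_linForm_pow_four, Finset.mul_sum]
  rw [← Finset.sum_add_distrib]
  refine Finset.sum_congr rfl fun i _ => ?_
  have : ∑ j, a i j ^ 2 * r j = matContr r a i i :=
    Finset.sum_congr rfl fun j _ => by rw [hs i j]; ring
  rw [this, mul_add, Finset.mul_sum]
  congr 1
  · ring
  · exact Finset.sum_congr rfl fun i _ => by ring

include hs h0 in
/-- The fourth moment of a quadratic form in centered Poisson variables. -/
lemma integral_quadForm_pow_four : ∫ k, quadForm r a k ^ 4 ∂(piPoisson r)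
    = 12 * matSq r a ^ 2 + 48 * (∑ i, ∑ j, r i * r j * matContr r a i j ^ 2)
      + 48 * (∑ i, r i * matContr r a i i ^ 2)
      + 96 * (∑ i, ∑ j, r i * r j * (matContr r a i j * a i j ^ 2))
      + 8 * ∑ i, ∑ j, r i * r j * a i j ^ 4 := by
  have hQ := ExpBdd.quadForm r a
  have h := integral_quadForm_smul r h0 (hQ.pow 3)
  simp only [smul_eq_mul, quadForm_addPoint r hs h0] at h
  simp only [pow_succ' _ 3]
  rw [h]
  have h1 : ∀ i, (r i : ℝ) * ∫ k, linForm r (a i) k *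
      ((quadForm r a k + 2 * linForm r (a i) k) ^ 3 - quadForm r a k ^ 3) ∂(piPoisson r)
      = (∫ k, 6 * (r i * linForm r (a i) k ^ 2 * quadForm r a k ^ 2) ∂(piPoisson r))
        + 12 * (r i * ∫ k, quadForm r a k * linForm r (a i) k ^ 3 ∂(piPoisson r))
        + 8 * (r i * ∫ k, linForm r (a i) k ^ 4 ∂(piPoisson r)) := by
    intro i
    have hi := ExpBdd.linForm r (a i)
    -- Expansion of L((Q + 2L)³ − Q³): its three terms are the three mixed moments computed above.
    have e : ∀ k, linForm r (a i) k *
      ((quadForm r a k + 2 * linForm r (a i) k) ^ 3 - quadForm r a k ^ 3)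
      = 6 * (linForm r (a i) k ^ 2 * quadForm r a k ^ 2)
        + (12 * (quadForm r a k * linForm r (a i) k ^ 3) + 8 * linForm r (a i) k ^ 4) := by
      intro k; ring
    simp only [e]
    rw [(((hi.pow 2).mul (hQ.pow 2)).const_mul _).integral_add r
        (((hQ.mul (hi.pow 3)).const_mul _).add ((hi.pow 4).const_mul _)),
      ((hQ.mul (hi.pow 3)).const_mul _).integral_add r ((hi.pow 4).const_mul _)]
    simp only [integral_const_mul, mul_assoc]
    ring
  simp only [h1, Finset.sum_add_distrib]
  rw [← Finset.mul_sum, ← Finset.mul_sum, sum_integral_quadForm_mul_row_pow_three r hs h0,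
    sum_integral_row_pow_four r hs, ← integral_finsetSum _ fun i _ =>
      ((ExpBdd.const _).mul (((ExpBdd.const _).mul ((ExpBdd.linForm r _).pow 2)).mul
        (hQ.pow 2))).integrable r]
  -- The factor 2 built into `halfGrad` turns 6 into 3.
  have e : ∀ k, ∑ i, 6 * (r i * linForm r (a i) k ^ 2 * quadForm r a k ^ 2)
    = 3 * (halfGrad r a k * quadForm r a k ^ 2) := by
    intro k
    simp only [PoissonCLT.halfGrad, Finset.mul_sum, Finset.sum_mul]
    exact Finset.sum_congr rfl fun i _ => by ring
  simp only [e]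
  rw [integral_const_mul, integral_halfGrad_mul_quadForm_sq r hs h0]
  ring

end QuadraticForms

/-! ### Characteristic function of a quadratic form -/

section CharFun

lemma norm_sub_le_of_norm_deriv_le_abs {g g' : ℝ → ℂ} {C t : ℝ}
    (hg : ∀ s, HasDerivAt g (g' s) s) (hC : ∀ s, |s| ≤ |t| → ‖g' s‖ ≤ C) :
    ‖g t - g 0‖ ≤ C * |t| := by
  have := (convex_closedBall (0 : ℝ) |t|).norm_image_sub_le_of_norm_hasDerivWithin_le
    (f := g) (f' := g') (C := C) (x := 0) (y := t) (fun s _ => (hg s).hasDerivWithinAt)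
    (fun s hs => hC s (by simpa using hs)) (by simp) (by simp)
  simpa using this

lemma norm_cexp_mul_I_sub_one_le (x : ℝ) : ‖Complex.exp (x * Complex.I) - 1‖ ≤ |x| := by
  have := Real.norm_exp_I_mul_ofReal_sub_one_le (x := x)
  rwa [mul_comm] at this

lemma hasDerivAt_cexp_mul_I (c s : ℝ) : HasDerivAt (fun s : ℝ => Complex.exp ((s * c : ℝ) * Complex.I))
    (Complex.exp ((s * c : ℝ) * Complex.I) * (c * Complex.I)) s := by
  have h1 : HasDerivAt (fun s : ℝ => ((s * c : ℝ) : ℂ) * Complex.I) (c * Complex.I) s := by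
    have h := ((hasDerivAt_id s).mul_const c).ofReal_comp.mul_const Complex.I
    simpa using h
  exact h1.cexp

/-- Mean value inequality for a derivative of modulus at most |s| ≤ |x|. The constant 1 instead of
1/2 is harmless. -/
lemma norm_cexp_mul_I_sub_one_sub_le (x : ℝ) :
    ‖Complex.exp (x * Complex.I) - 1 - x * Complex.I‖ ≤ x ^ 2 := by
  have hd : ∀ s : ℝ, HasDerivAt
      (fun s : ℝ => Complex.exp ((s : ℝ) * Complex.I) - 1 - (s : ℂ) * Complex.I)
      ((Complex.exp (s * Complex.I) - 1) * Complex.I) s := by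
    intro s
    have h1 := hasDerivAt_cexp_mul_I 1 s
    have h2 := ((hasDerivAt_id s).ofReal_comp).mul_const Complex.I
    have := (h1.sub_const 1).sub h2
    simp only [mul_one, Complex.ofReal_one, one_mul, id] at this
    rw [sub_mul, one_mul]
    exact this
  have := norm_sub_le_of_norm_deriv_le_abs (t := x) (C := |x|) hd (fun s hs => by
    rw [norm_mul, Complex.norm_I, mul_one]
    exact (norm_cexp_mul_I_sub_one_le s).trans hs)
  simpa [← abs_mul, ← pow_two] using this

/-- Converse of the weighted AM–GM inequality. It reduces each Cauchy–Schwarz bound below to a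
pointwise inequality, integrated or summed for every weight δ. -/
lemma le_sqrt_mul_of_forall {p q B : ℝ} (hp : 0 ≤ p) (hq : 0 ≤ q)
    (h : ∀ δ > 0, 2 * B ≤ δ * p + q / δ) : B ≤ √(p * q) := by
  rcases le_or_gt B 0 with hB | hB
  · exact hB.trans (Real.sqrt_nonneg _)
  refine Real.le_sqrt_of_sq_le ?_
  have hd : discrim p (-2 * B) q ≤ 0 := by
    -- The polynomial p δ² − 2Bδ + q is nonnegative for δ > 0 by hypothesis, and for δ ≤ 0 because B
    -- > 0.
    refine discrim_le_zero fun δ => ?_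
    rcases le_or_gt δ 0 with hδ | hδ
    · have : 0 ≤ -δ * B := mul_nonneg (by linarith) hB.le
      nlinarith [mul_nonneg hp (mul_self_nonneg δ)]
    · have := h δ hδ
      have h2 := mul_le_mul_of_nonneg_left this hδ.le
      rw [mul_add, mul_div_cancel₀ _ hδ.ne'] at h2
      nlinarith
  unfold discrim at hd
  nlinarith

variable {ι : Type*} [Fintype ι] [DecidableEq ι] (r : ι → ℝ≥0) (a : ι → ι → ℝ)

/-- The function `exp (i t Q)` of a quadratic form `Q`. -/
noncomputable def quadChar (t : ℝ) (k : ι → ℕ) : ℂ :=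
  Complex.exp ((t * quadForm r a k : ℝ) * Complex.I)

lemma norm_quadChar (t : ℝ) (k : ι → ℕ) : ‖quadChar r a t k‖ = 1 := by
  rw [quadChar, Complex.norm_exp_ofReal_mul_I]

lemma ExpBdd.quadChar (t : ℝ) : ExpBdd (quadChar r a t) :=
  ExpBdd.of_bounded 1 fun k => (norm_quadChar r a t k).le

lemma ExpBdd.abs {G : (ι → ℕ) → ℝ} (hG : ExpBdd G) : ExpBdd (fun k => |G k|) := hG.norm

lemma ExpBdd.const_mul_complex {G : (ι → ℕ) → ℂ} (hG : ExpBdd G) (c : ℂ) :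
    ExpBdd (fun k => c * G k) := by
  obtain ⟨C, s, hC, hs, h⟩ := hG
  refine ⟨‖c‖ * C, s, by positivity, hs, fun k => ?_⟩
  rw [norm_mul, mul_assoc]
  exact mul_le_mul_of_nonneg_left (h k) (norm_nonneg c)

lemma hasDerivAt_integral_quadChar (t : ℝ) :
    HasDerivAt (fun t => ∫ k, quadChar r a t k ∂(piPoisson r))
      (Complex.I * ∫ k, quadForm r a k • quadChar r a t k ∂(piPoisson r)) t := by
  have hc : Countable (ι → ℕ) := inferInstance
  have h := hasDerivAt_integral_of_dominated_loc_of_deriv_le (μ := piPoisson r)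
    (F := fun t k => quadChar r a t k) (x₀ := t) (s := Set.univ)
    (F' := fun t k => quadChar r a t k * (quadForm r a k * Complex.I))
    (bound := fun k => ‖quadForm r a k‖) Filter.univ_mem
    (Eventually.of_forall fun t => (StronglyMeasurable.of_discrete).aestronglyMeasurable)
    ((ExpBdd.quadChar r a t).integrable r) (StronglyMeasurable.of_discrete).aestronglyMeasurable
    (ae_of_all _ fun k s _ => by simp [norm_quadChar])
    ((ExpBdd.quadForm r a).norm.integrable r)
    (ae_of_all _ fun k s _ => hasDerivAt_cexp_mul_I _ s)
  refine h.2.congr_deriv ?_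
  rw [← integral_const_mul]
  congr 1
  ext k
  rw [Complex.real_smul]
  ring

variable {a} (hs : ∀ i j, a i j = a j i) (h0 : ∀ i, a i i = 0)

include hs h0 in
-- Integration by parts produces L_i (exp(it(Q + 2L_i)) − exp(itQ)). Its first-order Taylor term
-- sums to it · `halfGrad`, and the remainder is at most |L_i| (2tL_i)² = 4t²|L_i|³.
lemma norm_integral_quadForm_smul_quadChar_sub_le (t : ℝ) :
    ‖∫ k, quadForm r a k • quadChar r a t k ∂(piPoisson r)
      - (t * Complex.I) * ∫ k, halfGrad r a k • quadChar r a t k ∂(piPoisson r)‖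
    ≤ 4 * t ^ 2 * ∑ i, r i * ∫ k, |linForm r (a i) k| ^ 3 ∂(piPoisson r) := by
  have hE := ExpBdd.quadChar r a t
  have hL := fun i => ExpBdd.linForm r (a i)
  have h1 : (t * Complex.I) * ∫ k, halfGrad r a k • quadChar r a t k ∂(piPoisson r)
      = ∑ i, (r i : ℝ) • ∫ k, linForm r (a i) k •
        (((t * (2 * linForm r (a i) k) : ℝ) * Complex.I) * quadChar r a t k) ∂(piPoisson r) := by
    rw [← integral_const_mul]
    simp only [← integral_smul]
    rw [← integral_finsetSum _ fun i _ => ?_]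
    · congr 1
      ext k
      simp only [PoissonCLT.halfGrad, Complex.real_smul]
      push_cast
      rw [Finset.mul_sum, Finset.sum_mul, Finset.mul_sum]
      exact Finset.sum_congr rfl fun i _ => by ring
    · refine ((ExpBdd.const (r i : ℝ)).smul ((hL i).smul (ExpBdd.smul (G := fun k =>
        t * (2 * linForm r (a i) k)) (((hL i).const_mul 2).const_mul t)
        (hE.const_mul_complex Complex.I)))).integrable r |>.congr (ae_of_all _ fun k => ?_)
      simp only [Complex.real_smul]
      ring
  rw [integral_quadForm_smul r h0 hE, h1, ← Finset.sum_sub_distrib, Finset.mul_sum]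
  refine (norm_sum_le _ _).trans (Finset.sum_le_sum fun i _ => ?_)
  rw [← smul_sub, norm_smul, Real.norm_of_nonneg (NNReal.coe_nonneg _), ← integral_sub]
  · rw [mul_left_comm]
    refine mul_le_mul_of_nonneg_left ?_ (r i).2
    rw [← integral_const_mul]
    refine norm_integral_le_of_norm_le (((hL i).abs.pow 3).const_mul _ |>.integrable r)
      (ae_of_all _ fun k => ?_)
    rw [← smul_sub, norm_smul]
    have e : quadChar r a t (addPoint i k) - quadChar r a t k
        - (t * (2 * linForm r (a i) k) : ℝ) * Complex.I * quadChar r a t k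
        = (Complex.exp ((t * (2 * linForm r (a i) k) : ℝ) * Complex.I) - 1
          - (t * (2 * linForm r (a i) k) : ℝ) * Complex.I) * quadChar r a t k := by
      simp only [PoissonCLT.quadChar]
      rw [quadForm_addPoint r hs h0, mul_add t, Complex.ofReal_add, add_mul, Complex.exp_add]
      ring
    rw [e, norm_mul, norm_quadChar, mul_one]
    have := mul_le_mul_of_nonneg_left
      (norm_cexp_mul_I_sub_one_sub_le (t * (2 * linForm r (a i) k))) (norm_nonneg (linForm r (a i) k))
    refine this.trans (le_of_eq ?_)
    rw [Real.norm_eq_abs, mul_pow, mul_pow, ← sq_abs (linForm r (a i) k)]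
    ring
  · exact ((hL i).smul ((hE.comp_addPoint i).sub hE)).integrable r
  · refine ((hL i).smul (ExpBdd.smul (G := fun k =>
        t * (2 * linForm r (a i) k)) (((hL i).const_mul 2).const_mul t)
        (hE.const_mul_complex Complex.I))).integrable r |>.congr (ae_of_all _ fun k => ?_)
    simp only [Complex.real_smul]
    ring

lemma norm_integral_halfGrad_smul_quadChar_sub_le (t : ℝ) :
    ‖∫ k, halfGrad r a k • quadChar r a t k ∂(piPoisson r) - ∫ k, quadChar r a t k ∂(piPoisson r)‖
    ≤ ∫ k, |halfGrad r a k - 1| ∂(piPoisson r) := by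
  have hE := ExpBdd.quadChar r a t
  rw [← integral_sub (((ExpBdd.halfGrad r a).smul hE).integrable r) (hE.integrable r)]
  refine norm_integral_le_of_norm_le
    (((ExpBdd.halfGrad r a).sub (ExpBdd.const 1)).norm.integrable r) (ae_of_all _ fun k => ?_)
  have : halfGrad r a k • quadChar r a t k - quadChar r a t k
      = (halfGrad r a k - 1) • quadChar r a t k := by rw [sub_smul, one_smul]
  rw [this, norm_smul, norm_quadChar, mul_one, Real.norm_eq_abs]

include hs h0 in
-- The characteristic function ψ solves the Gaussian equation ψ' = −tψ up to an error controlled by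
-- the two preceding lemmas. The factor exp(t²/2) integrates the equation.
lemma norm_integral_quadChar_sub_le (t : ℝ) :
    ‖∫ k, quadChar r a t k ∂(piPoisson r) - Complex.exp (-(t ^ 2 / 2 : ℝ))‖
    ≤ t ^ 2 * (∫ k, |halfGrad r a k - 1| ∂(piPoisson r))
      + 4 * |t| ^ 3 * ∑ i, r i * ∫ k, |linForm r (a i) k| ^ 3 ∂(piPoisson r) := by
  set A := ∫ k, |halfGrad r a k - 1| ∂(piPoisson r) with hA
  set B := ∑ i, r i * ∫ k, |linForm r (a i) k| ^ 3 ∂(piPoisson r) with hB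
  have hA0 : 0 ≤ A := integral_nonneg fun k => abs_nonneg _
  have hB0 : 0 ≤ B := Finset.sum_nonneg fun i _ =>
    mul_nonneg (r i).2 (integral_nonneg fun k => by positivity)
  set ψ : ℝ → ℂ := fun t => ∫ k, quadChar r a t k ∂(piPoisson r) with hψ
  set ψ' : ℝ → ℂ := fun t => Complex.I * ∫ k, quadForm r a k • quadChar r a t k ∂(piPoisson r)
  have hd : ∀ s, HasDerivAt ψ (ψ' s) s := hasDerivAt_integral_quadChar r a
  have hε : ∀ s, ‖ψ' s + s * ψ s‖ ≤ |s| * A + 4 * s ^ 2 * B := by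
    intro s
    have e : ψ' s + s * ψ s
        = Complex.I * (∫ k, quadForm r a k • quadChar r a s k ∂(piPoisson r)
          - (s * Complex.I) * ∫ k, halfGrad r a k • quadChar r a s k ∂(piPoisson r))
          - s * (∫ k, halfGrad r a k • quadChar r a s k ∂(piPoisson r)
            - ∫ k, quadChar r a s k ∂(piPoisson r)) := by
      simp only [ψ, ψ']
      linear_combination (s * ∫ k, halfGrad r a k • quadChar r a s k ∂(piPoisson r)) * Complex.I_sq
    rw [e]
    refine (norm_sub_le _ _).trans ?_
    rw [norm_mul, norm_mul, Complex.norm_I, one_mul, Complex.norm_real, Real.norm_eq_abs, add_comm]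
    exact add_le_add (mul_le_mul_of_nonneg_left
      (norm_integral_halfGrad_smul_quadChar_sub_le r s) (abs_nonneg s))
      (norm_integral_quadForm_smul_quadChar_sub_le r hs h0 s)
  set w : ℝ → ℂ := fun s => Complex.exp ((s ^ 2 / 2 : ℝ))
  have hw : ∀ s, HasDerivAt w (w s * s) s := by
    intro s
    have h1 : HasDerivAt (fun s : ℝ => s ^ 2 / 2) s s := by
      have := ((hasDerivAt_id s).pow 2).div_const 2
      simpa using this
    exact h1.ofReal_comp.cexp
  have hwn : ∀ s, ‖w s‖ = Real.exp (s ^ 2 / 2) := fun s => by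
    simp only [w]; rw [← Complex.ofReal_exp, Complex.norm_real, Real.norm_of_nonneg (Real.exp_pos _).le]
  have hprod : ∀ s, HasDerivAt (fun s => ψ s * w s) ((ψ' s + s * ψ s) * w s) s := by
    intro s
    have := (hd s).mul (hw s)
    refine this.congr_deriv ?_
    ring
  -- On |s| ≤ |t| both the error and the weight exp(s²/2) are bounded by their values at t. The
  -- exponential then cancels when the weight is divided out.
  have key := norm_sub_le_of_norm_deriv_le_abs (t := t)
    (C := (|t| * A + 4 * t ^ 2 * B) * Real.exp (t ^ 2 / 2)) hprod (fun s hst => by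
      have hst2 : s ^ 2 ≤ t ^ 2 := sq_le_sq.2 hst
      rw [norm_mul, hwn]
      refine mul_le_mul ((hε s).trans ?_) ?_ (Real.exp_pos _).le (by positivity)
      · gcongr
      · exact Real.exp_le_exp.2 (by linarith))
  have hψ0 : ψ 0 * w 0 = 1 := by simp [ψ, w, quadChar]
  simp only [hψ0] at key
  have hfin : ψ t - Complex.exp (-(t ^ 2 / 2 : ℝ))
      = (ψ t * w t - 1) * Complex.exp (-(t ^ 2 / 2 : ℝ)) := by
    have : w t * Complex.exp (-(t ^ 2 / 2 : ℝ)) = 1 := by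
      simp only [w]
      rw [← Complex.exp_add]; simp
    linear_combination -ψ t * this
  have hn : ‖Complex.exp (-(t ^ 2 / 2 : ℝ))‖ = Real.exp (-(t ^ 2 / 2)) := by
    rw [← Complex.ofReal_neg, ← Complex.ofReal_exp, Complex.norm_real,
      Real.norm_of_nonneg (Real.exp_pos _).le]
  rw [hfin, norm_mul, hn]
  refine (mul_le_mul_of_nonneg_right key (Real.exp_pos _).le).trans (le_of_eq ?_)
  have he : Real.exp (t ^ 2 / 2) * Real.exp (-(t ^ 2 / 2)) = 1 := by
    rw [← Real.exp_add]; simp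
  have ht : t ^ 2 = |t| ^ 2 := (sq_abs t).symm
  calc _ = ((|t| * A + 4 * t ^ 2 * B) * |t|) * (Real.exp (t ^ 2 / 2) * Real.exp (-(t ^ 2 / 2))) := by
        ring
    _ = _ := by rw [he, ht]; ring

include hs in
-- Compare with the mean 2 `matSq`, then bound the first absolute central moment by the square root
-- of the variance.
lemma integral_abs_halfGrad_sub_one_le :
    ∫ k, |halfGrad r a k - 1| ∂(piPoisson r) ≤ |2 * matSq r a - 1|
      + √(8 * (∑ i, ∑ j, r i * r j * matContr r a i j ^ 2)
        + 4 * ∑ i, r i * matContr r a i i ^ 2) := by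
  set v := 8 * (∑ i, ∑ j, r i * r j * matContr r a i j ^ 2)
        + 4 * ∑ i, r i * matContr r a i i ^ 2 with hv
  have hT := ExpBdd.halfGrad r a
  have hTc := hT.sub (ExpBdd.const (2 * matSq r a))
  have hvar : ∫ k, |halfGrad r a k - 2 * matSq r a| ^ 2 ∂(piPoisson r) = v := by
    have e : ∀ k, |halfGrad r a k - 2 * matSq r a| ^ 2 = halfGrad r a k ^ 2
      + (-(4 * matSq r a) * halfGrad r a k + (2 * matSq r a) ^ 2) := fun k => by rw [sq_abs]; ring
    simp only [e]
    rw [(hT.pow 2).integral_add r ((hT.const_mul _).add (ExpBdd.const _)),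
      (hT.const_mul _).integral_add r (ExpBdd.const _), integral_const_mul,
      integral_halfGrad_sq r hs, integral_halfGrad r hs]
    simp only [integral_const, probReal_univ, one_smul]
    rw [hv]; ring
  have hv0 : 0 ≤ v := hvar ▸ integral_nonneg fun k => by positivity
  have h1 : ∫ k, |halfGrad r a k - 2 * matSq r a| ∂(piPoisson r) ≤ √(1 * v) := by
    refine le_sqrt_mul_of_forall zero_le_one hv0 fun δ hδ => ?_
    have : δ * 1 + v / δ
        = ∫ k, (δ + |halfGrad r a k - 2 * matSq r a| ^ 2 * δ⁻¹) ∂(piPoisson r) := by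
      rw [MeasureTheory.integral_add (integrable_const _)
        (((hTc.abs.pow 2).integrable r).mul_const _), integral_mul_const, hvar]
      simp [div_eq_mul_inv]
    rw [this, ← integral_const_mul]
    refine integral_mono ((hTc.abs.integrable r).const_mul _)
      ((integrable_const _).add (((hTc.abs.pow 2).integrable r).mul_const _)) fun k => ?_
    rw [← sub_nonneg]
    have e : δ + |halfGrad r a k - 2 * matSq r a| ^ 2 * δ⁻¹ - 2 * |halfGrad r a k - 2 * matSq r a|
      = (δ - |halfGrad r a k - 2 * matSq r a|) ^ 2 * δ⁻¹ := by field_simp; ring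
    rw [e]; positivity
  rw [one_mul] at h1
  calc _ ≤ ∫ k, (|halfGrad r a k - 2 * matSq r a| + |2 * matSq r a - 1|) ∂(piPoisson r) := by
        refine integral_mono ((hT.sub (ExpBdd.const 1)).abs.integrable r)
          ((hTc.abs.integrable r).add (integrable_const _)) fun k => ?_
        exact abs_sub_le _ _ _
    _ = (∫ k, |halfGrad r a k - 2 * matSq r a| ∂(piPoisson r)) + |2 * matSq r a - 1| := by
        rw [MeasureTheory.integral_add (hTc.abs.integrable r) (integrable_const _)]
        simp
    _ ≤ _ := by linarith

include hs in
-- Cauchy–Schwarz for |L|³ = |L| · L², over cells and expectation at once: the second moments add up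
-- to `matSq`, and the fourth moments are known from `sum_integral_row_pow_four`.
lemma sum_integral_abs_row_pow_three_le :
    ∑ i, r i * ∫ k, |linForm r (a i) k| ^ 3 ∂(piPoisson r)
    ≤ √(matSq r a * (3 * (∑ i, r i * matContr r a i i ^ 2) + ∑ i, ∑ j, r i * r j * a i j ^ 4)) := by
  have hL := fun i => ExpBdd.linForm r (a i)
  have h2 : ∑ i, r i * ∫ k, linForm r (a i) k ^ 2 ∂(piPoisson r) = matSq r a := by
    refine Finset.sum_congr rfl fun i _ => ?_
    simp only [pow_two]
    rw [integral_row_mul r hs]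
  have h4 := sum_integral_row_pow_four r hs
  rw [← h2, ← h4]
  refine le_sqrt_mul_of_forall
    (Finset.sum_nonneg fun i _ => mul_nonneg (r i).2 (integral_nonneg fun k => by positivity))
    (Finset.sum_nonneg fun i _ => mul_nonneg (r i).2 (integral_nonneg fun k => by positivity))
    fun δ hδ => ?_
  rw [Finset.mul_sum, Finset.mul_sum, Finset.sum_div, ← Finset.sum_add_distrib]
  refine Finset.sum_le_sum fun i _ => ?_
  rw [mul_left_comm 2, mul_left_comm δ, mul_div_assoc, ← mul_add]
  refine mul_le_mul_of_nonneg_left ?_ (r i).2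
  rw [← integral_const_mul, ← integral_const_mul, ← integral_div,
    ← MeasureTheory.integral_add ((((hL i).pow 2).integrable r).const_mul _)
      ((((hL i).pow 4).integrable r).div_const _)]
  refine integral_mono ((((hL i).abs.pow 3).integrable r).const_mul _)
    (((((hL i).pow 2).integrable r).const_mul _).add
      ((((hL i).pow 4).integrable r).div_const _)) fun k => ?_
  rw [← sub_nonneg]
  have e4 : linForm r (a i) k ^ 4 = |linForm r (a i) k| ^ 4 := (Even.pow_abs (by decide) _).symm
  have e2 : linForm r (a i) k ^ 2 = |linForm r (a i) k| ^ 2 := (sq_abs _).symm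
  rw [e4, e2]
  have e : δ * |linForm r (a i) k| ^ 2 + |linForm r (a i) k| ^ 4 / δ - 2 * |linForm r (a i) k| ^ 3
    = |linForm r (a i) k| ^ 2 * (δ - |linForm r (a i) k|) ^ 2 / δ := by field_simp; ring
  rw [e]; positivity

end CharFun

/-! ### Step kernels over disjoint cells -/

section StepFunctions

variable {Z : Type*} [MeasurableSpace Z] {ι : Type*} [Fintype ι]

/-- The real indicator function of a set. -/
noncomputable def ind (A : Set Z) (x : Z) : ℝ := A.indicator (fun _ => (1 : ℝ)) x

lemma ind_of_mem {A : Set Z} {x : Z} (h : x ∈ A) : ind A x = 1 := Set.indicator_of_mem h _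

lemma ind_of_notMem {A : Set Z} {x : Z} (h : x ∉ A) : ind A x = 0 := Set.indicator_of_notMem h _

/-- The kernel `∑ i j, a i j * 1_{A i}(x) * 1_{A j}(y)`. -/
noncomputable def stepFun (A : ι → Set Z) (a : ι → ι → ℝ) (p : Z × Z) : ℝ :=
  ∑ i, ∑ j, a i j * (ind (A i) p.1 * ind (A j) p.2)

/-- The function `∑ i, b i * 1_{A i}(x)`. -/
noncomputable def stepFunOne (A : ι → Set Z) (b : ι → ℝ) (x : Z) : ℝ :=
  ∑ i, b i * ind (A i) x

/-- The cells `A i` are measurable, of finite measure and pairwise disjoint. -/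
structure IsCells (μ : Measure Z) (A : ι → Set Z) : Prop where
  measurable : ∀ i, MeasurableSet (A i)
  finite : ∀ i, μ (A i) < ⊤
  disjoint : Pairwise fun i j => Disjoint (A i) (A j)

variable {μ : Measure Z} {A : ι → Set Z}

lemma IsCells.eq_of_mem (hA : IsCells μ A) {i j : ι} {x : Z} (hi : x ∈ A i) (hj : x ∈ A j) :
    j = i := by
  by_contra h
  exact Set.disjoint_left.1 (hA.disjoint h) hj hi

lemma IsCells.sum_ind (hA : IsCells μ A) (b : ι → ℝ) {i : ι} {x : Z} (hi : x ∈ A i) :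
    ∑ j, b j * ind (A j) x = b i := by
  rw [Finset.sum_eq_single i]
  · rw [ind_of_mem hi, mul_one]
  · intro j _ hj
    rw [ind_of_notMem fun h => hj (hA.eq_of_mem hi h), mul_zero]
  · simp

lemma sum_ind_eq_zero (b : ι → ℝ) {x : Z} (hx : ∀ i, x ∉ A i) : ∑ j, b j * ind (A j) x = 0 :=
  Finset.sum_eq_zero fun j _ => by rw [ind_of_notMem (hx j), mul_zero]

lemma stepFun_eq_stepFunOne (a : ι → ι → ℝ) (p : Z × Z) :
    stepFun A a p = stepFunOne A (fun i => stepFunOne A (a i) p.2) p.1 := by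
  simp only [stepFun, stepFunOne, Finset.sum_mul]
  exact Finset.sum_congr rfl fun i _ => Finset.sum_congr rfl fun j _ => by ring

lemma IsCells.stepFunOne_of_mem (hA : IsCells μ A) (b : ι → ℝ) {i : ι} {x : Z} (hi : x ∈ A i) :
    stepFunOne A b x = b i := hA.sum_ind b hi

lemma stepFunOne_of_notMem (b : ι → ℝ) {x : Z} (hx : ∀ i, x ∉ A i) : stepFunOne A b x = 0 :=
  sum_ind_eq_zero b hx

lemma IsCells.stepFun_of_mem (hA : IsCells μ A) (a : ι → ι → ℝ) {i j : ι} {p : Z × Z}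
    (hi : p.1 ∈ A i) (hj : p.2 ∈ A j) : stepFun A a p = a i j := by
  rw [stepFun_eq_stepFunOne, hA.stepFunOne_of_mem _ hi, hA.stepFunOne_of_mem _ hj]

lemma stepFun_of_notMem_left (a : ι → ι → ℝ) {p : Z × Z} (h : ∀ i, p.1 ∉ A i) :
    stepFun A a p = 0 := by
  rw [stepFun_eq_stepFunOne, stepFunOne_of_notMem _ h]

lemma stepFun_of_notMem_right (a : ι → ι → ℝ) {p : Z × Z} (h : ∀ i, p.2 ∉ A i) :
    stepFun A a p = 0 := by
  rw [stepFun_eq_stepFunOne]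
  simp only [stepFunOne_of_notMem _ h]
  simp [stepFunOne]

/-- Disjoint cells allow a function to act on coefficients. The condition φ 0 0 = 0 handles the
points outside all cells. -/
lemma IsCells.map_stepFun (hA : IsCells μ A) (φ : ℝ → ℝ → ℝ) (hφ : φ 0 0 = 0) (a b : ι → ι → ℝ)
    (p : Z × Z) :
    φ (stepFun A a p) (stepFun A b p) = stepFun A (fun i j => φ (a i j) (b i j)) p := by
  by_cases h1 : ∃ i, p.1 ∈ A i
  · by_cases h2 : ∃ j, p.2 ∈ A j
    · obtain ⟨i, hi⟩ := h1
      obtain ⟨j, hj⟩ := h2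
      simp only [hA.stepFun_of_mem _ hi hj]
    · push Not at h2
      simp only [stepFun_of_notMem_right _ h2, hφ]
  · push Not at h1
    simp only [stepFun_of_notMem_left _ h1, hφ]

lemma IsCells.stepFun_pow (hA : IsCells μ A) (a : ι → ι → ℝ) {n : ℕ} (hn : n ≠ 0) (p : Z × Z) :
    stepFun A a p ^ n = stepFun A (fun i j => a i j ^ n) p :=
  hA.map_stepFun (fun x _ => x ^ n) (by simp [hn]) a a p

lemma IsCells.stepFunOne_pow (hA : IsCells μ A) (b : ι → ℝ) {n : ℕ} (hn : n ≠ 0) (x : Z) :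
    stepFunOne A b x ^ n = stepFunOne A (fun i => b i ^ n) x := by
  by_cases h1 : ∃ i, x ∈ A i
  · obtain ⟨i, hi⟩ := h1
    simp only [hA.stepFunOne_of_mem _ hi]
  · push Not at h1
    simp [stepFunOne_of_notMem _ h1, hn]

lemma IsCells.integrable_ind (hA : IsCells μ A) (i : ι) : Integrable (ind (A i)) μ :=
  (integrable_indicator_iff (hA.measurable i)).2 (integrableOn_const (hA.finite i).ne)

lemma IsCells.integral_ind (hA : IsCells μ A) (i : ι) : ∫ x, ind (A i) x ∂μ = μ.real (A i) := by
  have : ind (A i) = (A i).indicator 1 := rfl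
  rw [this, integral_indicator_one (hA.measurable i)]

lemma IsCells.integrable_stepFunOne (hA : IsCells μ A) (b : ι → ℝ) :
    Integrable (stepFunOne A b) μ :=
  integrable_finsetSum _ fun i _ => (hA.integrable_ind i).const_mul _

lemma IsCells.integral_stepFunOne (hA : IsCells μ A) (b : ι → ℝ) :
    ∫ x, stepFunOne A b x ∂μ = ∑ i, b i * μ.real (A i) := by
  simp only [stepFunOne]
  rw [integral_finsetSum _ fun i _ => (hA.integrable_ind i).const_mul _]
  simp only [integral_const_mul, hA.integral_ind]

variable [SigmaFinite μ]

lemma IsCells.integrable_stepFun (hA : IsCells μ A) (a : ι → ι → ℝ) :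
    Integrable (stepFun A a) (μ.prod μ) :=
  integrable_finsetSum _ fun i _ => integrable_finsetSum _ fun j _ =>
    ((hA.integrable_ind i).mul_prod (hA.integrable_ind j)).const_mul _

lemma IsCells.integral_stepFun (hA : IsCells μ A) (a : ι → ι → ℝ) :
    ∫ p, stepFun A a p ∂(μ.prod μ) = ∑ i, ∑ j, μ.real (A i) * μ.real (A j) * a i j := by
  simp only [stepFun]
  rw [integral_finsetSum _ fun i _ => integrable_finsetSum _ fun j _ =>
    ((hA.integrable_ind i).mul_prod (hA.integrable_ind j)).const_mul _]
  refine Finset.sum_congr rfl fun i _ => ?_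
  rw [integral_finsetSum _ fun j _ =>
    ((hA.integrable_ind i).mul_prod (hA.integrable_ind j)).const_mul _]
  refine Finset.sum_congr rfl fun j _ => ?_
  rw [integral_const_mul, integral_prod_mul, hA.integral_ind, hA.integral_ind]
  ring

lemma measurable_stepFun (hA : IsCells μ A) (a : ι → ι → ℝ) :
    Measurable (stepFun A a) := by
  have h : ∀ i, Measurable (ind (A i)) := fun i => measurable_const.indicator (hA.measurable i)
  unfold stepFun
  fun_prop

lemma IsCells.memLp_stepFun (hA : IsCells μ A) (a : ι → ι → ℝ) {n : ℕ} (hn : n ≠ 0) :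
    MemLp (stepFun A a) n (μ.prod μ) := by
  have hm := (measurable_stepFun hA a).aestronglyMeasurable (μ := μ.prod μ)
  rw [← integrable_norm_rpow_iff hm (by simpa using hn) (by simp)]
  refine (hA.integrable_stepFun (fun i j => ‖a i j‖ ^ n)).congr (ae_of_all _ fun p => ?_)
  simp only [ENNReal.toReal_natCast, Real.rpow_natCast]
  exact (hA.map_stepFun (fun x _ => ‖x‖ ^ n) (by simp [hn]) a a p).symm

lemma IsCells.contr11_stepFun (hA : IsCells μ A) (a : ι → ι → ℝ) (p : Z × Z) :
    contr11 μ (stepFun A a) (stepFun A a) p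
      = stepFun A (fun i j => ∑ l, μ.real (A l) * a l i * a l j) p := by
  have hp : ∀ z, stepFun A a (z, p.1) * stepFun A a (z, p.2)
      = stepFunOne A (fun l => stepFunOne A (a l) p.1 * stepFunOne A (a l) p.2) z := by
    intro z
    rw [stepFun_eq_stepFunOne, stepFun_eq_stepFunOne]
    by_cases h1 : ∃ i, z ∈ A i
    · obtain ⟨i, hi⟩ := h1
      simp only [hA.stepFunOne_of_mem _ hi]
    · push Not at h1
      simp [stepFunOne_of_notMem _ h1]
  simp only [contr11, hp]
  rw [hA.integral_stepFunOne]
  by_cases h1 : ∃ i, p.1 ∈ A i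
  · by_cases h2 : ∃ j, p.2 ∈ A j
    · obtain ⟨i, hi⟩ := h1
      obtain ⟨j, hj⟩ := h2
      simp only [hA.stepFun_of_mem _ hi hj, hA.stepFunOne_of_mem _ hi, hA.stepFunOne_of_mem _ hj]
      exact Finset.sum_congr rfl fun l _ => by ring
    · push Not at h2
      simp [stepFun_of_notMem_right _ h2, stepFunOne_of_notMem _ h2]
  · push Not at h1
    simp [stepFun_of_notMem_left _ h1, stepFunOne_of_notMem _ h1]

lemma IsCells.contr21_stepFun (hA : IsCells μ A) (a : ι → ι → ℝ) (x : Z) :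
    contr21 μ (stepFun A a) (stepFun A a) x
      = stepFunOne A (fun i => ∑ l, μ.real (A l) * a l i * a l i) x := by
  have h := hA.contr11_stepFun a (x, x)
  have h' : contr21 μ (stepFun A a) (stepFun A a) x = contr11 μ (stepFun A a) (stepFun A a) (x, x) :=
    rfl
  rw [h', h]
  by_cases h1 : ∃ i, x ∈ A i
  · obtain ⟨i, hi⟩ := h1
    rw [hA.stepFunOne_of_mem _ hi, hA.stepFun_of_mem _ hi hi]
  · push Not at h1
    rw [stepFunOne_of_notMem _ h1, stepFun_of_notMem_left _ h1]

/-- The intensities of the cells. -/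
noncomputable def cellRate (μ : Measure Z) (A : ι → Set Z) (i : ι) : ℝ≥0 := (μ (A i)).toNNReal

lemma coe_cellRate (i : ι) : (cellRate μ A i : ℝ) = μ.real (A i) := rfl

/-- This identity and the next four form the dictionary between the weighted matrix sums of the
Poisson computations and the integrals of kernels and contractions. -/
lemma IsCells.integral_stepFun_sq (hA : IsCells μ A) (a : ι → ι → ℝ) :
    ∫ p, stepFun A a p ^ 2 ∂(μ.prod μ) = matSq (cellRate μ A) a := by
  simp only [hA.stepFun_pow a two_ne_zero, hA.integral_stepFun, matSq, matContr, coe_cellRate,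
    Finset.mul_sum]
  rw [Finset.sum_comm]
  exact Finset.sum_congr rfl fun i _ => Finset.sum_congr rfl fun j _ => by ring

lemma IsCells.integral_stepFun_pow_four (hA : IsCells μ A) (a : ι → ι → ℝ) :
    ∫ p, stepFun A a p ^ 4 ∂(μ.prod μ)
      = ∑ i, ∑ j, cellRate μ A i * cellRate μ A j * a i j ^ 4 := by
  simp only [hA.stepFun_pow a four_ne_zero, hA.integral_stepFun, coe_cellRate]

lemma IsCells.integral_contr11_sq (hA : IsCells μ A) (a : ι → ι → ℝ) :
    ∫ p, contr11 μ (stepFun A a) (stepFun A a) p ^ 2 ∂(μ.prod μ)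
      = ∑ i, ∑ j, cellRate μ A i * cellRate μ A j * matContr (cellRate μ A) a i j ^ 2 := by
  simp only [hA.contr11_stepFun, hA.stepFun_pow _ two_ne_zero, hA.integral_stepFun, matContr,
    coe_cellRate]

lemma IsCells.integral_contr11_mul_sq (hA : IsCells μ A) (a : ι → ι → ℝ) :
    ∫ p, contr11 μ (stepFun A a) (stepFun A a) p * stepFun A a p ^ 2 ∂(μ.prod μ)
      = ∑ i, ∑ j, cellRate μ A i * cellRate μ A j *
          (matContr (cellRate μ A) a i j * a i j ^ 2) := by
  simp only [hA.contr11_stepFun, hA.map_stepFun (fun x y => x * y ^ 2) (by simp),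
    hA.integral_stepFun, matContr, coe_cellRate]

lemma IsCells.integral_contr21_sq (hA : IsCells μ A) (a : ι → ι → ℝ) :
    ∫ x, contr21 μ (stepFun A a) (stepFun A a) x ^ 2 ∂μ
      = ∑ i, cellRate μ A i * matContr (cellRate μ A) a i i ^ 2 := by
  simp only [hA.contr21_stepFun, hA.stepFunOne_pow _ two_ne_zero, hA.integral_stepFunOne, matContr,
    coe_cellRate]
  exact Finset.sum_congr rfl fun i _ => mul_comm _ _

end StepFunctions

/-! ### The random measure on cells and its additivity -/

section RandomMeasure

variable {Z Ω : Type*} [MeasurableSpace Z] [MeasurableSpace Ω] {μ : Measure Z}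
  {P : Measure Ω} {M : Set Z → Ω → ℝ} {ι : Type*} [Fintype ι]

/-- The double integral of `stepFun A a`. -/
noncomputable def stepInt (M : Set Z → Ω → ℝ) (A : ι → Set Z) (a : ι → ι → ℝ) (ω : Ω) : ℝ :=
  ∑ i, ∑ j, a i j * (M (A i) ω * M (A j) ω)

lemma IsCompensatedPoisson.hasLaw_cells [IsProbabilityMeasure P] (hM : IsCompensatedPoisson μ P M)
    {A : ι → Set Z} (hA : IsCells μ A) :
    HasLaw (fun ω i => M (A i) ω)
      ((piPoisson (cellRate μ A)).map fun k i => centered (cellRate μ A) i k) P := by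
  have hind : iIndepFun (fun i => M (A i)) P := by
    let e := Fintype.equivFin ι
    have h := hM.indep (Fintype.card ι) (fun i => A (e.symm i)) (fun i => hA.measurable _)
      (fun i => hA.finite _) (fun i j hij => hA.disjoint fun h => hij (e.symm.injective h))
    have := h.precomp e.injective
    simpa using this
  have hlaw := fun i => hM.law (A i) (hA.measurable i) (hA.finite i)
  have h := hind.hasLaw_pi hlaw
  convert h using 1
  exact (Measure.pi_map_pi (μ := fun i => poissonMeasure (cellRate μ A i))
    (f := fun i (n : ℕ) => (n : ℝ) - μ.real (A i))
    (fun i => (measurable_of_countable _).aemeasurable))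

variable [DecidableEq ι]

lemma quadForm_eq (r : ι → ℝ≥0) (a : ι → ι → ℝ) (k : ι → ℕ) :
    quadForm r a k = ∑ i, ∑ j, a i j * (centered r i k * centered r j k) := by
  simp only [quadForm, linForm, Finset.mul_sum]
  exact Finset.sum_congr rfl fun i _ => Finset.sum_congr rfl fun j _ => by ring

/-- The integral is a fixed polynomial in the values on the cells, and these are independent centred
Poisson variables by `hasLaw_cells`. Every moment on Ω thus becomes one on `ι → ℕ`. -/
lemma IsCompensatedPoisson.map_stepInt [IsProbabilityMeasure P] (hM : IsCompensatedPoisson μ P M)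
    {A : ι → Set Z} (hA : IsCells μ A) (a : ι → ι → ℝ) :
    AEMeasurable (stepInt M A a) P ∧
    P.map (stepInt M A a) = (piPoisson (cellRate μ A)).map (quadForm (cellRate μ A) a) := by
  have h := hM.hasLaw_cells hA
  have hφ : Measurable fun x : ι → ℝ => ∑ i, ∑ j, a i j * (x i * x j) := by fun_prop
  refine ⟨hφ.comp_aemeasurable h.aemeasurable, ?_⟩
  have h1 : stepInt M A a = (fun x : ι → ℝ => ∑ i, ∑ j, a i j * (x i * x j)) ∘
    fun ω i => M (A i) ω := rfl
  rw [h1, ← AEMeasurable.map_map_of_aemeasurable hφ.aemeasurable h.aemeasurable, h.map_eq,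
    Measure.map_map hφ (measurable_nat_pi _)]
  congr 1
  ext k
  rw [quadForm_eq]
  rfl

lemma IsCompensatedPoisson.integral_stepInt [IsProbabilityMeasure P]
    (hM : IsCompensatedPoisson μ P M) {A : ι → Set Z} (hA : IsCells μ A) (a : ι → ι → ℝ)
    {E : Type*} [NormedAddCommGroup E] [NormedSpace ℝ E] {φ : ℝ → E} (hφ : StronglyMeasurable φ) :
    ∫ ω, φ (stepInt M A a ω) ∂P
      = ∫ k, φ (quadForm (cellRate μ A) a k) ∂(piPoisson (cellRate μ A)) := by
  have h := hM.map_stepInt hA a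
  rw [← integral_map h.1 hφ.aestronglyMeasurable, h.2,
    integral_map (measurable_nat_pi _).aemeasurable hφ.aestronglyMeasurable]

lemma IsCompensatedPoisson.integrable_stepInt_pow [IsProbabilityMeasure P]
    (hM : IsCompensatedPoisson μ P M) {A : ι → Set Z} (hA : IsCells μ A) (a : ι → ι → ℝ) (n : ℕ) :
    Integrable (fun ω => stepInt M A a ω ^ n) P := by
  have h := hM.map_stepInt hA a
  have hφ : Measurable fun x : ℝ => x ^ n := by fun_prop
  have h1 := integrable_map_measure (μ := P) hφ.aestronglyMeasurable h.1
  have h2 := integrable_map_measure (μ := piPoisson (cellRate μ A))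
    (f := quadForm (cellRate μ A) a) hφ.aestronglyMeasurable (measurable_nat_pi _).aemeasurable
  rw [← h.2] at h2
  exact h1.1 (h2.2 (((ExpBdd.quadForm _ a).pow n).integrable _))

/-- The map from simple functions to their stochastic integrals is well defined. -/
lemma IsCompensatedPoisson.sum_ae_eq_zero (hM : IsCompensatedPoisson μ P M) {κ : Type*} [Fintype κ]
    {B : κ → Set Z} (hB : ∀ k, MeasurableSet (B k)) (hfin : ∀ k, μ (B k) < ⊤) (α : κ → ℝ)
    (h0 : ∀ x, ∑ k, α k * ind (B k) x = 0) : ∀ᵐ ω ∂P, ∑ k, α k * M (B k) ω = 0 := by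
  have hI : ∀ k l, Integrable (fun ω => M (B k) ω * M (B l) ω) P := fun k l =>
    (hM.memLp _ (hB k) (hfin k)).integrable_mul (hM.memLp _ (hB l) (hfin l))
  have hJ : ∀ k l, Integrable (fun x => ind (B k ∩ B l) x) μ := fun k l =>
    (integrable_indicator_iff ((hB k).inter (hB l))).2
      (integrableOn_const (measure_inter_lt_top_of_left_ne_top (hfin k).ne).ne)
  have hexp : ∀ ω, (∑ k, α k * M (B k) ω) ^ 2
      = ∑ k, ∑ l, α k * α l * (M (B k) ω * M (B l) ω) := fun ω => by
    rw [pow_two, Finset.sum_mul_sum]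
    exact Finset.sum_congr rfl fun k _ => Finset.sum_congr rfl fun l _ => by ring
  have hint : Integrable (fun ω => (∑ k, α k * M (B k) ω) ^ 2) P := by
    simp only [hexp]
    exact integrable_finsetSum _ fun k _ => integrable_finsetSum _ fun l _ => (hI k l).const_mul _
  have hzero : ∫ ω, (∑ k, α k * M (B k) ω) ^ 2 ∂P = 0 := by
    simp only [hexp]
    rw [integral_finsetSum _ fun k _ => integrable_finsetSum _ fun l _ => (hI k l).const_mul _]
    simp only [integral_finsetSum _ fun l _ => (hI _ l).const_mul _, integral_const_mul]
    -- By the covariance, the second moment of Σ α_k M(B_k) is the μ-integral of (Σ α_k 1_{B_k})²,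
    -- which vanishes.
    have e : ∀ k l, ∫ ω, M (B k) ω * M (B l) ω ∂P = ∫ x, ind (B k ∩ B l) x ∂μ := fun k l => by
      rw [hM.cov _ _ (hB k) (hfin k) (hB l) (hfin l)]
      exact (integral_indicator_one ((hB k).inter (hB l))).symm
    simp only [e, ← integral_const_mul]
    simp only [← integral_finsetSum _ fun l _ => (hJ _ l).const_mul _]
    rw [← integral_finsetSum _ fun k _ => integrable_finsetSum _ fun l _ => (hJ k l).const_mul _]
    have e2 : ∀ x, ∑ k, ∑ l, α k * α l * ind (B k ∩ B l) x = 0 := by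
      intro x
      have : ∀ k l, ind (B k ∩ B l) x = ind (B k) x * ind (B l) x := fun k l => by
        by_cases hk : x ∈ B k <;> by_cases hl : x ∈ B l <;> simp [ind, hk, hl]
      have h1 : (∑ k, α k * ind (B k) x) * (∑ k, α k * ind (B k) x) = 0 := by rw [h0, mul_zero]
      rw [Finset.sum_mul_sum] at h1
      rw [← h1]
      exact Finset.sum_congr rfl fun k _ => Finset.sum_congr rfl fun l _ => by rw [this]; ring
    simp [e2]
  have := (integral_eq_zero_iff_of_nonneg (fun ω => sq_nonneg _) hint).1 hzero
  filter_upwards [this] with ω hω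
  simpa using hω

end RandomMeasure

/-! ### Simple kernels in matrix form, their moments and characteristic functions -/

section SimpleKernels

variable {Z Ω : Type*} [MeasurableSpace Z] [MeasurableSpace Ω] {μ : Measure Z}
  {P : Measure Ω} {M : Set Z → Ω → ℝ}

/-- The atoms of the algebra generated by finitely many sets, except for the complement of their
union. -/
def atomSet {κ : Type*} (C : κ → Set Z) (s : Finset κ) : Set Z :=
  {x | s.Nonempty ∧ ∀ i, x ∈ C i ↔ i ∈ s}

lemma isCells_atomSet {κ : Type*} [Fintype κ] {C : κ → Set Z} (hC : ∀ i, MeasurableSet (C i))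
    (hfin : ∀ i, μ (C i) < ⊤) : IsCells μ (atomSet C) where
  measurable s := by
    have : atomSet C s = {_x | s.Nonempty} ∩ ⋂ i, {x | x ∈ C i ↔ i ∈ s} := by
      ext x; simp [atomSet]
    rw [this]
    refine (MeasurableSet.const _).inter (MeasurableSet.iInter fun i => ?_)
    by_cases hi : i ∈ s
    · simpa [hi] using hC i
    · simp only [hi, iff_false]
      exact (hC i).compl
  finite s := by
    rcases s.eq_empty_or_nonempty with rfl | ⟨i, hi⟩
    · simp [atomSet]
    · exact (measure_mono fun x hx => (hx.2 i).2 hi).trans_lt (hfin i)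
  disjoint s t hst := by
    refine Set.disjoint_left.2 fun x hs ht => hst ?_
    ext i
    rw [← hs.2, ht.2]

/-- A point of the union lies in exactly one atom, indexed by the set of all j with x ∈ C j. -/
lemma ind_eq_sum_atomSet {κ : Type*} [Fintype κ] [DecidableEq κ] {C : κ → Set Z}
    (hC : ∀ i, MeasurableSet (C i)) (hfin : ∀ i, μ (C i) < ⊤) (i : κ) (x : Z) :
    ind (C i) x = ∑ s : Finset κ, (if i ∈ s then 1 else 0) * ind (atomSet C s) x := by
  classical
  have hA := isCells_atomSet hC hfin
  by_cases hx : ∃ j, x ∈ C j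
  · have hmem : x ∈ atomSet C {j | x ∈ C j} := by
      obtain ⟨j, hj⟩ := hx
      exact ⟨⟨j, by simpa using hj⟩, fun i => by simp⟩
    rw [hA.sum_ind (fun s => if i ∈ s then 1 else 0) hmem]
    by_cases hi : x ∈ C i
    · simp [hi, ind_of_mem hi]
    · simp [hi, ind_of_notMem hi]
  · push Not at hx
    rw [ind_of_notMem (hx i), sum_ind_eq_zero]
    rintro s ⟨⟨j, hj⟩, h⟩
    exact hx j ((h j).2 hj)

lemma SimpleKernel.toFun_eq (g : SimpleKernel μ) (p : Z × Z) : g.toFun p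
    = ∑ i, g.c i * (ind (g.A i) p.1 * ind (g.B i) p.2 + ind (g.A i) p.2 * ind (g.B i) p.1) := rfl

/-- A simple kernel and its integral are given by a symmetric matrix with zero diagonal over
disjoint cells. -/
lemma SimpleKernel.exists_step (hM : IsCompensatedPoisson μ P M) (g : SimpleKernel μ) :
    ∃ A : Finset (Fin g.m ⊕ Fin g.m) → Set Z,
    ∃ a : Finset (Fin g.m ⊕ Fin g.m) → Finset (Fin g.m ⊕ Fin g.m) → ℝ,
      IsCells μ A ∧ (∀ s t, a s t = a t s) ∧ (∀ s, a s s = 0) ∧ g.toFun = stepFun A a ∧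
      g.integral M =ᵐ[P] stepInt M A a := by
  classical
  set C : Fin g.m ⊕ Fin g.m → Set Z := Sum.elim g.A g.B with hCdef
  have hC : ∀ i, MeasurableSet (C i) := by
    rintro (i | i)
    exacts [g.measurable_A i, g.measurable_B i]
  have hfin : ∀ i, μ (C i) < ⊤ := by
    rintro (i | i)
    exacts [g.finite_A i, g.finite_B i]
  have hA := isCells_atomSet hC hfin
  set b : Fin g.m ⊕ Fin g.m → Finset (Fin g.m ⊕ Fin g.m) → ℝ := fun i s => if i ∈ s then 1 else 0
    with hb
  set a₀ : Finset (Fin g.m ⊕ Fin g.m) → Finset (Fin g.m ⊕ Fin g.m) → ℝ := fun s t =>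
    ∑ i, g.c i * (b (.inl i) s * b (.inr i) t + b (.inl i) t * b (.inr i) s) with ha₀
  -- A nonempty atom cannot lie in both A i and B i, since these are disjoint. For empty atoms the
  -- diagonal coefficient may be nonzero, so `a` sets it to zero by hand.
  have hdiag : ∀ s, atomSet C s ≠ ∅ → a₀ s s = 0 := by
    intro s hs
    obtain ⟨x, hx⟩ := Set.nonempty_iff_ne_empty.2 hs
    refine Finset.sum_eq_zero fun i _ => ?_
    have : b (.inl i) s * b (.inr i) s = 0 := by
      by_cases h1 : Sum.inl i ∈ s
      · have h2 : Sum.inr i ∉ s := fun h2 =>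
          Set.disjoint_left.1 (g.disjoint i) ((hx.2 (.inl i)).2 h1) ((hx.2 (.inr i)).2 h2)
        simp [b, h2]
      · simp [b, h1]
    rw [this]; simp
  set a : Finset (Fin g.m ⊕ Fin g.m) → Finset (Fin g.m ⊕ Fin g.m) → ℝ :=
    fun s t => if s = t then 0 else a₀ s t with ha
  -- The bilinear algebra is stated once and applied twice: to values of indicators for the kernel,
  -- and to values of `M` for the integral.
  have hbil : ∀ (u v : Fin g.m ⊕ Fin g.m → ℝ) (x y : Finset (Fin g.m ⊕ Fin g.m) → ℝ),
      (∀ i, u i = ∑ s, b i s * x s) → (∀ i, v i = ∑ s, b i s * y s) →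
      (∀ s, a₀ s s * (x s * y s) = 0) →
      ∑ i, g.c i * (u (.inl i) * v (.inr i) + v (.inl i) * u (.inr i))
        = ∑ s, ∑ t, a s t * (x s * y t) := by
    intro u v x y hu hv h0
    have h1 : ∑ s, ∑ t, a s t * (x s * y t) = ∑ s, ∑ t, a₀ s t * (x s * y t) := by
      refine Finset.sum_congr rfl fun s _ => Finset.sum_congr rfl fun t _ => ?_
      by_cases hst : s = t
      · subst hst
        rw [h0]; simp [a]
      · simp [a, hst]
    rw [h1]
    simp only [a₀, Finset.sum_mul]
    have h2 : ∀ s, ∑ t, ∑ i, g.c i * (b (.inl i) s * b (.inr i) t + b (.inl i) t * b (.inr i) s) *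
        (x s * y t) = ∑ i, ∑ t, g.c i * (b (.inl i) s * b (.inr i) t
          + b (.inl i) t * b (.inr i) s) * (x s * y t) := fun s => Finset.sum_comm
    simp only [h2]
    rw [Finset.sum_comm]
    refine Finset.sum_congr rfl fun i _ => ?_
    rw [hu, hu, hv, hv, mul_comm (∑ s, b (.inl i) s * y s), Finset.sum_mul_sum, Finset.sum_mul_sum,
      ← Finset.sum_add_distrib, Finset.mul_sum]
    refine Finset.sum_congr rfl fun s _ => ?_
    rw [← Finset.sum_add_distrib, Finset.mul_sum]
    exact Finset.sum_congr rfl fun t _ => by ring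
  refine ⟨atomSet C, a, hA, fun s t => ?_, fun s => by simp [a], ?_, ?_⟩
  · by_cases hst : s = t
    · simp [hst]
    · simp only [a, hst, Ne.symm hst, if_false, a₀]
      exact Finset.sum_congr rfl fun i _ => by ring
  · ext p
    rw [SimpleKernel.toFun_eq, stepFun]
    refine hbil (fun i => ind (C i) p.1) (fun i => ind (C i) p.2) (fun s => ind (atomSet C s) p.1)
      (fun s => ind (atomSet C s) p.2) (fun i => ind_eq_sum_atomSet hC hfin i _)
      (fun i => ind_eq_sum_atomSet hC hfin i _) fun s => ?_
    by_cases hs : atomSet C s = ∅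
    · simp [hs, ind]
    · rw [hdiag s hs, zero_mul]
  · have h1 : ∀ i, ∀ᵐ ω ∂P, M (C i) ω = ∑ s, b i s * M (atomSet C s) ω := by
      intro i
      -- Almost sure additivity of `M`: the index `none` carries the set C i with weight 1, the
      -- other indices its atoms with weight −1, and the indicators cancel.
      have := hM.sum_ae_eq_zero (κ := Option (Finset (Fin g.m ⊕ Fin g.m)))
        (B := fun o => o.elim (C i) (atomSet C))
        (by rintro (_ | s); exacts [hC i, hA.measurable s])
        (by rintro (_ | s); exacts [hfin i, hA.finite s])
        (fun o => o.elim 1 fun s => -b i s)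
        (fun x => by
          simp only [Fintype.sum_option, Option.elim_none, Option.elim_some, one_mul, neg_mul,
            Finset.sum_neg_distrib]
          rw [ind_eq_sum_atomSet hC hfin i x, add_neg_cancel])
      filter_upwards [this] with ω hω
      simp only [Fintype.sum_option, Option.elim_none, Option.elim_some, one_mul, neg_mul,
        Finset.sum_neg_distrib] at hω
      linarith
    have h2 : ∀ s, ∀ᵐ ω ∂P, a₀ s s * (M (atomSet C s) ω * M (atomSet C s) ω) = 0 := by
      intro s
      by_cases hs : atomSet C s = ∅
      -- The same lemma for the single set ∅ gives M ∅ = 0 almost surely.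
      · have := hM.sum_ae_eq_zero (κ := Unit) (B := fun _ => ∅) (fun _ => .empty) (by simp)
          (fun _ => 1) (by simp [ind])
        filter_upwards [this] with ω hω
        simp only [Finset.univ_unique, Finset.sum_singleton, one_mul] at hω
        rw [hs, hω]; simp
      · simp [hdiag s hs]
    filter_upwards [ae_all_iff.2 h1, ae_all_iff.2 h2] with ω hω1 hω2
    have := hbil (fun i => M (C i) ω) (fun i => M (C i) ω) (fun s => M (atomSet C s) ω)
      (fun s => M (atomSet C s) ω) hω1 hω1 hω2
    rw [stepInt, ← this, SimpleKernel.integral]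
    exact Finset.sum_congr rfl fun i _ => by
      simp only [C, Sum.elim_inl, Sum.elim_inr]
      ring

/-- The simple kernel given by a symmetric matrix with zero diagonal over disjoint cells. -/
lemma IsCells.exists_simpleKernel {ι : Type*} [Fintype ι] {A : ι → Set Z} (hA : IsCells μ A)
    {a : ι → ι → ℝ} (hs : ∀ i j, a i j = a j i) (h0 : ∀ i, a i i = 0) :
    ∃ g : SimpleKernel μ, g.toFun = stepFun A a ∧ ∀ M : Set Z → Ω → ℝ, g.integral M = stepInt M A a := by
  classical
  let e := Fintype.equivFin (ι × ι)
  let g : SimpleKernel μ :=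
    { m := Fintype.card (ι × ι)
      -- Each pair {i, j} occurs in both orders and each term is symmetrised, hence the half. On the
      -- diagonal the coefficient is 0, so taking ∅ as second set only serves disjointness.
      c := fun n => a (e.symm n).1 (e.symm n).2 / 2
      A := fun n => A (e.symm n).1
      B := fun n => if (e.symm n).1 = (e.symm n).2 then ∅ else A (e.symm n).2
      measurable_A := fun n => hA.measurable _
      measurable_B := fun n => by split_ifs; exacts [.empty, hA.measurable _]
      finite_A := fun n => hA.finite _
      finite_B := fun n => by split_ifs; exacts [by simp, hA.finite _]
      disjoint := fun n => by
        split_ifs with h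
        · exact Set.disjoint_empty _
        · exact hA.disjoint h }
  refine ⟨g, ?_, fun M => ?_⟩
  · ext p
    rw [SimpleKernel.toFun_eq]
    have h1 := e.symm.sum_comp (fun q : ι × ι => a q.1 q.2 / 2 *
      (ind (A q.1) p.1 * ind (if q.1 = q.2 then ∅ else A q.2) p.2
        + ind (A q.1) p.2 * ind (if q.1 = q.2 then ∅ else A q.2) p.1))
    refine h1.trans ?_
    rw [Fintype.sum_prod_type, stepFun]
    have h2 : ∀ i j, a i j / 2 * (ind (A i) p.1 * ind (if i = j then ∅ else A j) p.2
        + ind (A i) p.2 * ind (if i = j then ∅ else A j) p.1)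
        = a i j / 2 * (ind (A i) p.1 * ind (A j) p.2)
          + a i j / 2 * (ind (A i) p.2 * ind (A j) p.1) := by
      intro i j
      by_cases hij : i = j
      · subst hij; simp [h0]
      · simp [hij]; ring
    simp only [h2, Finset.sum_add_distrib]
    rw [Finset.sum_comm (f := fun i j => a i j / 2 * (ind (A i) p.2 * ind (A j) p.1))]
    rw [← Finset.sum_add_distrib]
    refine Finset.sum_congr rfl fun i _ => ?_
    rw [← Finset.sum_add_distrib]
    refine Finset.sum_congr rfl fun j _ => ?_
    rw [hs j i]; ring
  · ext ω
    rw [SimpleKernel.integral, stepInt]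
    have h1 := e.symm.sum_comp (fun q : ι × ι => a q.1 q.2 / 2 *
      (2 * (M (A q.1) ω * M (if q.1 = q.2 then ∅ else A q.2) ω)))
    refine h1.trans ?_
    rw [Fintype.sum_prod_type]
    refine Finset.sum_congr rfl fun i _ => Finset.sum_congr rfl fun j _ => ?_
    by_cases hij : i = j
    · subst hij; simp [h0]
    · simp [hij]; ring

/-- The difference of two simple kernels. -/
def SimpleKernel.sub (g h : SimpleKernel μ) : SimpleKernel μ where
  m := g.m + h.m
  c := Fin.append g.c fun i => -h.c i
  A := Fin.append g.A h.A
  B := Fin.append g.B h.B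
  measurable_A i := by
    refine Fin.addCases (fun i => ?_) (fun i => ?_) i
    · simpa using g.measurable_A i
    · simpa using h.measurable_A i
  measurable_B i := by
    refine Fin.addCases (fun i => ?_) (fun i => ?_) i
    · simpa using g.measurable_B i
    · simpa using h.measurable_B i
  finite_A i := by
    refine Fin.addCases (fun i => ?_) (fun i => ?_) i
    · simpa using g.finite_A i
    · simpa using h.finite_A i
  finite_B i := by
    refine Fin.addCases (fun i => ?_) (fun i => ?_) i
    · simpa using g.finite_B i
    · simpa using h.finite_B i
  disjoint i := by
    refine Fin.addCases (fun i => ?_) (fun i => ?_) i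
    · simpa using g.disjoint i
    · simpa using h.disjoint i

lemma SimpleKernel.sub_toFun (g h : SimpleKernel μ) (p : Z × Z) :
    (g.sub h).toFun p = g.toFun p - h.toFun p := by
  refine (Fin.sum_univ_add (a := g.m) (b := h.m) _).trans ?_
  simp only [SimpleKernel.toFun, SimpleKernel.sub, Fin.append_left, Fin.append_right, neg_mul,
    Finset.sum_neg_distrib, sub_eq_add_neg]

lemma SimpleKernel.sub_integral (g h : SimpleKernel μ) (ω : Ω) :
    (g.sub h).integral M ω = g.integral M ω - h.integral M ω := by
  refine (Fin.sum_univ_add (a := g.m) (b := h.m) _).trans ?_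
  simp only [SimpleKernel.integral, SimpleKernel.sub, Fin.append_left, Fin.append_right, neg_mul,
    Finset.sum_neg_distrib, sub_eq_add_neg]

section Moments

variable [SigmaFinite μ]

lemma SimpleKernel.integrable_pow (hM : IsCompensatedPoisson μ P M) [IsProbabilityMeasure P]
    (g : SimpleKernel μ) (n : ℕ) : Integrable (fun ω => g.integral M ω ^ n) P := by
  obtain ⟨A, a, hA, -, -, -, hI⟩ := g.exists_step hM
  refine (hM.integrable_stepInt_pow hA a n).congr ?_
  filter_upwards [hI] with ω hω
  rw [hω]

lemma SimpleKernel.aestronglyMeasurable (hM : IsCompensatedPoisson μ P M) [IsProbabilityMeasure P]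
    (g : SimpleKernel μ) : AEStronglyMeasurable (g.integral M) P := by
  simpa using (g.integrable_pow hM 1).aestronglyMeasurable

lemma SimpleKernel.memLp_toFun (hM : IsCompensatedPoisson μ P M)
    (g : SimpleKernel μ) {n : ℕ} (hn : n ≠ 0) : MemLp g.toFun n (μ.prod μ) := by
  obtain ⟨A, a, hA, -, -, hf, -⟩ := g.exists_step hM
  rw [hf]
  exact hA.memLp_stepFun a hn

/-- The isometry up to the factor 2. As for the fourth moment and the characteristic function below,
the statement no longer mentions cells, so it can pass to limits of kernels. -/
lemma SimpleKernel.integral_integral_sq (hM : IsCompensatedPoisson μ P M) [IsProbabilityMeasure P]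
    (g : SimpleKernel μ) :
    ∫ ω, g.integral M ω ^ 2 ∂P = 2 * ∫ p, g.toFun p ^ 2 ∂(μ.prod μ) := by
  obtain ⟨A, a, hA, hs, h0, hf, hI⟩ := g.exists_step hM
  have h1 : ∫ ω, g.integral M ω ^ 2 ∂P = ∫ ω, stepInt M A a ω ^ 2 ∂P :=
    integral_congr_ae (by filter_upwards [hI] with ω hω; rw [hω])
  rw [h1, hM.integral_stepInt hA a (φ := fun x => x ^ 2) (by fun_prop),
    integral_quadForm_sq _ hs h0, hf, hA.integral_stepFun_sq]

lemma SimpleKernel.integral_integral_pow_four (hM : IsCompensatedPoisson μ P M)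
    [IsProbabilityMeasure P] (g : SimpleKernel μ) :
    ∫ ω, g.integral M ω ^ 4 ∂P = 12 * (∫ p, g.toFun p ^ 2 ∂(μ.prod μ)) ^ 2
      + 48 * (∫ p, contr11 μ g.toFun g.toFun p ^ 2 ∂(μ.prod μ))
      + 48 * (∫ x, contr21 μ g.toFun g.toFun x ^ 2 ∂μ)
      + 96 * (∫ p, contr11 μ g.toFun g.toFun p * g.toFun p ^ 2 ∂(μ.prod μ))
      + 8 * ∫ p, g.toFun p ^ 4 ∂(μ.prod μ) := by
  obtain ⟨A, a, hA, hs, h0, hf, hI⟩ := g.exists_step hM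
  have h1 : ∫ ω, g.integral M ω ^ 4 ∂P = ∫ ω, stepInt M A a ω ^ 4 ∂P :=
    integral_congr_ae (by filter_upwards [hI] with ω hω; rw [hω])
  rw [h1, hM.integral_stepInt hA a (φ := fun x => x ^ 4) (by fun_prop),
    integral_quadForm_pow_four _ hs h0, hf, hA.integral_stepFun_sq, hA.integral_contr11_sq,
    hA.integral_contr21_sq, hA.integral_contr11_mul_sq, hA.integral_stepFun_pow_four]

lemma SimpleKernel.norm_charFun_sub_le (hM : IsCompensatedPoisson μ P M)
    [IsProbabilityMeasure P] (g : SimpleKernel μ) (t : ℝ) :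
    ‖∫ ω, Complex.exp ((t * g.integral M ω : ℝ) * Complex.I) ∂P
        - Complex.exp (-(t ^ 2 / 2 : ℝ))‖
      ≤ t ^ 2 * (|2 * (∫ p, g.toFun p ^ 2 ∂(μ.prod μ)) - 1|
          + √(8 * (∫ p, contr11 μ g.toFun g.toFun p ^ 2 ∂(μ.prod μ))
            + 4 * ∫ x, contr21 μ g.toFun g.toFun x ^ 2 ∂μ))
        + 4 * |t| ^ 3 * √((∫ p, g.toFun p ^ 2 ∂(μ.prod μ)) *
            (3 * (∫ x, contr21 μ g.toFun g.toFun x ^ 2 ∂μ)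
              + ∫ p, g.toFun p ^ 4 ∂(μ.prod μ))) := by
  obtain ⟨A, a, hA, hs, h0, hf, hI⟩ := g.exists_step hM
  have h1 : ∫ ω, Complex.exp ((t * g.integral M ω : ℝ) * Complex.I) ∂P
      = ∫ ω, Complex.exp ((t * stepInt M A a ω : ℝ) * Complex.I) ∂P :=
    integral_congr_ae (by filter_upwards [hI] with ω hω; rw [hω])
  rw [h1, hM.integral_stepInt hA a (φ := fun x => Complex.exp ((t * x : ℝ) * Complex.I))
    (by fun_prop), hf, hA.integral_stepFun_sq, hA.integral_contr11_sq,
    hA.integral_contr21_sq, hA.integral_stepFun_pow_four]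
  refine (norm_integral_quadChar_sub_le _ hs h0 t).trans ?_
  gcongr
  · exact integral_abs_halfGrad_sub_one_le _ hs
  · exact sum_integral_abs_row_pow_three_le _ hs

end Moments

end SimpleKernels

/-! ### Norms as integrals of powers, and Jensen's inequality -/

section Norms

variable {α : Type*} [MeasurableSpace α] {ν : Measure α}

lemma eLpNorm_two_eq {f : α → ℝ} (hf : MemLp f 2 ν) :
    eLpNorm f 2 ν = ENNReal.ofReal (√(∫ x, f x ^ 2 ∂ν)) := by
  rw [hf.eLpNorm_eq_integral_rpow_norm two_ne_zero (by simp), Real.sqrt_eq_rpow]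
  simp

lemma eLpNorm_four_eq {f : α → ℝ} (hf : MemLp f 4 ν) :
    eLpNorm f 4 ν = ENNReal.ofReal ((∫ x, f x ^ 4 ∂ν) ^ (4⁻¹ : ℝ)) := by
  rw [hf.eLpNorm_eq_integral_rpow_norm (by norm_num) (by simp)]
  congr 2
  · refine integral_congr_ae (ae_of_all _ fun x => ?_)
    have : ((4 : ℝ≥0∞).toReal) = ((4 : ℕ) : ℝ) := by simp
    simp only [this, Real.rpow_natCast, Real.norm_eq_abs]
    exact Even.pow_abs (by decide) _

lemma memLp_four_iff {f : α → ℝ} (hf : AEStronglyMeasurable f ν) :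
    MemLp f 4 ν ↔ Integrable (fun x => f x ^ 4) ν := by
  rw [← integrable_norm_rpow_iff hf (by norm_num) (by simp)]
  have : ((4 : ℝ≥0∞).toReal) = ((4 : ℕ) : ℝ) := by simp
  simp only [this, Real.rpow_natCast, Real.norm_eq_abs, Even.pow_abs (show Even 4 by decide)]

lemma memLp_sq_of_memLp_four {f : α → ℝ} (hf : MemLp f 4 ν) : MemLp (fun x => f x ^ 2) 2 ν := by
  refine (memLp_two_iff_integrable_sq (hf.1.pow 2)).2 ?_
  exact ((memLp_four_iff hf.1).1 hf).congr (ae_of_all _ fun x => by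
    simp only [Pi.pow_apply]; ring)

/-- The integral of (h − c)² over S is nonnegative, where c is the mean of h over S. This is
Jensen's inequality without normalising the measure. -/
lemma sq_setIntegral_le {S : Set α} (hS : ν S ≠ ⊤) {h : α → ℝ} (hh : MemLp h 2 (ν.restrict S)) :
    (∫ x in S, h x ∂ν) ^ 2 ≤ ν.real S * ∫ x in S, h x ^ 2 ∂ν := by
  have : IsFiniteMeasure (ν.restrict S) := ⟨by simpa using hS.lt_top⟩
  have h1 : Integrable h (ν.restrict S) := hh.integrable one_le_two
  have h2 := hh.integrable_sq
  rcases eq_or_ne (ν.real S) 0 with h0 | h0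
  · have : ν S = 0 := (measureReal_eq_zero_iff hS).1 h0
    simp [Measure.restrict_eq_zero.2 this]
  · have hpos : 0 < ν.real S := lt_of_le_of_ne measureReal_nonneg h0.symm
    set c := (∫ x in S, h x ∂ν) / ν.real S with hc
    have hnn : 0 ≤ ∫ x in S, (h x - c) ^ 2 ∂ν := integral_nonneg fun x => sq_nonneg _
    have e : ∀ x, (h x - c) ^ 2 = h x ^ 2 + (-(2 * c) * h x + c ^ 2) := fun x => by ring
    simp only [e] at hnn
    have h3 : Integrable (fun x => -(2 * c) * h x + c ^ 2) (ν.restrict S) :=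
      (h1.const_mul _).add (integrable_const _)
    rw [MeasureTheory.integral_add h2 h3,
      MeasureTheory.integral_add (h1.const_mul _) (integrable_const _), integral_const_mul,
      integral_const] at hnn
    simp only [measureReal_restrict_apply_univ, smul_eq_mul] at hnn
    have hI : ∫ x in S, h x ∂ν = c * ν.real S := by rw [hc]; field_simp
    rw [hI] at hnn ⊢
    nlinarith

end Norms

/-! ### Averaging a kernel over blocks -/

section BlockAverage

variable {Z : Type*} [MeasurableSpace Z] {μ : Measure Z} [SigmaFinite μ]
  {ι : Type*} [Fintype ι] [DecidableEq ι] {A : ι → Set Z}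

/-- The averages of a kernel over the off-diagonal blocks `A i × A j`. -/
noncomputable def blockAvg (μ : Measure Z) (A : ι → Set Z) (f : Z × Z → ℝ) (i j : ι) : ℝ :=
  if i = j then 0 else
    (∫ p in A i ×ˢ A j, f p ∂(μ.prod μ)) / (μ.real (A i) * μ.real (A j))

lemma blockAvg_self (f : Z × Z → ℝ) (i : ι) : blockAvg μ A f i i = 0 := by simp [blockAvg]

/-- Exchanging the coordinates preserves the product measure, so symmetry almost everywhere gives an
exactly symmetric matrix. -/
lemma blockAvg_comm {f : Z × Z → ℝ} (hf : ∀ᵐ p ∂(μ.prod μ), f p.swap = f p) (i j : ι) :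
    blockAvg μ A f i j = blockAvg μ A f j i := by
  unfold blockAvg
  by_cases hij : i = j
  · simp [hij]
  · rw [if_neg hij, if_neg (Ne.symm hij), mul_comm (μ.real (A i))]
    congr 1
    have h1 := (Measure.measurePreserving_swap (μ := μ) (ν := μ)).setIntegral_preimage_emb
      MeasurableEquiv.prodComm.measurableEmbedding f (A i ×ˢ A j)
    rw [← h1, Set.preimage_swap_prod]
    exact (integral_congr_ae (ae_restrict_of_ae hf))

lemma IsCells.prod_finite (hA : IsCells μ A) (i j : ι) : (μ.prod μ) (A i ×ˢ A j) ≠ ⊤ := by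
  rw [Measure.prod_prod]
  exact ENNReal.mul_ne_top (hA.finite i).ne (hA.finite j).ne

lemma real_prod (i j : ι) : (μ.prod μ).real (A i ×ˢ A j) = μ.real (A i) * μ.real (A j) := by
  simp [measureReal_def, Measure.prod_prod]

lemma IsCells.mul_blockAvg (hA : IsCells μ A) (f : Z × Z → ℝ) {i j : ι} (hij : i ≠ j) :
    μ.real (A i) * μ.real (A j) * blockAvg μ A f i j = ∫ p in A i ×ˢ A j, f p ∂(μ.prod μ) := by
  rw [blockAvg, if_neg hij]
  -- On a null block the quotient is a division by zero, but both sides vanish.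
  rcases eq_or_ne (μ.real (A i) * μ.real (A j)) 0 with h0 | h0
  · rw [h0, zero_mul]
    rw [← real_prod, measureReal_eq_zero_iff (hA.prod_finite i j)] at h0
    simp [Measure.restrict_eq_zero.2 h0]
  · rw [mul_div_cancel₀ _ h0]

/-- Jensen's inequality for an average c over a block of mass m, in a form that stays valid for m =
0. -/
lemma mul_sq_le_of_mul_eq {m c I J : ℝ} (hm : 0 ≤ m) (hJ : 0 ≤ J) (hI : m * c = I)
    (h : I ^ 2 ≤ m * J) : m * c ^ 2 ≤ J := by
  rcases hm.eq_or_lt with rfl | hm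
  · simpa using hJ
  · rw [← hI] at h
    have : m * (m * c ^ 2) ≤ m * J := by linarith [show m * (m * c ^ 2) = (m * c) ^ 2 by ring]
    exact le_of_mul_le_mul_left this hm

lemma IsCells.mul_blockAvg_sub_sq_le (hA : IsCells μ A) {f : Z × Z → ℝ} (hf : MemLp f 2 (μ.prod μ))
    {a : ι → ι → ℝ} (h0 : ∀ i, a i i = 0) (i j : ι) :
    μ.real (A i) * μ.real (A j) * (blockAvg μ A f i j - a i j) ^ 2
      ≤ ∫ p in A i ×ˢ A j, (f p - stepFun A a p) ^ 2 ∂(μ.prod μ) := by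
  have hnn : 0 ≤ ∫ p in A i ×ˢ A j, (f p - stepFun A a p) ^ 2 ∂(μ.prod μ) :=
    integral_nonneg fun _ => sq_nonneg _
  by_cases hij : i = j
  · subst hij
    simpa [blockAvg_self, h0] using hnn
  have hg : MemLp (stepFun A a) 2 (μ.prod μ) := hA.memLp_stepFun a two_ne_zero
  have hfin : IsFiniteMeasure ((μ.prod μ).restrict (A i ×ˢ A j)) :=
    ⟨by simpa using (hA.prod_finite i j).lt_top⟩
  refine mul_sq_le_of_mul_eq (by positivity) hnn (I := ∫ p in A i ×ˢ A j, (f p - stepFun A a p)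
    ∂(μ.prod μ)) ?_ ?_
  · rw [mul_sub, hA.mul_blockAvg f hij, integral_sub ((hf.restrict _).integrable one_le_two)
      ((hg.restrict _).integrable one_le_two)]
    congr 1
    have : ∫ p in A i ×ˢ A j, stepFun A a p ∂(μ.prod μ)
        = ∫ p in A i ×ˢ A j, a i j ∂(μ.prod μ) :=
      setIntegral_congr_fun ((hA.measurable i).prod (hA.measurable j)) fun p hp =>
        hA.stepFun_of_mem a hp.1 hp.2
    rw [this, setIntegral_const, real_prod, smul_eq_mul]
  · rw [← real_prod]
    exact sq_setIntegral_le (hA.prod_finite i j) ((hf.sub hg).restrict _)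

lemma IsCells.sum_setIntegral_le {μ : Measure Z} (hA : IsCells μ A) {F : Z → ℝ}
    (hF : Integrable F μ) (h0 : ∀ x, 0 ≤ F x) : ∑ i, ∫ x in A i, F x ∂μ ≤ ∫ x, F x ∂μ := by
  rw [← integral_iUnion_fintype hA.measurable hA.disjoint fun i => hF.integrableOn]
  exact setIntegral_le_integral hF (ae_of_all _ h0)

lemma IsCells.sum_setIntegral_prod_le (hA : IsCells μ A) {F : Z × Z → ℝ}
    (hF : Integrable F (μ.prod μ)) (h0 : ∀ p, 0 ≤ F p) :
    ∑ i, ∑ j, ∫ p in A i ×ˢ A j, F p ∂(μ.prod μ) ≤ ∫ p, F p ∂(μ.prod μ) := by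
  rw [← Fintype.sum_prod_type' (f := fun i j => ∫ p in A i ×ˢ A j, F p ∂(μ.prod μ)),
    ← integral_iUnion_fintype (s := fun q : ι × ι => A q.1 ×ˢ A q.2)
      (fun q => (hA.measurable _).prod (hA.measurable _)) ?_ fun q => hF.integrableOn]
  · exact setIntegral_le_integral hF (ae_of_all _ h0)
  · intro q q' hqq
    rw [Function.onFun, Set.disjoint_prod]
    by_cases h1 : q.1 = q'.1
    · exact Or.inr (hA.disjoint fun h2 => hqq (Prod.ext h1 h2))
    · exact Or.inl (hA.disjoint h1)

/-- Averaging over blocks is an L² contraction that fixes step kernels with zero diagonal. -/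
lemma IsCells.integral_stepFun_blockAvg_sub_sq_le (hA : IsCells μ A) {f : Z × Z → ℝ}
    (hf : MemLp f 2 (μ.prod μ)) {a : ι → ι → ℝ} (h0 : ∀ i, a i i = 0) :
    ∫ p, (stepFun A (blockAvg μ A f) p - stepFun A a p) ^ 2 ∂(μ.prod μ)
      ≤ ∫ p, (f p - stepFun A a p) ^ 2 ∂(μ.prod μ) := by
  simp only [hA.map_stepFun (fun x y => (x - y) ^ 2) (by simp), hA.integral_stepFun]
  refine le_trans ?_ (hA.sum_setIntegral_prod_le
    (hf.sub (hA.memLp_stepFun a two_ne_zero)).integrable_sq fun p => sq_nonneg _)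
  exact Finset.sum_le_sum fun i _ => Finset.sum_le_sum fun j _ => hA.mul_blockAvg_sub_sq_le hf h0 i j

lemma stepFun_zero (p : Z × Z) : stepFun A (fun _ _ => 0) p = 0 := by simp [stepFun]

lemma IsCells.mul_blockAvg_sq_le (hA : IsCells μ A) {f : Z × Z → ℝ} (hf : MemLp f 2 (μ.prod μ))
    (i j : ι) : μ.real (A i) * μ.real (A j) * blockAvg μ A f i j ^ 2
      ≤ ∫ p in A i ×ˢ A j, f p ^ 2 ∂(μ.prod μ) := by
  have := hA.mul_blockAvg_sub_sq_le hf (a := fun _ _ => 0) (fun _ => rfl) i j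
  simpa [stepFun_zero] using this

/-- Jensen on each block twice: from the average to its square, then from the square to the fourth
power. -/
lemma IsCells.integral_stepFun_blockAvg_pow_four_le (hA : IsCells μ A) {f : Z × Z → ℝ}
    (hf : MemLp f 2 (μ.prod μ)) (hf4 : MemLp f 4 (μ.prod μ)) :
    ∫ p, stepFun A (blockAvg μ A f) p ^ 4 ∂(μ.prod μ) ≤ ∫ p, f p ^ 4 ∂(μ.prod μ) := by
  have h4 := (memLp_four_iff hf4.1).1 hf4
  have hsq := memLp_sq_of_memLp_four hf4
  simp only [hA.stepFun_pow _ four_ne_zero, hA.integral_stepFun]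
  refine le_trans ?_ (hA.sum_setIntegral_prod_le h4 fun p => by positivity)
  refine Finset.sum_le_sum fun i _ => Finset.sum_le_sum fun j _ => ?_
  have h1 := hA.mul_blockAvg_sq_le hf i j
  have hb : blockAvg μ A f i j ^ 4 = (blockAvg μ A f i j ^ 2) ^ 2 := by ring
  rw [hb]
  refine mul_sq_le_of_mul_eq (by positivity) (integral_nonneg fun _ => by positivity) rfl ?_
  have h2 := sq_setIntegral_le (hA.prod_finite i j) (hsq.restrict (A i ×ˢ A j))
  rw [real_prod] at h2
  simp only [← pow_mul] at h2
  exact (pow_le_pow_left₀ (by positivity) h1 2).trans h2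

lemma setIntegral_univ_prod {F : Z × Z → ℝ} (hF : Integrable F (μ.prod μ)) (B : Set Z) :
    ∫ p in Set.univ ×ˢ B, F p ∂(μ.prod μ) = ∫ x in B, ∫ z, F (z, x) ∂μ ∂μ := by
  rw [← Measure.prod_restrict, Measure.restrict_univ]
  refine integral_prod_symm _ ?_
  have h := hF.restrict (s := Set.univ ×ˢ B)
  rwa [← Measure.prod_restrict, Measure.restrict_univ] at h

/-- On A i the contraction of the averaged kernel is constant. By Jensen on the blocks A l × A i it
is at most the mean over A i of the contraction of f; Jensen on A i then gives the squares. -/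
lemma IsCells.integral_contr21_blockAvg_sq_le (hA : IsCells μ A) {f : Z × Z → ℝ}
    (hf : MemLp f 2 (μ.prod μ)) (hu : MemLp (contr21 μ f f) 2 μ) :
    ∫ x, contr21 μ (stepFun A (blockAvg μ A f)) (stepFun A (blockAvg μ A f)) x ^ 2 ∂μ
      ≤ ∫ x, contr21 μ f f x ^ 2 ∂μ := by
  simp only [hA.contr21_stepFun, hA.stepFunOne_pow _ two_ne_zero, hA.integral_stepFunOne]
  refine le_trans ?_ (hA.sum_setIntegral_le hu.integrable_sq fun x => sq_nonneg _)
  refine Finset.sum_le_sum fun i _ => ?_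
  rw [mul_comm]
  set c := ∑ l, μ.real (A l) * blockAvg μ A f l i * blockAvg μ A f l i with hc
  have hc0 : 0 ≤ c := Finset.sum_nonneg fun l _ => by
    rw [mul_assoc]; exact mul_nonneg measureReal_nonneg (mul_self_nonneg _)
  refine mul_sq_le_of_mul_eq measureReal_nonneg (integral_nonneg fun _ => by positivity) rfl ?_
  have h1 : μ.real (A i) * c ≤ ∫ x in A i, contr21 μ f f x ∂μ := by
    have e : ∀ x, contr21 μ f f x = ∫ z, f (z, x) ^ 2 ∂μ := fun x => by
      simp only [contr21, pow_two]
    simp only [e]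
    rw [← setIntegral_univ_prod hf.integrable_sq, hc, Finset.mul_sum]
    refine (Finset.sum_le_sum (g := fun l => ∫ p in A l ×ˢ A i, f p ^ 2 ∂(μ.prod μ))
      fun l _ => ?_).trans ?_
    · refine le_trans (le_of_eq ?_) (hA.mul_blockAvg_sq_le hf l i)
      ring
    · rw [← integral_iUnion_fintype (fun l => (hA.measurable l).prod (hA.measurable i)) ?_
        fun l => hf.integrable_sq.integrableOn]
      · exact setIntegral_mono_set hf.integrable_sq.integrableOn
          (ae_of_all _ fun _ => sq_nonneg _)
          (Set.iUnion_subset fun l => Set.prod_mono (Set.subset_univ _) subset_rfl).eventuallyLE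
      · intro l l' hl
        exact Set.disjoint_prod.2 (Or.inl (hA.disjoint hl))
  exact (pow_le_pow_left₀ (by positivity) h1 2).trans
    (sq_setIntegral_le (hA.finite i).ne (hu.restrict _))

end BlockAverage

/-! ### Approximation by dominated simple kernels -/

section Approximation

variable {Z Ω : Type*} [MeasurableSpace Z] [MeasurableSpace Ω] {μ : Measure Z} [SigmaFinite μ]
  {P : Measure Ω} [IsProbabilityMeasure P] {M : Set Z → Ω → ℝ}

/-- A simple kernel `h` such that the fourth moments of `h` are controlled by those of `f`. -/
structure SimpleKernel.IsDominated (h : SimpleKernel μ) (f : Z × Z → ℝ) : Prop where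
  integral_pow_four_le : MemLp f 4 (μ.prod μ) →
    ∫ p, h.toFun p ^ 4 ∂(μ.prod μ) ≤ ∫ p, f p ^ 4 ∂(μ.prod μ)
  integral_contr21_sq_le : MemLp (contr21 μ f f) 2 μ →
    ∫ x, contr21 μ h.toFun h.toFun x ^ 2 ∂μ ≤ ∫ x, contr21 μ f f x ^ 2 ∂μ

/-- Keep the cells of g and replace its coefficients by the block averages of f. Averaging fixes g,
so the new kernel is no farther from g than f is. -/
lemma SimpleKernel.exists_isDominated (hM : IsCompensatedPoisson μ P M) {f : Z × Z → ℝ}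
    (hf : MemL2Symm μ f) (g : SimpleKernel μ) : ∃ h : SimpleKernel μ, h.IsDominated f ∧
      eLpNorm (fun p => h.toFun p - g.toFun p) 2 (μ.prod μ)
        ≤ eLpNorm (fun p => f p - g.toFun p) 2 (μ.prod μ) := by
  classical
  obtain ⟨A, a, hA, -, h0, hg, -⟩ := g.exists_step hM
  obtain ⟨h, hh, -⟩ := hA.exists_simpleKernel (Ω := Ω) (blockAvg_comm (A := A) hf.2)
    (blockAvg_self f)
  refine ⟨h, ⟨fun h4 => ?_, fun hu => ?_⟩, ?_⟩
  · rw [hh]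
    exact hA.integral_stepFun_blockAvg_pow_four_le hf.1 h4
  · rw [hh]
    exact hA.integral_contr21_blockAvg_sq_le hf.1 hu
  · have hgL : MemLp g.toFun 2 (μ.prod μ) := g.memLp_toFun hM two_ne_zero
    have hhL : MemLp h.toFun 2 (μ.prod μ) := h.memLp_toFun hM two_ne_zero
    refine (eLpNorm_two_eq (hhL.sub hgL)).trans_le
      (le_trans ?_ (eLpNorm_two_eq (hf.1.sub hgL)).ge)
    refine ENNReal.ofReal_le_ofReal (Real.sqrt_le_sqrt ?_)
    simp only [hh, hg, Pi.sub_apply]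
    exact hA.integral_stepFun_blockAvg_sub_sq_le hf.1 h0

lemma SimpleKernel.memLp_integral (hM : IsCompensatedPoisson μ P M) (g : SimpleKernel μ) :
    MemLp (g.integral M) 2 P :=
  (memLp_two_iff_integrable_sq (g.aestronglyMeasurable hM)).2 (g.integrable_pow hM 2)

lemma SimpleKernel.eLpNorm_integral_sub (hM : IsCompensatedPoisson μ P M) (g h : SimpleKernel μ) :
    eLpNorm (fun ω => g.integral M ω - h.integral M ω) 2 P
      = ENNReal.ofReal (√2) * eLpNorm (fun p => g.toFun p - h.toFun p) 2 (μ.prod μ) := by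
  have e1 : (fun ω => g.integral M ω - h.integral M ω) = (g.sub h).integral M :=
    funext fun ω => (g.sub_integral h ω).symm
  have e2 : (fun p => g.toFun p - h.toFun p) = (g.sub h).toFun :=
    funext fun p => (g.sub_toFun h p).symm
  rw [e1, e2, eLpNorm_two_eq ((g.sub h).memLp_integral hM),
    eLpNorm_two_eq (by exact_mod_cast (g.sub h).memLp_toFun hM two_ne_zero),
    (g.sub h).integral_integral_sq hM, ← ENNReal.ofReal_mul (Real.sqrt_nonneg _),
    Real.sqrt_mul zero_le_two]

/-- A double integral is the limit of integrals of simple kernels whose fourth moments are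
controlled by those of the kernel. -/
lemma IsDoubleIntegral.exists_dominated (hM : IsCompensatedPoisson μ P M) {f : Z × Z → ℝ}
    (hf : MemL2Symm μ f) {F : Ω → ℝ} (hF : IsDoubleIntegral μ P M f F) :
    ∃ h : ℕ → SimpleKernel μ, (∀ k, (h k).IsDominated f) ∧
      Tendsto (fun k => eLpNorm (fun p => f p - (h k).toFun p) 2 (μ.prod μ)) atTop (𝓝 0) ∧
      Tendsto (fun k => eLpNorm (fun ω => F ω - (h k).integral M ω) 2 P) atTop (𝓝 0) := by
  obtain ⟨hFL, g, hg1, hg2⟩ := hF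
  choose h hdom hle using fun k => (g k).exists_isDominated hM hf
  have hgL : ∀ k, AEStronglyMeasurable (g k).toFun (μ.prod μ) := fun k =>
    ((g k).memLp_toFun hM two_ne_zero).1
  have hhL : ∀ k, AEStronglyMeasurable (h k).toFun (μ.prod μ) := fun k =>
    ((h k).memLp_toFun hM two_ne_zero).1
  -- Averaging at most doubles the L² distance of the kernels to f. On the random side, the isometry
  -- charges the same amount to the integrals.
  have hgh : ∀ k, eLpNorm (fun p => (g k).toFun p - (h k).toFun p) 2 (μ.prod μ)
      ≤ eLpNorm (fun p => f p - (g k).toFun p) 2 (μ.prod μ) := fun k => by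
    refine le_trans (le_of_eq ?_) (hle k)
    exact eLpNorm_sub_comm (g k).toFun (h k).toFun 2 (μ.prod μ)
  refine ⟨h, hdom, ?_, ?_⟩
  · have hlim := hg1.add hg1
    rw [add_zero] at hlim
    refine tendsto_of_tendsto_of_tendsto_of_le_of_le tendsto_const_nhds hlim (fun _ => zero_le)
      fun k => ?_
    have : (fun p => f p - (h k).toFun p)
        = (fun p => f p - (g k).toFun p) + fun p => (g k).toFun p - (h k).toFun p := by
      ext p; simp
    rw [this]
    refine (eLpNorm_add_le (hf.1.1.sub (hgL k)) ((hgL k).sub (hhL k)) one_le_two).trans ?_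
    exact add_le_add le_rfl (hgh k)
  · have hlim := hg2.add (ENNReal.Tendsto.const_mul hg1 (a := ENNReal.ofReal (√2))
      (Or.inr ENNReal.ofReal_ne_top))
    rw [mul_zero, add_zero] at hlim
    refine tendsto_of_tendsto_of_tendsto_of_le_of_le tendsto_const_nhds hlim (fun _ => zero_le)
      fun k => ?_
    have : (fun ω => F ω - (h k).integral M ω)
        = (fun ω => F ω - (g k).integral M ω)
          + fun ω => (g k).integral M ω - (h k).integral M ω := by
      ext p; simp
    have hgI := (g k).aestronglyMeasurable hM
    have hhI := (h k).aestronglyMeasurable hM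
    rw [this]
    refine (eLpNorm_add_le (hFL.1.sub hgI) (hgI.sub hhI) one_le_two).trans ?_
    refine add_le_add le_rfl (((g k).eLpNorm_integral_sub hM (h k)).trans_le ?_)
    exact mul_le_mul_right (hgh k) _

end Approximation

/-! ### Cauchy–Schwarz and convergence of integrals -/

section Convergence

variable {α : Type*} [MeasurableSpace α] {ν : Measure α}

lemma abs_integral_mul_le {f g : α → ℝ} (hf : MemLp f 2 ν) (hg : MemLp g 2 ν) :
    |∫ x, f x * g x ∂ν| ≤ √((∫ x, f x ^ 2 ∂ν) * ∫ x, g x ^ 2 ∂ν) := by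
  refine le_sqrt_mul_of_forall (integral_nonneg fun _ => sq_nonneg _)
    (integral_nonneg fun _ => sq_nonneg _) fun δ hδ => ?_
  have h1 : |∫ x, f x * g x ∂ν| ≤ ∫ x, |f x * g x| ∂ν := abs_integral_le_integral_abs
  have h2 : 2 * ∫ x, |f x * g x| ∂ν ≤ δ * (∫ x, f x ^ 2 ∂ν) + (∫ x, g x ^ 2 ∂ν) / δ := by
    rw [← integral_const_mul, ← integral_const_mul, ← integral_div,
      ← integral_add (hf.integrable_sq.const_mul _) (hg.integrable_sq.div_const _)]
    refine integral_mono ((hf.integrable_mul hg).abs.const_mul 2)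
      ((hf.integrable_sq.const_mul _).add (hg.integrable_sq.div_const _)) fun x => ?_
    simp only [Pi.add_apply]
    have e : δ * f x ^ 2 + g x ^ 2 / δ - 2 * |f x * g x| = (δ * |f x| - |g x|) ^ 2 / δ := by
      rw [abs_mul, ← sq_abs (f x), ← sq_abs (g x)]
      field_simp
      ring
    have : 0 ≤ (δ * |f x| - |g x|) ^ 2 / δ := by positivity
    exact sub_nonneg.1 (e ▸ this)
  linarith

lemma sq_integral_mul_le {f g : α → ℝ} (hf : MemLp f 2 ν) (hg : MemLp g 2 ν) :
    (∫ x, f x * g x ∂ν) ^ 2 ≤ (∫ x, f x ^ 2 ∂ν) * ∫ x, g x ^ 2 ∂ν := by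
  have h := abs_integral_mul_le hf hg
  have h0 : 0 ≤ (∫ x, f x ^ 2 ∂ν) * ∫ x, g x ^ 2 ∂ν :=
    mul_nonneg (integral_nonneg fun _ => sq_nonneg _) (integral_nonneg fun _ => sq_nonneg _)
  rw [← sq_abs, ← Real.sq_sqrt h0]
  exact pow_le_pow_left₀ (abs_nonneg _) h 2

lemma abs_integral_sq_sub_le {f h : α → ℝ} (hf : MemLp f 2 ν) (hh : MemLp h 2 ν) :
    |(∫ x, h x ^ 2 ∂ν) - ∫ x, f x ^ 2 ∂ν|
      ≤ (∫ x, (h x - f x) ^ 2 ∂ν) + 2 * √((∫ x, f x ^ 2 ∂ν) * ∫ x, (h x - f x) ^ 2 ∂ν) := by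
  have hd : MemLp (fun x => h x - f x) 2 ν := hh.sub hf
  have hfd : Integrable (fun x => 2 * (f x * (h x - f x))) ν := (hf.integrable_mul hd).const_mul 2
  have e : (∫ x, h x ^ 2 ∂ν) - ∫ x, f x ^ 2 ∂ν
      = (∫ x, (h x - f x) ^ 2 ∂ν) + 2 * ∫ x, f x * (h x - f x) ∂ν := by
    rw [← integral_const_mul, ← integral_sub hh.integrable_sq hf.integrable_sq,
      ← integral_add hd.integrable_sq hfd]
    refine integral_congr_ae (ae_of_all _ fun x => ?_)
    ring
  rw [e]
  refine (abs_add_le _ _).trans ?_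
  rw [abs_of_nonneg (integral_nonneg fun _ => sq_nonneg _), abs_mul, abs_two]
  gcongr
  exact abs_integral_mul_le hf hd

lemma tendsto_toReal_eLpNorm {p : ℝ≥0∞} (hp : 1 ≤ p) {g : α → ℝ} {G : ℕ → α → ℝ}
    (hg : MemLp g p ν) (hG : ∀ k, MemLp (G k) p ν)
    (h : Tendsto (fun k => eLpNorm (fun x => g x - G k x) p ν) atTop (𝓝 0)) :
    Tendsto (fun k => (eLpNorm (G k) p ν).toReal) atTop (𝓝 (eLpNorm g p ν).toReal) := by
  have hd : ∀ k, MemLp (fun x => g x - G k x) p ν := fun k => hg.sub (hG k)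
  have h' := (ENNReal.tendsto_toReal ENNReal.zero_ne_top).comp h
  rw [ENNReal.toReal_zero] at h'
  rw [tendsto_iff_norm_sub_tendsto_zero]
  refine squeeze_zero (fun _ => norm_nonneg _) (fun k => ?_) h'
  have h1 : eLpNorm g p ν ≤ eLpNorm (fun x => g x - G k x) p ν + eLpNorm (G k) p ν := by
    have : g = (fun x => g x - G k x) + G k := by ext x; simp
    conv_lhs => rw [this]
    exact eLpNorm_add_le (hd k).1 (hG k).1 hp
  have h2 : eLpNorm (G k) p ν ≤ eLpNorm g p ν + eLpNorm (fun x => g x - G k x) p ν := by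
    have : G k = g - (fun x => g x - G k x) := by ext x; simp
    conv_lhs => rw [this]
    exact eLpNorm_sub_le hg.1 (hd k).1 hp
  have h3 := ENNReal.toReal_mono (ENNReal.add_ne_top.2 ⟨(hd k).2.ne, (hG k).2.ne⟩) h1
  have h4 := ENNReal.toReal_mono (ENNReal.add_ne_top.2 ⟨hg.2.ne, (hd k).2.ne⟩) h2
  rw [ENNReal.toReal_add (hd k).2.ne (hG k).2.ne] at h3
  rw [ENNReal.toReal_add hg.2.ne (hd k).2.ne] at h4
  rw [Real.norm_eq_abs, abs_le, Function.comp]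
  constructor <;> linarith

lemma toReal_eLpNorm_two_sq {g : α → ℝ} (hg : MemLp g 2 ν) :
    (eLpNorm g 2 ν).toReal ^ 2 = ∫ x, g x ^ 2 ∂ν := by
  rw [eLpNorm_two_eq hg, ENNReal.toReal_ofReal (Real.sqrt_nonneg _),
    Real.sq_sqrt (integral_nonneg fun _ => sq_nonneg _)]

lemma toReal_eLpNorm_four_pow {g : α → ℝ} (hg : MemLp g 4 ν) :
    (eLpNorm g 4 ν).toReal ^ 4 = ∫ x, g x ^ 4 ∂ν := by
  have h0 : 0 ≤ ∫ x, g x ^ 4 ∂ν := integral_nonneg fun _ => by positivity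
  rw [eLpNorm_four_eq hg, ENNReal.toReal_ofReal (by positivity), ← Real.rpow_natCast,
    ← Real.rpow_mul h0]
  norm_num

lemma tendsto_integral_sq {g : α → ℝ} {G : ℕ → α → ℝ} (hg : MemLp g 2 ν)
    (hG : ∀ k, MemLp (G k) 2 ν)
    (h : Tendsto (fun k => eLpNorm (fun x => g x - G k x) 2 ν) atTop (𝓝 0)) :
    Tendsto (fun k => ∫ x, G k x ^ 2 ∂ν) atTop (𝓝 (∫ x, g x ^ 2 ∂ν)) := by
  have := (tendsto_toReal_eLpNorm one_le_two hg hG h).pow 2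
  simpa only [toReal_eLpNorm_two_sq hg, toReal_eLpNorm_two_sq (hG _)] using this

lemma tendsto_integral_pow_four {g : α → ℝ} {G : ℕ → α → ℝ} (hg : MemLp g 4 ν)
    (hG : ∀ k, MemLp (G k) 4 ν)
    (h : Tendsto (fun k => eLpNorm (fun x => g x - G k x) 4 ν) atTop (𝓝 0)) :
    Tendsto (fun k => ∫ x, G k x ^ 4 ∂ν) atTop (𝓝 (∫ x, g x ^ 4 ∂ν)) := by
  have := (tendsto_toReal_eLpNorm (by norm_num) hg hG h).pow 4
  simpa only [toReal_eLpNorm_four_pow hg, toReal_eLpNorm_four_pow (hG _)] using this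

/-- If `b k → b` almost everywhere, the integrals of `b k` do not exceed that of `b`, and `d k → 0`
almost everywhere with `d k ≤ C * (b k + b)`, then the integrals of `b k` and `d k` converge. -/
lemma tendsto_integral_of_le {d b' : ℕ → α → ℝ} {b : α → ℝ} {C : ℝ} (hC : 0 ≤ C)
    (hd : ∀ k, Integrable (d k) ν) (hb' : ∀ k, Integrable (b' k) ν) (hb : Integrable b ν)
    (hd0 : ∀ k x, 0 ≤ d k x) (hb0 : ∀ k x, 0 ≤ b' k x) (hbnn : ∀ x, 0 ≤ b x)
    (hle : ∀ k, ∀ᵐ x ∂ν, d k x ≤ C * (b' k x + b x))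
    (hdlim : ∀ᵐ x ∂ν, Tendsto (fun k => d k x) atTop (𝓝 0))
    (hblim : ∀ᵐ x ∂ν, Tendsto (fun k => b' k x) atTop (𝓝 (b x)))
    (hint : ∀ k, ∫ x, b' k x ∂ν ≤ ∫ x, b x ∂ν) :
    Tendsto (fun k => ∫ x, d k x ∂ν) atTop (𝓝 0) ∧
      Tendsto (fun k => ∫ x, b' k x ∂ν) atTop (𝓝 (∫ x, b x ∂ν)) := by
  -- Scheffé's argument: the positive part of b − b'_k is dominated by b, so its integral tends to
  -- 0. With ∫ b'_k ≤ ∫ b this forces convergence of the integrals.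
  set q : ℕ → α → ℝ := fun k x => max (b x - b' k x) 0 with hq
  have hqm : ∀ k, Integrable (q k) ν := fun k => (hb.sub (hb' k)).pos_part
  have hqlim : Tendsto (fun k => ∫ x, q k x ∂ν) atTop (𝓝 0) := by
    have := tendsto_integral_of_dominated_convergence (μ := ν) (F := q) (f := fun _ => 0) b
      (fun k => (hqm k).1) hb (fun k => ae_of_all _ fun x => by
        rw [Real.norm_of_nonneg (le_max_right _ _)]
        exact max_le (by linarith [hb0 k x]) (hbnn x)) ?_
    · simpa using this
    · filter_upwards [hblim] with x hx
      have := (tendsto_const_nhds (x := b x)).sub hx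
      rw [sub_self] at this
      simpa using this.max (tendsto_const_nhds (x := (0 : ℝ)))
  have hlow : ∀ k, ∫ x, b x ∂ν - ∫ x, q k x ∂ν ≤ ∫ x, b' k x ∂ν := fun k => by
    rw [← integral_sub hb (hqm k)]
    refine integral_mono (hb.sub (hqm k)) (hb' k) fun x => ?_
    have := le_max_left (b x - b' k x) 0
    simp only [q]
    linarith
  -- The truncation at 2Cb is handled by dominated convergence. The excess d − m is at most C(b' −
  -- b) + 2Cq, whose first term has nonpositive integral.
  set m : ℕ → α → ℝ := fun k x => min (d k x) (2 * C * b x) with hm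
  have hmi : ∀ k, Integrable (m k) ν := fun k => (hd k).inf (hb.const_mul _)
  have hmlim : Tendsto (fun k => ∫ x, m k x ∂ν) atTop (𝓝 0) := by
    have := tendsto_integral_of_dominated_convergence (μ := ν) (F := m) (f := fun _ => 0)
      (fun x => 2 * C * b x)
      (fun k => (hmi k).1) (hb.const_mul _) (fun k => ae_of_all _ fun x => by
        rw [Real.norm_of_nonneg (le_min (hd0 k x) (mul_nonneg (by linarith) (hbnn x)))]
        exact min_le_right _ _) ?_
    · simpa using this
    · filter_upwards [hdlim] with x hx
      have := hx.min (tendsto_const_nhds (x := 2 * C * b x))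
      rwa [min_eq_left (mul_nonneg (by linarith) (hbnn x))] at this
  refine ⟨?_, ?_⟩
  · have hup : ∀ k, ∫ x, d k x ∂ν ≤ ∫ x, m k x ∂ν + 2 * C * ∫ x, q k x ∂ν := by
      intro k
      have h1 : ∫ x, d k x ∂ν ≤ ∫ x, (m k x + (C * (b' k x - b x) + 2 * C * q k x)) ∂ν := by
        refine integral_mono_ae (hd k) ((hmi k).add ((((hb' k).sub hb).const_mul C).add
          ((hqm k).const_mul _))) ?_
        filter_upwards [hle k] with x hx
        simp only [m, q]
        rcases le_total (b x) (b' k x) with h | h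
        · rw [max_eq_right (by linarith)]
          rcases min_cases (d k x) (2 * C * b x) with ⟨h2, h3⟩ | ⟨h2, h3⟩
          · rw [h2]
            have := mul_nonneg hC (sub_nonneg.2 h)
            linarith
          · rw [h2]
            linarith
        · rw [max_eq_left (by linarith)]
          have := mul_nonneg hC (sub_nonneg.2 h)
          have hxx : d k x ≤ 2 * C * b x := hx.trans (by nlinarith)
          rw [min_eq_left hxx]
          nlinarith
      have h2 : Integrable (fun x => C * (b' k x - b x)) ν := ((hb' k).sub hb).const_mul C
      have h3 : Integrable (fun x => C * (b' k x - b x) + 2 * C * q k x) ν :=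
        h2.add ((hqm k).const_mul _)
      rw [integral_add (hmi k) h3, integral_add h2 ((hqm k).const_mul _), integral_const_mul,
        integral_const_mul, integral_sub (hb' k) hb] at h1
      have := mul_nonneg hC (sub_nonneg.2 (hint k))
      linarith
    have := hmlim.add (hqlim.const_mul (2 * C))
    rw [mul_zero, add_zero] at this
    exact squeeze_zero (fun k => integral_nonneg (hd0 k)) hup this
  · have := (tendsto_const_nhds (x := ∫ x, b x ∂ν)).sub hqlim
    rw [sub_zero] at this
    exact tendsto_of_tendsto_of_tendsto_of_le_of_le this tendsto_const_nhds hlow hint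

end Convergence

/-! ### Contractions as maps on L² -/

section Contractions

variable {Z : Type*} [MeasurableSpace Z] {μ : Measure Z} [SigmaFinite μ]

lemma ae_memLp_section {f : Z × Z → ℝ} (hf : MemLp f 2 (μ.prod μ)) :
    ∀ᵐ x ∂μ, MemLp (fun z => f (z, x)) 2 μ := by
  filter_upwards [hf.1.prodMk_right, hf.integrable_sq.prod_left_ae] with x h1 h2
  exact (memLp_two_iff_integrable_sq h1).2 h2

lemma contr21_eq (f : Z × Z → ℝ) (x : Z) : contr21 μ f f x = ∫ z, f (z, x) ^ 2 ∂μ := by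
  simp only [contr21, pow_two]

lemma contr21_nonneg (f : Z × Z → ℝ) (x : Z) : 0 ≤ contr21 μ f f x :=
  integral_nonneg fun _ => mul_self_nonneg _

lemma integrable_contr21 {f : Z × Z → ℝ} (hf : MemLp f 2 (μ.prod μ)) :
    Integrable (contr21 μ f f) μ :=
  hf.integrable_sq.integral_prod_right.congr (ae_of_all _ fun x => (contr21_eq f x).symm)

lemma integral_contr21 {f : Z × Z → ℝ} (hf : MemLp f 2 (μ.prod μ)) :
    ∫ x, contr21 μ f f x ∂μ = ∫ p, f p ^ 2 ∂(μ.prod μ) := by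
  rw [integral_prod_symm _ hf.integrable_sq]
  simp only [contr21_eq]

lemma aestronglyMeasurable_contr11 {u v : Z × Z → ℝ} (hu : AEStronglyMeasurable u (μ.prod μ))
    (hv : AEStronglyMeasurable v (μ.prod μ)) :
    AEStronglyMeasurable (contr11 μ u v) (μ.prod μ) := by
  have h1 : Measure.QuasiMeasurePreserving (fun q : (Z × Z) × Z => (q.2, q.1.1))
      ((μ.prod μ).prod μ) (μ.prod μ) :=
    ((Measure.measurePreserving_swap (μ := μ) (ν := μ)).quasiMeasurePreserving).comp
      (MeasureTheory.QuasiMeasurePreserving.prodMap Measure.quasiMeasurePreserving_fst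
        (Measure.QuasiMeasurePreserving.id μ))
  have h2 : Measure.QuasiMeasurePreserving (fun q : (Z × Z) × Z => (q.2, q.1.2))
      ((μ.prod μ).prod μ) (μ.prod μ) :=
    ((Measure.measurePreserving_swap (μ := μ) (ν := μ)).quasiMeasurePreserving).comp
      (MeasureTheory.QuasiMeasurePreserving.prodMap Measure.quasiMeasurePreserving_snd
        (Measure.QuasiMeasurePreserving.id μ))
  exact ((hu.comp_quasiMeasurePreserving h1).mul
    (hv.comp_quasiMeasurePreserving h2)).integral_prod_right'

lemma ae_prod_of_ae {p q : Z → Prop} (hp : ∀ᵐ x ∂μ, p x) (hq : ∀ᵐ x ∂μ, q x) :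
    ∀ᵐ y ∂(μ.prod μ), p y.1 ∧ q y.2 := by
  filter_upwards [Measure.quasiMeasurePreserving_fst.ae hp,
    Measure.quasiMeasurePreserving_snd.ae hq] with y h1 h2
  exact ⟨h1, h2⟩

/-- Cauchy–Schwarz in the contracted variable bounds the square by a product of functions of one
variable each, which Fubini integrates. Sections are square integrable only almost everywhere. -/
lemma memLp_contr11_and_integral_le {u v : Z × Z → ℝ} (hu : MemLp u 2 (μ.prod μ))
    (hv : MemLp v 2 (μ.prod μ)) : MemLp (contr11 μ u v) 2 (μ.prod μ) ∧
    ∫ p, contr11 μ u v p ^ 2 ∂(μ.prod μ)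
      ≤ (∫ p, u p ^ 2 ∂(μ.prod μ)) * ∫ p, v p ^ 2 ∂(μ.prod μ) := by
  have hm := aestronglyMeasurable_contr11 hu.1 hv.1
  have hle : ∀ᵐ p ∂(μ.prod μ), contr11 μ u v p ^ 2 ≤ contr21 μ u u p.1 * contr21 μ v v p.2 := by
    filter_upwards [ae_prod_of_ae (ae_memLp_section hu) (ae_memLp_section hv)] with p hp
    rw [contr21_eq, contr21_eq]
    exact sq_integral_mul_le hp.1 hp.2
  have hI : Integrable (fun p : Z × Z => contr21 μ u u p.1 * contr21 μ v v p.2) (μ.prod μ) :=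
    (integrable_contr21 hu).mul_prod (integrable_contr21 hv)
  have hI2 : Integrable (fun p => contr11 μ u v p ^ 2) (μ.prod μ) := by
    refine hI.mono' (hm.pow 2) ?_
    filter_upwards [hle] with p hp
    rwa [Real.norm_of_nonneg (sq_nonneg _)]
  refine ⟨(memLp_two_iff_integrable_sq hm).2 hI2, (integral_mono_ae hI2 hI hle).trans ?_⟩
  rw [integral_prod_mul, integral_contr21 hu, integral_contr21 hv]

lemma eLpNorm_contr11_le {u v : Z × Z → ℝ} (hu : MemLp u 2 (μ.prod μ))
    (hv : MemLp v 2 (μ.prod μ)) : eLpNorm (contr11 μ u v) 2 (μ.prod μ)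
      ≤ eLpNorm u 2 (μ.prod μ) * eLpNorm v 2 (μ.prod μ) := by
  have h := memLp_contr11_and_integral_le hu hv
  rw [eLpNorm_two_eq h.1, eLpNorm_two_eq hu, eLpNorm_two_eq hv,
    ← ENNReal.ofReal_mul (Real.sqrt_nonneg _),
    ← Real.sqrt_mul (integral_nonneg fun _ => sq_nonneg _)]
  exact ENNReal.ofReal_le_ofReal (Real.sqrt_le_sqrt h.2)

lemma contr11_sub_ae {f h : Z × Z → ℝ} (hf : MemLp f 2 (μ.prod μ)) (hh : MemLp h 2 (μ.prod μ)) :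
    (fun p => contr11 μ f f p - contr11 μ h h p) =ᵐ[μ.prod μ]
      contr11 μ (fun p => f p - h p) f + contr11 μ h (fun p => f p - h p) := by
  filter_upwards [ae_prod_of_ae (ae_memLp_section hf) (ae_memLp_section hf),
    ae_prod_of_ae (ae_memLp_section hh) (ae_memLp_section hh)] with p hp hq
  simp only [contr11, Pi.add_apply]
  have i1 := hp.1.integrable_mul hp.2
  have i2 := hq.1.integrable_mul hq.2
  have i3 := (hp.1.sub hq.1).integrable_mul hp.2
  have i4 := hq.1.integrable_mul (hp.2.sub hq.2)
  refine (integral_sub i1 i2).symm.trans ((integral_congr_ae (ae_of_all _ fun z => ?_)).trans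
    (integral_add i3 i4))
  simp only [Pi.mul_apply, Pi.sub_apply]
  ring

/-- By bilinearity the difference splits into two contractions, each with f − h k in one slot, so
`contr11` is continuous on L². No such continuity in L² holds for `contr21`, hence the dominated
approximations. -/
lemma tendsto_eLpNorm_contr11_sub {f : Z × Z → ℝ} {h : ℕ → Z × Z → ℝ}
    (hf : MemLp f 2 (μ.prod μ)) (hh : ∀ k, MemLp (h k) 2 (μ.prod μ))
    (hlim : Tendsto (fun k => eLpNorm (fun p => f p - h k p) 2 (μ.prod μ)) atTop (𝓝 0)) :
    Tendsto (fun k => eLpNorm (fun p => contr11 μ f f p - contr11 μ (h k) (h k) p) 2 (μ.prod μ))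
      atTop (𝓝 0) := by
  set e : ℕ → ℝ≥0∞ := fun k => eLpNorm (fun p => f p - h k p) 2 (μ.prod μ) with he
  set N := eLpNorm f 2 (μ.prod μ) with hN
  have hNt : N ≠ ⊤ := hf.2.ne
  have hb : Tendsto (fun k => e k * N + (N + e k) * e k) atTop (𝓝 (0 * N + (N + 0) * 0)) := by
    refine (ENNReal.Tendsto.mul_const hlim (Or.inr hNt)).add
      (ENNReal.Tendsto.mul (tendsto_const_nhds.add hlim) (Or.inr ENNReal.zero_ne_top) hlim
        (Or.inr ?_))
    simpa using hNt
  simp only [zero_mul, mul_zero, add_zero] at hb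
  refine tendsto_of_tendsto_of_tendsto_of_le_of_le tendsto_const_nhds hb (fun _ => zero_le)
    fun k => ?_
  have hd : MemLp (fun p => f p - h k p) 2 (μ.prod μ) := hf.sub (hh k)
  rw [eLpNorm_congr_ae (contr11_sub_ae hf (hh k))]
  refine (eLpNorm_add_le (memLp_contr11_and_integral_le hd hf).1.1
    (memLp_contr11_and_integral_le (hh k) hd).1.1 one_le_two).trans ?_
  refine add_le_add (eLpNorm_contr11_le hd hf) ((eLpNorm_contr11_le (hh k) hd).trans ?_)
  gcongr
  have : h k = f - (fun p => f p - h k p) := by ext x; simp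
  conv_lhs => rw [this]
  exact eLpNorm_sub_le hf.1 hd.1 one_le_two

end Contractions

/-! ### Passage to general kernels -/

section Limits

variable {Z Ω : Type*} [MeasurableSpace Z] [MeasurableSpace Ω] {μ : Measure Z} [SigmaFinite μ]
  {P : Measure Ω} [IsProbabilityMeasure P] {M : Set Z → Ω → ℝ}

lemma tendsto_integral_cexp {F : Ω → ℝ} {H : ℕ → Ω → ℝ} (hF : MemLp F 2 P)
    (hH : ∀ k, MemLp (H k) 2 P)
    (h : Tendsto (fun k => eLpNorm (fun ω => F ω - H k ω) 2 P) atTop (𝓝 0)) (t : ℝ) :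
    Tendsto (fun k => ∫ ω, Complex.exp ((t * H k ω : ℝ) * Complex.I) ∂P) atTop
      (𝓝 (∫ ω, Complex.exp ((t * F ω : ℝ) * Complex.I) ∂P)) := by
  have hm : ∀ {G : Ω → ℝ}, MemLp G 2 P →
      Integrable (fun ω => Complex.exp ((t * G ω : ℝ) * Complex.I)) P := fun {G} hG => by
    have hφ : Continuous fun x : ℝ => Complex.exp ((t * x : ℝ) * Complex.I) := by fun_prop
    refine Integrable.of_bound (hφ.comp_aestronglyMeasurable hG.1) 1 (ae_of_all _ fun ω => ?_)
    rw [Complex.norm_exp_ofReal_mul_I]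
  have hd : ∀ k, MemLp (fun ω => F ω - H k ω) 2 P := fun k => hF.sub (hH k)
  rw [tendsto_iff_norm_sub_tendsto_zero]
  have hlim := ((ENNReal.tendsto_toReal ENNReal.zero_ne_top).comp h).const_mul |t|
  rw [ENNReal.toReal_zero, mul_zero] at hlim
  refine squeeze_zero (fun _ => norm_nonneg _) (fun k => ?_) hlim
  rw [← integral_sub (hm (hH k)) (hm hF)]
  have h1 : ‖∫ ω, (Complex.exp ((t * H k ω : ℝ) * Complex.I)
      - Complex.exp ((t * F ω : ℝ) * Complex.I)) ∂P‖ ≤ ∫ ω, |t| * |F ω - H k ω| ∂P := by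
    refine norm_integral_le_of_norm_le (((hd k).integrable one_le_two).abs.const_mul _)
      (ae_of_all _ fun ω => ?_)
    have e : Complex.exp ((t * H k ω : ℝ) * Complex.I) - Complex.exp ((t * F ω : ℝ) * Complex.I)
        = Complex.exp ((t * F ω : ℝ) * Complex.I) *
          (Complex.exp ((t * (H k ω - F ω) : ℝ) * Complex.I) - 1) := by
      rw [mul_sub, ← Complex.exp_add, mul_one]
      congr 2
      push_cast
      ring
    rw [e, norm_mul, Complex.norm_exp_ofReal_mul_I, one_mul, abs_sub_comm, ← abs_mul]
    exact norm_cexp_mul_I_sub_one_le _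
  refine h1.trans ?_
  rw [integral_const_mul]
  refine mul_le_mul_of_nonneg_left ?_ (abs_nonneg t)
  have h2 : ∫ ω, |F ω - H k ω| ∂P ≤ √(∫ ω, (F ω - H k ω) ^ 2 ∂P) := by
    have := abs_integral_mul_le (ν := P) (f := fun ω => |F ω - H k ω|) (g := fun _ => 1)
      (hd k).abs (memLp_const (1 : ℝ))
    simp only [mul_one, one_pow, integral_const, probReal_univ, smul_eq_mul, sq_abs] at this
    exact (le_abs_self _).trans this
  refine h2.trans (le_of_eq ?_)
  rw [Function.comp, eLpNorm_two_eq (hd k), ENNReal.toReal_ofReal (Real.sqrt_nonneg _)]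

/-- A quantitative bound for the characteristic function of a double integral. -/
lemma IsDoubleIntegral.norm_charFun_sub_le (hM : IsCompensatedPoisson μ P M) {f : Z × Z → ℝ}
    (hf : MemL2Symm μ f) (hf4 : MemLp f 4 (μ.prod μ)) (hu : MemLp (contr21 μ f f) 2 μ)
    {F : Ω → ℝ} (hF : IsDoubleIntegral μ P M f F) (t : ℝ) :
    ‖∫ ω, Complex.exp ((t * F ω : ℝ) * Complex.I) ∂P - Complex.exp (-(t ^ 2 / 2 : ℝ))‖
      ≤ t ^ 2 * (|2 * (∫ p, f p ^ 2 ∂(μ.prod μ)) - 1|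
          + √(8 * (∫ p, contr11 μ f f p ^ 2 ∂(μ.prod μ)) + 4 * ∫ x, contr21 μ f f x ^ 2 ∂μ))
        + 4 * |t| ^ 3 * √((∫ p, f p ^ 2 ∂(μ.prod μ)) *
            (3 * (∫ x, contr21 μ f f x ^ 2 ∂μ) + ∫ p, f p ^ 4 ∂(μ.prod μ))) := by
  obtain ⟨h, hdom, hh, hH⟩ := hF.exists_dominated hM hf
  have hL : ∀ k, MemLp (h k).toFun 2 (μ.prod μ) := fun k => (h k).memLp_toFun hM two_ne_zero
  have l1 := tendsto_integral_cexp hF.1 (fun k => (h k).memLp_integral hM) hH t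
  have l2 := tendsto_integral_sq hf.1 hL hh
  have l3 := tendsto_integral_sq (memLp_contr11_and_integral_le hf.1 hf.1).1
    (fun k => (memLp_contr11_and_integral_le (hL k) (hL k)).1)
    (tendsto_eLpNorm_contr11_sub hf.1 hL hh)
  set m := ∫ x, contr21 μ f f x ^ 2 ∂μ with hm
  set q := ∫ p, f p ^ 4 ∂(μ.prod μ) with hq
  -- Only ‖f‖ and the norm of `contr11` are taken to the limit. The other two quantities are
  -- replaced, for every k, by those of f through domination.
  refine le_of_tendsto_of_tendsto' (l1.sub_const _).norm
    (((((l2.const_mul 2).sub_const 1).abs.add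
      (((l3.const_mul 8).add_const (4 * m)).sqrt)).const_mul (t ^ 2)).add
      (((l2.mul_const (3 * m + q)).sqrt).const_mul (4 * |t| ^ 3))) fun k => ?_
  refine ((h k).norm_charFun_sub_le hM t).trans ?_
  have d1 := (hdom k).integral_contr21_sq_le hu
  have d2 := (hdom k).integral_pow_four_le hf4
  have hnn : 0 ≤ ∫ p, (h k).toFun p ^ 2 ∂(μ.prod μ) := integral_nonneg fun _ => sq_nonneg _
  gcongr

lemma exists_subseq_tendsto_ae {α : Type*} [MeasurableSpace α] {ν : Measure α} {p : ℝ≥0∞}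
    (hp0 : p ≠ 0) (hp : p ≠ ⊤)
    {g : α → ℝ} {G : ℕ → α → ℝ} (hg : AEStronglyMeasurable g ν)
    (hG : ∀ k, AEStronglyMeasurable (G k) ν)
    (h : Tendsto (fun k => eLpNorm (fun x => g x - G k x) p ν) atTop (𝓝 0)) :
    ∃ ns : ℕ → ℕ, StrictMono ns ∧ ∀ᵐ x ∂ν, Tendsto (fun i => G (ns i) x) atTop (𝓝 (g x)) := by
  refine (tendstoInMeasure_of_tendsto_eLpNorm_of_ne_top hp0 hp hG hg
    (h.congr fun k => ?_)).exists_seq_tendsto_ae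
  exact eLpNorm_sub_comm g (G k) p ν

/-- The fourth moment of the integral of a simple kernel is controlled by moments of the kernel. -/
lemma SimpleKernel.integral_integral_pow_four_le (hM : IsCompensatedPoisson μ P M)
    (g : SimpleKernel μ) : ∫ ω, g.integral M ω ^ 4 ∂P
      ≤ 108 * ((∫ p, g.toFun p ^ 2 ∂(μ.prod μ)) ^ 2 + (∫ x, contr21 μ g.toFun g.toFun x ^ 2 ∂μ)
        + ∫ p, g.toFun p ^ 4 ∂(μ.prod μ)) := by
  have hL : MemLp g.toFun 2 (μ.prod μ) := g.memLp_toFun hM two_ne_zero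
  have hL4 : MemLp g.toFun 4 (μ.prod μ) := g.memLp_toFun hM four_ne_zero
  have hI4 := (memLp_four_iff hL4.1).1 hL4
  have hc := memLp_contr11_and_integral_le hL hL
  have hcross : ∫ p, contr11 μ g.toFun g.toFun p * g.toFun p ^ 2 ∂(μ.prod μ)
      ≤ ((∫ p, contr11 μ g.toFun g.toFun p ^ 2 ∂(μ.prod μ))
        + ∫ p, g.toFun p ^ 4 ∂(μ.prod μ)) / 2 := by
    rw [← integral_add hc.1.integrable_sq hI4, ← integral_div]
    refine integral_mono (hc.1.integrable_mul (memLp_sq_of_memLp_four hL4))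
      ((hc.1.integrable_sq.add hI4).div_const 2) fun p => ?_
    simp only [Pi.add_apply, Pi.mul_apply]
    have := sq_nonneg (contr11 μ g.toFun g.toFun p - g.toFun p ^ 2)
    nlinarith
  have h0 : 0 ≤ ∫ x, contr21 μ g.toFun g.toFun x ^ 2 ∂μ := integral_nonneg fun _ => sq_nonneg _
  have h4 : 0 ≤ ∫ p, g.toFun p ^ 4 ∂(μ.prod μ) := integral_nonneg fun _ => by positivity
  rw [g.integral_integral_pow_four hM]
  have := hc.2
  -- With the cross term halved by AM–GM and ‖g⋆₁¹g‖² ≤ ‖g‖⁴, the coefficient of ‖g‖⁴ is 12 + 48 +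
  -- 48 = 108; the other two are 48 and 56.
  nlinarith

lemma abs_contr21_sub_le {f h : Z × Z → ℝ} (hf : MemLp f 2 (μ.prod μ))
    (hh : MemLp h 2 (μ.prod μ)) : ∀ᵐ x ∂μ,
    |contr21 μ h h x - contr21 μ f f x|
      ≤ contr21 μ (fun p => h p - f p) (fun p => h p - f p) x
        + 2 * √(contr21 μ f f x * contr21 μ (fun p => h p - f p) (fun p => h p - f p) x) := by
  filter_upwards [ae_memLp_section hf, ae_memLp_section hh] with x h1 h2
  simp only [contr21_eq]
  exact abs_integral_sq_sub_le h1 h2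

lemma contr21_sub_le {f h : Z × Z → ℝ} (hf : MemLp f 2 (μ.prod μ))
    (hh : MemLp h 2 (μ.prod μ)) : ∀ᵐ x ∂μ,
    contr21 μ (fun p => h p - f p) (fun p => h p - f p) x
      ≤ 2 * contr21 μ h h x + 2 * contr21 μ f f x := by
  filter_upwards [ae_memLp_section hf, ae_memLp_section hh] with x h1 h2
  simp only [contr21_eq]
  have i1 := h1.integrable_sq.const_mul 2
  have i2 := h2.integrable_sq.const_mul 2
  rw [← integral_const_mul, ← integral_const_mul, ← integral_add i2 i1]
  refine integral_mono (h2.sub h1).integrable_sq (i2.add i1) fun z => ?_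
  simp only [Pi.sub_apply, Pi.add_apply]
  nlinarith [sq_nonneg (h (z, x) + f (z, x))]

lemma integrable_contr21_sq_of_le {f h : Z × Z → ℝ} (hf : MemLp f 2 (μ.prod μ))
    (hh : MemLp h 2 (μ.prod μ)) (hfu : MemLp (contr21 μ f f) 2 μ)
    (hhu : MemLp (contr21 μ h h) 2 μ) :
    MemLp (contr21 μ (fun p => h p - f p) (fun p => h p - f p)) 2 μ := by
  have hd : MemLp (fun p => h p - f p) 2 (μ.prod μ) := hh.sub hf
  refine MemLp.mono' (((hhu.const_mul 2).add (hfu.const_mul 2))) (integrable_contr21 hd).1 ?_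
  filter_upwards [contr21_sub_le hf hh] with x hx
  rw [Real.norm_of_nonneg (contr21_nonneg _ _)]
  exact hx

lemma SimpleKernel.memLp_contr21 (hM : IsCompensatedPoisson μ P M) (g : SimpleKernel μ) :
    MemLp (contr21 μ g.toFun g.toFun) 2 μ := by
  obtain ⟨A, a, hA, -, -, hf, -⟩ := g.exists_step hM
  rw [hf]
  have hm := (integrable_contr21 (hA.memLp_stepFun a two_ne_zero)).1
  refine (memLp_two_iff_integrable_sq hm).2 ?_
  simp only [hA.contr21_stepFun, hA.stepFunOne_pow _ two_ne_zero]
  exact hA.integrable_stepFunOne _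

/-- Simple kernels converging to `f`, with convergence of the fourth moments. -/
lemma IsDoubleIntegral.exists_tendsto (hM : IsCompensatedPoisson μ P M) {f : Z × Z → ℝ}
    (hf : MemL2Symm μ f) (hf4 : MemLp f 4 (μ.prod μ)) (hu : MemLp (contr21 μ f f) 2 μ)
    {F : Ω → ℝ} (hF : IsDoubleIntegral μ P M f F) :
    ∃ h : ℕ → SimpleKernel μ, (∀ k, (h k).IsDominated f) ∧
      Tendsto (fun k => eLpNorm (fun p => f p - (h k).toFun p) 2 (μ.prod μ)) atTop (𝓝 0) ∧
      (∀ᵐ ω ∂P, Tendsto (fun k => (h k).integral M ω) atTop (𝓝 (F ω))) ∧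
      Tendsto (fun k => ∫ p, ((h k).toFun p - f p) ^ 4 ∂(μ.prod μ)) atTop (𝓝 0) ∧
      Tendsto (fun k => ∫ x, contr21 μ (fun p => (h k).toFun p - f p)
        (fun p => (h k).toFun p - f p) x ^ 2 ∂μ) atTop (𝓝 0) ∧
      Tendsto (fun k => ∫ x, contr21 μ (h k).toFun (h k).toFun x ^ 2 ∂μ) atTop
        (𝓝 (∫ x, contr21 μ f f x ^ 2 ∂μ)) := by
  obtain ⟨h₀, hdom₀, hh₀, hH₀⟩ := hF.exists_dominated hM hf
  obtain ⟨ns, hns, hae1⟩ := exists_subseq_tendsto_ae two_ne_zero ENNReal.ofNat_ne_top hf.1.1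
    (fun k => ((h₀ k).memLp_toFun hM two_ne_zero).1) hh₀
  obtain ⟨ms, hms, hae2⟩ := exists_subseq_tendsto_ae two_ne_zero ENNReal.ofNat_ne_top hF.1.1
    (fun k => (h₀ (ns k)).aestronglyMeasurable hM) (hH₀.comp hns.tendsto_atTop)
  set h₁ : ℕ → SimpleKernel μ := fun k => h₀ (ns (ms k)) with hh₁def
  have hL₁ : ∀ k, MemLp (h₁ k).toFun 2 (μ.prod μ) := fun k => (h₁ k).memLp_toFun hM two_ne_zero
  have hd₁ : ∀ k, MemLp (fun p => (h₁ k).toFun p - f p) 2 (μ.prod μ) := fun k => (hL₁ k).sub hf.1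
  have hh₁ : Tendsto (fun k => eLpNorm (fun p => f p - (h₁ k).toFun p) 2 (μ.prod μ)) atTop (𝓝 0) :=
    hh₀.comp (hns.comp hms).tendsto_atTop
  -- The L¹ norm of this nonnegative contraction equals the squared L² distance of the kernels. A
  -- third extraction makes it vanish almost everywhere.
  have hD : Tendsto (fun k => eLpNorm (fun x => (0 : ℝ) - contr21 μ (fun p => (h₁ k).toFun p - f p)
        (fun p => (h₁ k).toFun p - f p) x) 1 μ) atTop (𝓝 0) := by
    have e : ∀ k, eLpNorm (fun x => (0 : ℝ) - contr21 μ (fun p => (h₁ k).toFun p - f p)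
        (fun p => (h₁ k).toFun p - f p) x) 1 μ
        = eLpNorm (fun p => f p - (h₁ k).toFun p) 2 (μ.prod μ) ^ 2 := by
      intro k
      have e1 : eLpNorm (fun p => f p - (h₁ k).toFun p) 2 (μ.prod μ)
          = eLpNorm (fun p => (h₁ k).toFun p - f p) 2 (μ.prod μ) :=
        eLpNorm_sub_comm f (h₁ k).toFun 2 (μ.prod μ)
      rw [e1, eLpNorm_two_eq (hd₁ k), ← ENNReal.ofReal_pow (Real.sqrt_nonneg _),
        Real.sq_sqrt (integral_nonneg fun _ => sq_nonneg _), eLpNorm_one_eq_lintegral_enorm,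
        ← integral_contr21 (hd₁ k),
        ofReal_integral_eq_lintegral_ofReal (integrable_contr21 (hd₁ k))
          (ae_of_all _ fun x => contr21_nonneg _ x)]
      refine lintegral_congr fun x => ?_
      rw [zero_sub, enorm_neg, Real.enorm_of_nonneg (contr21_nonneg _ x)]
    simp only [e]
    have := ENNReal.Tendsto.pow (n := 2) hh₁
    simpa using this
  obtain ⟨ls, hls, hae3⟩ := exists_subseq_tendsto_ae (g := fun _ => 0) one_ne_zero
    ENNReal.one_ne_top aestronglyMeasurable_const (fun k => (integrable_contr21 (hd₁ k)).1) hD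
  set h : ℕ → SimpleKernel μ := fun k => h₁ (ls k) with hhdef
  have hL : ∀ k, MemLp (h k).toFun 2 (μ.prod μ) := fun k => hL₁ _
  have hL4 : ∀ k, MemLp (h k).toFun 4 (μ.prod μ) := fun k => (h k).memLp_toFun hM four_ne_zero
  have hdom : ∀ k, (h k).IsDominated f := fun k => hdom₀ _
  have hc : ∀ k, MemLp (contr21 μ (h k).toFun (h k).toFun) 2 μ := fun k =>
    (h k).memLp_contr21 hM
  have hcd : ∀ k, MemLp (contr21 μ (fun p => (h k).toFun p - f p)
      (fun p => (h k).toFun p - f p)) 2 μ := fun k =>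
    integrable_contr21_sq_of_le hf.1 (hL k) hu (hc k)
  -- The constant is that of (x − y)⁴ ≤ 8(x⁴ + y⁴). The same 8 serves for `contr21` below, which is
  -- already quadratic and at most 2(u + v).
  have lim4 := tendsto_integral_of_le (ν := μ.prod μ) (C := 8)
    (d := fun k p => ((h k).toFun p - f p) ^ 4) (b' := fun k p => (h k).toFun p ^ 4)
    (b := fun p => f p ^ 4) (by norm_num)
    (fun k => (memLp_four_iff ((hL4 k).sub hf4).1).1 ((hL4 k).sub hf4))
    (fun k => (memLp_four_iff (hL4 k).1).1 (hL4 k)) ((memLp_four_iff hf4.1).1 hf4)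
    (fun k p => by positivity) (fun k p => by positivity) (fun p => by positivity)
    (fun k => ae_of_all _ fun p => by
      have h1 : ((h k).toFun p - f p) ^ 2 ≤ 2 * ((h k).toFun p ^ 2 + f p ^ 2) := by
        nlinarith [sq_nonneg ((h k).toFun p + f p)]
      have h2 : ((h k).toFun p - f p) ^ 4 ≤ (2 * ((h k).toFun p ^ 2 + f p ^ 2)) ^ 2 := by
        have := pow_le_pow_left₀ (sq_nonneg _) h1 2
        rwa [← pow_mul] at this
      nlinarith [sq_nonneg ((h k).toFun p ^ 2 - f p ^ 2)])
    (by
      filter_upwards [hae1] with p hp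
      have := ((hp.comp (hms.comp hls).tendsto_atTop).sub_const (f p)).pow 4
      simpa using this)
    (by
      filter_upwards [hae1] with p hp
      exact (hp.comp (hms.comp hls).tendsto_atTop).pow 4)
    (fun k => (hdom k).integral_pow_four_le hf4)
  have lim21 := tendsto_integral_of_le (ν := μ) (C := 8)
    (d := fun k x => contr21 μ (fun p => (h k).toFun p - f p) (fun p => (h k).toFun p - f p) x ^ 2)
    (b' := fun k x => contr21 μ (h k).toFun (h k).toFun x ^ 2)
    (b := fun x => contr21 μ f f x ^ 2) (by norm_num)
    (fun k => (hcd k).integrable_sq) (fun k => (hc k).integrable_sq) hu.integrable_sq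
    (fun k p => by positivity) (fun k p => by positivity) (fun p => by positivity)
    (fun k => by
      filter_upwards [contr21_sub_le hf.1 (hL k)] with x hx
      have h0 := contr21_nonneg (μ := μ) (fun p => (h k).toFun p - f p) x
      have h2 := pow_le_pow_left₀ h0 hx 2
      nlinarith [sq_nonneg (contr21 μ (h k).toFun (h k).toFun x - contr21 μ f f x)])
    (by
      filter_upwards [hae3] with x hx
      have := hx.pow 2
      simpa using this)
    (by
      filter_upwards [hae3, ae_all_iff.2 fun k => abs_contr21_sub_le hf.1 (hL k)] with x hx hle
      refine Tendsto.pow ?_ 2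
      rw [tendsto_iff_norm_sub_tendsto_zero]
      have hb := hx.add (((hx.const_mul (contr21 μ f f x)).sqrt).const_mul 2)
      simp only [mul_zero, Real.sqrt_zero, add_zero] at hb
      exact squeeze_zero (fun _ => norm_nonneg _) hle hb)
    (fun k => (hdom k).integral_contr21_sq_le hu)
  refine ⟨h, hdom, hh₁.comp hls.tendsto_atTop, ?_, lim4.1, lim21.1, lim21.2⟩
  filter_upwards [hae2] with ω hω
  exact hω.comp hls.tendsto_atTop

end Limits

/-! ### Fourth moments of double integrals -/

section FourthMoment

variable {Z Ω : Type*} [MeasurableSpace Z] [MeasurableSpace Ω] {μ : Measure Z} [SigmaFinite μ]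
  {P : Measure Ω} [IsProbabilityMeasure P] {M : Set Z → Ω → ℝ}

/-- A functional controlling the fourth moment of the double integral of `h - f`. -/
noncomputable def distFour (μ : Measure Z) (h f : Z × Z → ℝ) : ℝ :=
  (∫ p, (h p - f p) ^ 2 ∂(μ.prod μ)) ^ 2
    + (∫ x, contr21 μ (fun p => h p - f p) (fun p => h p - f p) x ^ 2 ∂μ)
    + ∫ p, (h p - f p) ^ 4 ∂(μ.prod μ)

/-- Write g − h as (g − f) − (h − f). Each of the three terms of the fourth-moment bound loses a
factor of at most 8, and 864 = 108 · 8. -/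
lemma SimpleKernel.integral_sub_pow_four_le (hM : IsCompensatedPoisson μ P M) {f : Z × Z → ℝ}
    (hf : MemLp f 2 (μ.prod μ)) (hf4 : MemLp f 4 (μ.prod μ)) (hu : MemLp (contr21 μ f f) 2 μ)
    (g h : SimpleKernel μ) :
    ∫ ω, (g.integral M ω - h.integral M ω) ^ 4 ∂P
      ≤ 864 * (distFour μ g.toFun f + distFour μ h.toFun f) := by
  have h1 := (g.sub h).integral_integral_pow_four_le hM
  simp only [SimpleKernel.sub_integral] at h1
  have e : (g.sub h).toFun = fun p => (g.toFun p - f p) - (h.toFun p - f p) := by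
    ext p; rw [SimpleKernel.sub_toFun]; ring
  have hg2 : MemLp (fun p => g.toFun p - f p) 2 (μ.prod μ) :=
    MemLp.sub (by exact_mod_cast g.memLp_toFun hM two_ne_zero) hf
  have hh2 : MemLp (fun p => h.toFun p - f p) 2 (μ.prod μ) :=
    MemLp.sub (by exact_mod_cast h.memLp_toFun hM two_ne_zero) hf
  have hg4 : MemLp (fun p => g.toFun p - f p) 4 (μ.prod μ) :=
    MemLp.sub (by exact_mod_cast g.memLp_toFun hM four_ne_zero) hf4
  have hh4 : MemLp (fun p => h.toFun p - f p) 4 (μ.prod μ) :=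
    MemLp.sub (by exact_mod_cast h.memLp_toFun hM four_ne_zero) hf4
  have hgc := integrable_contr21_sq_of_le hf (g.memLp_toFun hM two_ne_zero) hu (g.memLp_contr21 hM)
  have hhc := integrable_contr21_sq_of_le hf (h.memLp_toFun hM two_ne_zero) hu (h.memLp_contr21 hM)
  have hgI4 := (memLp_four_iff hg4.1).1 hg4
  have hhI4 := (memLp_four_iff hh4.1).1 hh4
  rw [e] at h1
  set a := fun p => g.toFun p - f p with ha
  set b := fun p => h.toFun p - f p with hb
  have k2 : ∫ p, (a p - b p) ^ 2 ∂(μ.prod μ)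
      ≤ 2 * (∫ p, a p ^ 2 ∂(μ.prod μ)) + 2 * ∫ p, b p ^ 2 ∂(μ.prod μ) := by
    have i1 := hg2.integrable_sq.const_mul 2
    have i2 := hh2.integrable_sq.const_mul 2
    rw [← integral_const_mul, ← integral_const_mul, ← integral_add i1 i2]
    refine integral_mono (hg2.sub hh2).integrable_sq (i1.add i2) fun p => ?_
    simp only [Pi.sub_apply]
    nlinarith [sq_nonneg (a p + b p)]
  have k4 : ∫ p, (a p - b p) ^ 4 ∂(μ.prod μ)
      ≤ 8 * (∫ p, a p ^ 4 ∂(μ.prod μ)) + 8 * ∫ p, b p ^ 4 ∂(μ.prod μ) := by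
    have i1 := hgI4.const_mul 8
    have i2 := hhI4.const_mul 8
    rw [← integral_const_mul, ← integral_const_mul, ← integral_add i1 i2]
    refine integral_mono ((memLp_four_iff (hg4.sub hh4).1).1 (hg4.sub hh4)) (i1.add i2)
      fun p => ?_
    simp only [Pi.sub_apply, Pi.add_apply]
    have h2 : (a p - b p) ^ 2 ≤ 2 * (a p ^ 2 + b p ^ 2) := by nlinarith [sq_nonneg (a p + b p)]
    have h3 := pow_le_pow_left₀ (sq_nonneg _) h2 2
    nlinarith [sq_nonneg (a p ^ 2 - b p ^ 2)]
  have kc : ∫ x, contr21 μ (fun p => a p - b p) (fun p => a p - b p) x ^ 2 ∂μ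
      ≤ 8 * (∫ x, contr21 μ a a x ^ 2 ∂μ) + 8 * ∫ x, contr21 μ b b x ^ 2 ∂μ := by
    have i1 := hgc.integrable_sq.const_mul 8
    have i2 := hhc.integrable_sq.const_mul 8
    rw [← integral_const_mul, ← integral_const_mul, ← integral_add i1 i2]
    refine integral_mono_ae (integrable_contr21_sq_of_le hh2 hg2 hhc hgc).integrable_sq
      (i1.add i2) ?_
    filter_upwards [contr21_sub_le hh2 hg2] with x hx
    have h3 := pow_le_pow_left₀ (contr21_nonneg _ _) hx 2
    nlinarith [sq_nonneg (contr21 μ a a x - contr21 μ b b x)]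
  have h0 : 0 ≤ ∫ p, (a p - b p) ^ 2 ∂(μ.prod μ) := integral_nonneg fun _ => sq_nonneg _
  have k22 := pow_le_pow_left₀ h0 k2 2
  unfold distFour
  nlinarith [sq_nonneg ((∫ p, a p ^ 2 ∂(μ.prod μ)) - ∫ p, b p ^ 2 ∂(μ.prod μ))]

/-- Convergence in `L⁴` of the integrals of simple kernels. -/
lemma IsDoubleIntegral.exists_tendsto_four (hM : IsCompensatedPoisson μ P M) {f : Z × Z → ℝ}
    (hf : MemL2Symm μ f) (hf4 : MemLp f 4 (μ.prod μ)) (hu : MemLp (contr21 μ f f) 2 μ)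
    {F : Ω → ℝ} (hF : IsDoubleIntegral μ P M f F) :
    ∃ h : ℕ → SimpleKernel μ, (∀ k, (h k).IsDominated f) ∧
      Tendsto (fun k => eLpNorm (fun p => f p - (h k).toFun p) 2 (μ.prod μ)) atTop (𝓝 0) ∧
      Tendsto (fun k => ∫ x, contr21 μ (h k).toFun (h k).toFun x ^ 2 ∂μ) atTop
        (𝓝 (∫ x, contr21 μ f f x ^ 2 ∂μ)) ∧
      Tendsto (fun k => ∫ ω, (h k).integral M ω ^ 4 ∂P) atTop (𝓝 (∫ ω, F ω ^ 4 ∂P)) := by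
  obtain ⟨h, hdom, hh, hae, l4, l21, lc⟩ := hF.exists_tendsto hM hf hf4 hu
  refine ⟨h, hdom, hh, lc, ?_⟩
  have hL : ∀ k, MemLp (h k).toFun 2 (μ.prod μ) := fun k => (h k).memLp_toFun hM two_ne_zero
  have hHm : ∀ k, AEStronglyMeasurable ((h k).integral M) P := fun k =>
    (h k).aestronglyMeasurable hM
  have hH4 : ∀ k, MemLp ((h k).integral M) 4 P := fun k =>
    (memLp_four_iff (hHm k)).2 ((h k).integrable_pow hM 4)
  have l2 : Tendsto (fun k => ∫ p, ((h k).toFun p - f p) ^ 2 ∂(μ.prod μ)) atTop (𝓝 0) := by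
    have := ((ENNReal.tendsto_toReal ENNReal.zero_ne_top).comp hh).pow 2
    rw [ENNReal.toReal_zero, zero_pow two_ne_zero] at this
    refine this.congr fun k => ?_
    have e : eLpNorm (fun p => f p - (h k).toFun p) 2 (μ.prod μ)
        = eLpNorm (fun p => (h k).toFun p - f p) 2 (μ.prod μ) :=
      eLpNorm_sub_comm f (h k).toFun 2 (μ.prod μ)
    have hd : MemLp (fun p => (h k).toFun p - f p) 2 (μ.prod μ) := (hL k).sub hf.1
    rw [Function.comp, e, toReal_eLpNorm_two_sq hd]
  have lε : Tendsto (fun k => 864 * distFour μ (h k).toFun f) atTop (𝓝 0) := by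
    have := (((l2.pow 2).add l21).add l4).const_mul 864
    simpa [distFour] using this
  -- Fatou in l with k fixed, using almost sure convergence to F: an L⁴ Cauchy estimate becomes an
  -- estimate of the distance to F.
  have hbound : ∀ k, eLpNorm (fun ω => F ω - (h k).integral M ω) 4 P ^ 4
      ≤ ENNReal.ofReal (864 * distFour μ (h k).toFun f) := by
    intro k
    have hpow : ∀ G : Ω → ℝ, eLpNorm G 4 P ^ 4 = ∫⁻ ω, ‖G ω‖ₑ ^ 4 ∂P := by
      intro G
      have := eLpNorm_nnreal_pow_eq_lintegral (μ := P) (f := G) (p := 4) four_ne_zero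
      norm_num at this
      exact_mod_cast this
    rw [hpow]
    have hlim : ∀ᵐ ω ∂P, Tendsto (fun l => ‖(h l).integral M ω - (h k).integral M ω‖ₑ ^ 4) atTop
        (𝓝 (‖F ω - (h k).integral M ω‖ₑ ^ 4)) := by
      filter_upwards [hae] with ω hω
      exact ENNReal.Tendsto.pow ((hω.sub_const _).enorm)
    calc ∫⁻ ω, ‖F ω - (h k).integral M ω‖ₑ ^ 4 ∂P
        = ∫⁻ ω, liminf (fun l => ‖(h l).integral M ω - (h k).integral M ω‖ₑ ^ 4) atTop ∂P := by
          refine lintegral_congr_ae ?_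
          filter_upwards [hlim] with ω hω
          exact hω.liminf_eq.symm
      _ ≤ liminf (fun l => ∫⁻ ω, ‖(h l).integral M ω - (h k).integral M ω‖ₑ ^ 4 ∂P) atTop :=
          lintegral_liminf_le' fun l => (((hHm l).sub (hHm k)).enorm.pow_const 4)
      _ ≤ liminf (fun l => ENNReal.ofReal (864 * (distFour μ (h l).toFun f
            + distFour μ (h k).toFun f))) atTop := by
          refine liminf_le_liminf (Eventually.of_forall fun l => ?_)
          refine le_trans (le_of_eq ?_) (ENNReal.ofReal_le_ofReal
            ((h l).integral_sub_pow_four_le hM hf.1 hf4 hu (h k)))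
          have hI : Integrable (fun ω => ((h l).integral M ω - (h k).integral M ω) ^ 4) P :=
            (memLp_four_iff ((hHm l).sub (hHm k))).1 ((hH4 l).sub (hH4 k))
          rw [ofReal_integral_eq_lintegral_ofReal hI
            (ae_of_all _ fun ω => by simp only [Pi.zero_apply]; positivity)]
          refine lintegral_congr fun ω => ?_
          rw [← enorm_pow, Real.enorm_of_nonneg (by positivity)]
      _ = ENNReal.ofReal (864 * distFour μ (h k).toFun f) := by
          refine Tendsto.liminf_eq (ENNReal.tendsto_ofReal ?_)
          have := lε.add_const (864 * distFour μ (h k).toFun f)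
          rw [zero_add] at this
          simpa only [mul_add] using this
  -- F is at finite L⁴ distance from one simple integral, which has all moments.
  have hF4 : MemLp F 4 P := by
    have h1 : MemLp (fun ω => F ω - (h 0).integral M ω) 4 P := by
      refine ⟨hF.1.1.sub (hHm 0), ?_⟩
      by_contra hcon
      rw [not_lt, top_le_iff] at hcon
      have := hbound 0
      rw [hcon, ENNReal.top_pow four_ne_zero] at this
      exact ENNReal.ofReal_ne_top (top_le_iff.1 this)
    have := h1.add (hH4 0)
    refine this.ae_eq (ae_of_all _ fun ω => ?_)
    simp
  refine tendsto_integral_pow_four hF4 hH4 ?_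
  have hz : Tendsto (fun k => eLpNorm (fun ω => F ω - (h k).integral M ω) 4 P ^ 4) atTop (𝓝 0) := by
    refine tendsto_of_tendsto_of_tendsto_of_le_of_le tendsto_const_nhds
      (ENNReal.ofReal_zero ▸ ENNReal.tendsto_ofReal lε) (fun _ => zero_le) hbound
  have := hz.ennrpow_const (4⁻¹ : ℝ)
  rw [ENNReal.zero_rpow_of_pos (by norm_num)] at this
  refine this.congr fun k => ?_
  rw [← ENNReal.rpow_natCast, ← ENNReal.rpow_mul]
  norm_num

/-- A bound on the contractions of a kernel by the fourth moment of its double integral. -/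
lemma IsDoubleIntegral.contractions_le (hM : IsCompensatedPoisson μ P M) {f : Z × Z → ℝ}
    (hf : MemL2Symm μ f) (hf4 : MemLp f 4 (μ.prod μ)) (hu : MemLp (contr21 μ f f) 2 μ)
    {F : Ω → ℝ} (hF : IsDoubleIntegral μ P M f F) :
    48 * (∫ p, contr11 μ f f p ^ 2 ∂(μ.prod μ)) + 48 * (∫ x, contr21 μ f f x ^ 2 ∂μ)
      ≤ ∫ ω, F ω ^ 4 ∂P - 12 * (∫ p, f p ^ 2 ∂(μ.prod μ)) ^ 2
        + 96 * √((∫ p, contr11 μ f f p ^ 2 ∂(μ.prod μ)) * ∫ p, f p ^ 4 ∂(μ.prod μ)) := by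
  obtain ⟨h, hdom, hh, lc, l4⟩ := hF.exists_tendsto_four hM hf hf4 hu
  have hL : ∀ k, MemLp (h k).toFun 2 (μ.prod μ) := fun k => (h k).memLp_toFun hM two_ne_zero
  have hL4 : ∀ k, MemLp (h k).toFun 4 (μ.prod μ) := fun k => (h k).memLp_toFun hM four_ne_zero
  have hC := fun k => (memLp_contr11_and_integral_le (hL k) (hL k)).1
  have l2 := tendsto_integral_sq hf.1 hL hh
  have l3 := tendsto_integral_sq (memLp_contr11_and_integral_le hf.1 hf.1).1 hC
    (tendsto_eLpNorm_contr11_sub hf.1 hL hh)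
  set q := ∫ p, f p ^ 4 ∂(μ.prod μ) with hq
  -- For each k the inequality is the exact fourth-moment formula with the term 8∫h⁴ ≥ 0 dropped,
  -- the cross term bounded by Cauchy–Schwarz, and ∫h⁴ under the root bounded by `q`.
  refine le_of_tendsto_of_tendsto' ((l3.const_mul 48).add (lc.const_mul 48))
    ((l4.sub ((l2.pow 2).const_mul 12)).add (((l3.mul_const q).sqrt).const_mul 96)) fun k => ?_
  have hcross := abs_integral_mul_le (hC k) (memLp_sq_of_memLp_four (hL4 k))
  have hle : √((∫ p, contr11 μ (h k).toFun (h k).toFun p ^ 2 ∂(μ.prod μ)) *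
      ∫ p, ((h k).toFun p ^ 2) ^ 2 ∂(μ.prod μ))
      ≤ √((∫ p, contr11 μ (h k).toFun (h k).toFun p ^ 2 ∂(μ.prod μ)) * q) := by
    refine Real.sqrt_le_sqrt (mul_le_mul_of_nonneg_left ?_ (integral_nonneg fun _ => sq_nonneg _))
    simp only [← pow_mul]
    exact (hdom k).integral_pow_four_le hf4
  have h4 : 0 ≤ ∫ p, (h k).toFun p ^ 4 ∂(μ.prod μ) := integral_nonneg fun _ => by positivity
  rw [(h k).integral_integral_pow_four hM]
  have := (abs_le.1 hcross).1
  linarith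

end FourthMoment

/-! ### Gaussian moments and convergence in law -/

section GaussianLimit

lemma integral_pow_four_gaussianReal : ∫ x, x ^ 4 ∂(gaussianReal 0 1) = 3 := by
  have h0 : (0 : ℝ) ∈ interior (integrableExpSet id (gaussianReal 0 1)) := by simp
  have h := iteratedDeriv_mgf_zero h0 4
  have e0 : mgf id (gaussianReal 0 1) = fun t => Real.exp (t ^ 2 / 2) := by
    rw [mgf_id_gaussianReal]; simp
  have hE : ∀ t : ℝ, HasDerivAt (fun t : ℝ => Real.exp (t ^ 2 / 2))
      (Real.exp (t ^ 2 / 2) * t) t := fun t => by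
    have := ((hasDerivAt_pow 2 t).div_const 2).exp
    simpa using this
  -- Differentiating p(t) exp(t²/2) replaces p by p' + tp. Four rounds starting from 1 leave the
  -- value 3 at 0.
  have key : ∀ (p p' : ℝ → ℝ), (∀ t, HasDerivAt p (p' t) t) →
      deriv (fun t => p t * Real.exp (t ^ 2 / 2))
        = fun t => (p' t + p t * t) * Real.exp (t ^ 2 / 2) := fun p p' hp => by
    ext t
    refine ((hp t).mul (hE t)).deriv.trans ?_
    ring
  have d1 : deriv (fun t : ℝ => Real.exp (t ^ 2 / 2)) = fun t => t * Real.exp (t ^ 2 / 2) := by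
    ext t; rw [(hE t).deriv]; ring
  have d2 := key (fun t => t) (fun _ => 1) hasDerivAt_id'
  have d3 := key (fun t => 1 + t * t) (fun t => 2 * t) fun t => by
    have := ((hasDerivAt_id' t).mul (hasDerivAt_id' t)).const_add 1
    refine this.congr_deriv ?_
    ring
  have d4 := key (fun t => 2 * t + (1 + t * t) * t) (fun t => 3 + 3 * t ^ 2) fun t => by
    have := ((hasDerivAt_id' t).const_mul 2).add
      ((((hasDerivAt_id' t).mul (hasDerivAt_id' t)).const_add 1).mul (hasDerivAt_id' t))
    refine this.congr_deriv ?_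
    simp only [Pi.mul_apply]
    ring
  rw [e0, iteratedDeriv_succ, iteratedDeriv_succ, iteratedDeriv_succ, iteratedDeriv_one, d1, d2,
    d3, d4] at h
  simpa using h.symm

variable {Ω : Type*} [MeasurableSpace Ω] {P : Measure Ω} [IsProbabilityMeasure P]

lemma tendstoInDistribution_of_tendsto_integral_cexp {F : ℕ → Ω → ℝ}
    (hF : ∀ n, AEMeasurable (F n) P)
    (h : ∀ t : ℝ, Tendsto (fun n => ∫ ω, Complex.exp ((t * F n ω : ℝ) * Complex.I) ∂P) atTop
      (𝓝 (Complex.exp (-(t ^ 2 / 2 : ℝ))))) :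
    TendstoInDistribution F atTop (id : ℝ → ℝ) (fun _ => P) (gaussianReal 0 1) := by
  refine ⟨hF, aemeasurable_id, ProbabilityMeasure.tendsto_of_tendsto_charFun fun t => ?_⟩
  simp only [ProbabilityMeasure.coe_mk, Measure.map_id, charFun_gaussianReal]
  have := h t
  convert this using 2
  · rw [charFun_apply_real, integral_map (hF _) (by fun_prop)]
    refine integral_congr_ae (ae_of_all _ fun ω => ?_)
    push_cast
    rfl
  · push_cast
    congr 1
    ring

/-- Convergence in law and uniform integrability imply convergence of fourth moments. -/
lemma tendsto_integral_pow_four_of_tendstoInDistribution {F : ℕ → Ω → ℝ}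
    (h : TendstoInDistribution F atTop (id : ℝ → ℝ) (fun _ => P) (gaussianReal 0 1))
    (hU : UniformIntegrable (fun n ω => F n ω ^ 4) 1 P) :
    Tendsto (fun n => ∫ ω, F n ω ^ 4 ∂P) atTop (𝓝 3) := by
  have hint : ∀ n, Integrable (fun ω => F n ω ^ 4) P := fun n =>
    memLp_one_iff_integrable.1 (hU.memLp n)
  -- The truncated fourth power is bounded and continuous, so weak convergence applies to it.
  have htr : ∀ R : ℝ, 0 ≤ R → Tendsto (fun n => ∫ ω, min (F n ω ^ 4) R ∂P) atTop
      (𝓝 (∫ x, min (x ^ 4) R ∂(gaussianReal 0 1))) := by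
    intro R hR
    let φ : BoundedContinuousFunction ℝ ℝ := BoundedContinuousFunction.ofNormedAddCommGroup
      (fun x : ℝ => min (x ^ 4) R) (by fun_prop) R (fun x => by
        rw [Real.norm_of_nonneg (le_min (by positivity) hR)]
        exact min_le_right _ _)
    have hφ : ∀ x, φ x = min (x ^ 4) R := fun _ => rfl
    have := ProbabilityMeasure.tendsto_iff_forall_integral_tendsto.1 h.tendsto φ
    simp only [ProbabilityMeasure.coe_mk, Measure.map_id] at this
    refine this.congr fun n => ?_
    rw [integral_map (h.forall_aemeasurable n) φ.continuous.aestronglyMeasurable]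
    rfl
  have hG : Integrable (fun x : ℝ => x ^ 4) (gaussianReal 0 1) :=
    (memLp_four_iff aestronglyMeasurable_id).1 (memLp_id_gaussianReal' 4 (by norm_num))
  have hGR : Tendsto (fun R : ℕ => ∫ x, min (x ^ 4) (R : ℝ) ∂(gaussianReal 0 1)) atTop (𝓝 3) := by
    rw [← integral_pow_four_gaussianReal]
    refine tendsto_integral_of_dominated_convergence (fun x => x ^ 4)
      (fun R => (by fun_prop : Measurable fun x : ℝ => min (x ^ 4) (R : ℝ)).aestronglyMeasurable)
      hG (fun R => ae_of_all _ fun x => ?_) (ae_of_all _ fun x => ?_)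
    · rw [Real.norm_of_nonneg (le_min (by positivity) (Nat.cast_nonneg R))]
      exact min_le_left _ _
    · refine tendsto_const_nhds.congr' ?_
      filter_upwards [eventually_ge_atTop ⌈x ^ 4⌉₊] with R hR
      exact (min_eq_left (Nat.ceil_le.1 hR)).symm
  rw [Metric.tendsto_atTop]
  intro ε hε
  obtain ⟨-, hC⟩ := (uniformIntegrable_iff le_rfl ENNReal.one_ne_top).1 hU
  obtain ⟨C, hC⟩ := hC (ε / 3) (by positivity)
  -- The level R is taken above the uniform integrability threshold C, so that x⁴ − min(x⁴, R) is at
  -- most x⁴ on {x⁴ ≥ C} and zero elsewhere.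
  obtain ⟨R, hR, hRC⟩ := (((Metric.tendsto_nhds.1 hGR) (ε / 3) (by positivity)).and
    (eventually_ge_atTop ⌈(C : ℝ)⌉₊)).exists
  have hCR : (C : ℝ) ≤ R := Nat.ceil_le.1 hRC
  obtain ⟨N, hN⟩ := Metric.tendsto_atTop.1 (htr R (Nat.cast_nonneg R)) (ε / 3) (by positivity)
  refine ⟨N, fun n hn => ?_⟩
  have h1 := hN n hn
  have hmi : Integrable (fun ω => min (F n ω ^ 4) (R : ℝ)) P :=
    (hint n).inf (integrable_const _)
  have h2 : |∫ ω, F n ω ^ 4 ∂P - ∫ ω, min (F n ω ^ 4) (R : ℝ) ∂P| ≤ ε / 3 := by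
    rw [← integral_sub (hint n) hmi, abs_of_nonneg (integral_nonneg fun ω =>
      sub_nonneg.2 (min_le_left _ _)), integral_eq_lintegral_of_nonneg_ae
      (ae_of_all _ fun ω => sub_nonneg.2 (min_le_left _ _)) ((hint n).sub hmi).1]
    refine ENNReal.toReal_le_of_le_ofReal (by positivity) (le_trans ?_ (hC n))
    rw [eLpNorm_one_eq_lintegral_enorm]
    refine lintegral_mono fun ω => ?_
    have h4 : 0 ≤ F n ω ^ 4 := by positivity
    rcases le_or_gt (C : ℝ) (F n ω ^ 4) with hc | hc
    · rw [Set.indicator_of_mem (by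
        rw [Set.mem_ofPred_eq, ← NNReal.coe_le_coe, coe_nnnorm, Real.norm_of_nonneg h4]
        exact hc), Real.enorm_of_nonneg h4]
      refine ENNReal.ofReal_le_ofReal (sub_le_self _ (le_min h4 (Nat.cast_nonneg R)))
    · rw [min_eq_left (by linarith), sub_self]
      simp
  rw [Real.dist_eq] at h1 hR ⊢
  have := abs_add_three (∫ ω, F n ω ^ 4 ∂P - ∫ ω, min (F n ω ^ 4) (R : ℝ) ∂P)
    (∫ ω, min (F n ω ^ 4) (R : ℝ) ∂P - ∫ x, min (x ^ 4) (R : ℝ) ∂(gaussianReal 0 1))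
    (∫ x, min (x ^ 4) (R : ℝ) ∂(gaussianReal 0 1) - 3)
  simp only [sub_add_sub_cancel] at this
  linarith

end GaussianLimit

/-! ### Sequences of kernels and the main theorem -/

section Limit

variable {Z Ω : Type*} [MeasurableSpace Z] [MeasurableSpace Ω] {μ : Measure Z} [SigmaFinite μ]
  {P : Measure Ω} [IsProbabilityMeasure P] {M : Set Z → Ω → ℝ}

/-- By Fubini the squared norm is the integral of (∫ f(x, z)² μ(dz))², that is ‖f⋆₂¹f‖². Symmetry is
needed because the two contractions keep different variables free. -/
lemma memLp_contr10 {f : Z × Z → ℝ} (hf : MemL2Symm μ f) (hu : MemLp (contr21 μ f f) 2 μ) :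
    MemLp (contr10 f f) 2 (μ.prod (μ.prod μ)) := by
  have h1 : Measure.QuasiMeasurePreserving (fun q : Z × Z × Z => (q.1, q.2.1))
      (μ.prod (μ.prod μ)) (μ.prod μ) :=
    MeasureTheory.QuasiMeasurePreserving.prodMap (Measure.QuasiMeasurePreserving.id μ)
      Measure.quasiMeasurePreserving_fst
  have h2 : Measure.QuasiMeasurePreserving (fun q : Z × Z × Z => (q.1, q.2.2))
      (μ.prod (μ.prod μ)) (μ.prod μ) :=
    MeasureTheory.QuasiMeasurePreserving.prodMap (Measure.QuasiMeasurePreserving.id μ)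
      Measure.quasiMeasurePreserving_snd
  have hm : AEStronglyMeasurable (contr10 f f) (μ.prod (μ.prod μ)) :=
    (hf.1.1.comp_quasiMeasurePreserving h1).mul (hf.1.1.comp_quasiMeasurePreserving h2)
  have hsec : ∀ᵐ x ∂μ, Integrable (fun z => f (x, z) ^ 2) μ ∧
      ∫ z, f (x, z) ^ 2 ∂μ = contr21 μ f f x := by
    filter_upwards [ae_memLp_section hf.1, Measure.ae_ae_of_ae_prod hf.2] with x hx hs
    have e : (fun z => f (z, x) ^ 2) =ᵐ[μ] fun z => f (x, z) ^ 2 := by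
      filter_upwards [hs] with z hz
      rw [← hz, Prod.swap_prod_mk]
    exact ⟨hx.integrable_sq.congr e, by rw [contr21_eq, integral_congr_ae e]⟩
  rw [memLp_two_iff_integrable_sq hm, 
    integrable_prod_iff (f := fun q => contr10 f f q ^ 2) (hm.pow 2)]
  have e : ∀ x, (fun q : Z × Z => contr10 f f (x, q) ^ 2)
      = fun q => f (x, q.1) ^ 2 * f (x, q.2) ^ 2 := fun x => by
    ext q; simp only [contr10]; ring
  refine ⟨?_, hu.integrable_sq.congr ?_⟩
  · filter_upwards [hsec] with x hx
    rw [e]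
    exact hx.1.mul_prod hx.1
  · filter_upwards [hsec] with x hx
    simp only [norm_pow, Real.norm_eq_abs, sq_abs]
    rw [e, integral_prod_mul (fun z => f (x, z) ^ 2) (fun z => f (x, z) ^ 2), hx.2, sq]

lemma memL2Symm_contr11 {f : Z × Z → ℝ} (hf : MemLp f 2 (μ.prod μ)) :
    MemL2Symm μ (contr11 μ f f) :=
  ⟨(memLp_contr11_and_integral_le hf hf).1, ae_of_all _ fun p => by
    simp only [contr11, Prod.fst_swap, Prod.snd_swap, mul_comm]⟩

variable {f : ℕ → Z × Z → ℝ}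

lemma AssumptionN.memLp_contr21 (hN : AssumptionN μ f) (n : ℕ) :
    MemLp (contr21 μ (f n) (f n)) 2 μ := by
  have : contr21 μ (f n) (f n) = fun x => ∫ z, f n (z, x) ^ 2 ∂μ := funext (contr21_eq (f n))
  rw [this]
  exact hN.integrability n

lemma AssumptionN.tendsto_integral_sq (hN : AssumptionN μ f) (hf : ∀ n, MemL2Symm μ (f n)) :
    Tendsto (fun n => ∫ p, f n p ^ 2 ∂(μ.prod μ)) atTop (𝓝 2⁻¹) := by
  have := hN.normalization.const_mul 2⁻¹
  rw [mul_one] at this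
  refine this.congr fun n => ?_
  rw [integral_prod _ (hf n).1.integrable_sq]
  ring

/-- The fourth moments take values in [0, ∞] and may be infinite for finitely many n, so membership
in L⁴ holds only eventually. -/
lemma AssumptionN.eventually_memLp_four (hN : AssumptionN μ f) (hf : ∀ n, MemL2Symm μ (f n)) :
    (∀ᶠ n in atTop, MemLp (f n) 4 (μ.prod μ)) ∧
      Tendsto (fun n => ∫ p, f n p ^ 4 ∂(μ.prod μ)) atTop (𝓝 0) := by
  have hm : ∀ n, AEStronglyMeasurable (fun p => f n p ^ 4) (μ.prod μ) := fun n => (hf n).1.1.pow 4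
  have e : ∀ n, ∫⁻ z, ∫⁻ z', ENNReal.ofReal (f n (z, z') ^ 4) ∂μ ∂μ
      = ∫⁻ p, ENNReal.ofReal (f n p ^ 4) ∂(μ.prod μ) := fun n =>
    (lintegral_prod _ (hm n).aemeasurable.ennreal_ofReal).symm
  have h := hN.fourth_moment
  simp only [e] at h
  have hnn : ∀ n, 0 ≤ᵐ[μ.prod μ] fun p => f n p ^ 4 := fun n => ae_of_all _ fun p => by
    simp only [Pi.zero_apply]; positivity
  constructor
  · filter_upwards [h.eventually_lt_const zero_lt_one] with n hn
    rw [memLp_four_iff (hf n).1.1]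
    exact (lintegral_ofReal_ne_top_iff_integrable (hm n) (hnn n)).1 (hn.trans ENNReal.one_lt_top).ne
  · have := (ENNReal.tendsto_toReal ENNReal.zero_ne_top).comp h
    rw [ENNReal.toReal_zero] at this
    refine this.congr fun n => ?_
    rw [integral_eq_lintegral_of_nonneg_ae (hnn n) (hm n)]
    rfl

lemma contractionsVanish_iff (hN : AssumptionN μ f) (hf : ∀ n, MemL2Symm μ (f n)) :
    ContractionsVanish μ f ↔
      Tendsto (fun n => ∫ p, contr11 μ (f n) (f n) p ^ 2 ∂(μ.prod μ)) atTop (𝓝 0) ∧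
      Tendsto (fun n => ∫ x, contr21 μ (f n) (f n) x ^ 2 ∂μ) atTop (𝓝 0) := by
  have key : ∀ {α : Type _} [MeasurableSpace α] {ν : Measure α} {g : ℕ → α → ℝ},
      (∀ n, MemLp (g n) 2 ν) → (Tendsto (fun n => eLpNorm (g n) 2 ν) atTop (𝓝 0) ↔
        Tendsto (fun n => ∫ x, g n x ^ 2 ∂ν) atTop (𝓝 0)) := by
    intro α _ ν g hg
    refine ⟨fun h => ?_, fun h => ?_⟩
    · have := ((ENNReal.tendsto_toReal ENNReal.zero_ne_top).comp h).pow 2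
      rw [ENNReal.toReal_zero, zero_pow two_ne_zero] at this
      exact this.congr fun n => toReal_eLpNorm_two_sq (hg n)
    · have := ENNReal.tendsto_ofReal h.sqrt
      rw [Real.sqrt_zero, ENNReal.ofReal_zero] at this
      exact this.congr fun n => (eLpNorm_two_eq (hg n)).symm
  unfold ContractionsVanish
  rw [key fun n => (memL2Symm_contr11 (hf n).1).1]
  exact and_congr_right fun _ => key hN.memLp_contr21

variable {F : ℕ → Ω → ℝ}

/-- Vanishing contractions imply asymptotic normality. -/
lemma ContractionsVanish.tendstoInDistribution (hM : IsCompensatedPoisson μ P M)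
    (hf : ∀ n, MemL2Symm μ (f n)) (hF : ∀ n, IsDoubleIntegral μ P M (f n) (F n))
    (hN : AssumptionN μ f) (hG : ContractionsVanish μ f) :
    TendstoInDistribution F atTop (id : ℝ → ℝ) (fun _ => P) (gaussianReal 0 1) := by
  obtain ⟨h11, h21⟩ := (contractionsVanish_iff hN hf).1 hG
  obtain ⟨hev, h4⟩ := hN.eventually_memLp_four hf
  have h2 := hN.tendsto_integral_sq hf
  refine tendstoInDistribution_of_tendsto_integral_cexp (fun n => (hF n).1.1.aemeasurable)
    fun t => ?_
  rw [tendsto_iff_norm_sub_tendsto_zero]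
  refine squeeze_zero' (Eventually.of_forall fun _ => norm_nonneg _)
    (hev.mono fun n hn => (hF n).norm_charFun_sub_le hM (hf n) hn (hN.memLp_contr21 n) t) ?_
  have l := (((((h2.const_mul 2).sub_const 1).abs).add
    (((h11.const_mul 8).add (h21.const_mul 4)).sqrt)).const_mul (t ^ 2)).add
    (((h2.mul ((h21.const_mul 3).add h4)).sqrt).const_mul (4 * |t| ^ 3))
  simpa using l

/-- Convergence of the fourth moments to `3` implies that the contractions vanish. -/
lemma contractionsVanish_of_tendsto_integral_pow_four (hM : IsCompensatedPoisson μ P M)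
    (hf : ∀ n, MemL2Symm μ (f n)) (hF : ∀ n, IsDoubleIntegral μ P M (f n) (F n))
    (hN : AssumptionN μ f) (hm : Tendsto (fun n => ∫ ω, F n ω ^ 4 ∂P) atTop (𝓝 3)) :
    ContractionsVanish μ f := by
  obtain ⟨hev, h4⟩ := hN.eventually_memLp_four hf
  have h2 := hN.tendsto_integral_sq hf
  have l := ((hm.sub ((h2.pow 2).const_mul 12)).add
    ((((h2.pow 2).mul h4).sqrt).const_mul 96)).div_const 48
  -- The Gaussian value 3 is exactly 12‖f‖⁴ in the limit ‖f‖² = 1/2.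
  have l0 : ((3 : ℝ) - 12 * 2⁻¹ ^ 2 + 96 * √(2⁻¹ ^ 2 * 0)) / 48 = 0 := by norm_num
  rw [l0] at l
  have hle : ∀ᶠ n in atTop, (∫ p, contr11 μ (f n) (f n) p ^ 2 ∂(μ.prod μ))
      + (∫ x, contr21 μ (f n) (f n) x ^ 2 ∂μ) ≤ (∫ ω, F n ω ^ 4 ∂P
        - 12 * (∫ p, f n p ^ 2 ∂(μ.prod μ)) ^ 2 + 96 * √((∫ p, f n p ^ 2 ∂(μ.prod μ)) ^ 2 *
          ∫ p, f n p ^ 4 ∂(μ.prod μ))) / 48 := by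
    filter_upwards [hev] with n hn
    have h := (hF n).contractions_le hM (hf n) hn (hN.memLp_contr21 n)
    -- The cross term still contains ‖f⋆₁¹f‖, whose smallness is to be proved. The a priori bound by
    -- ‖f‖² suffices, since the other factor ∫f⁴ tends to 0.
    have hc := (memLp_contr11_and_integral_le (hf n).1 (hf n).1).2
    rw [← sq] at hc
    have hs := Real.sqrt_le_sqrt (mul_le_mul_of_nonneg_right hc
      (integral_nonneg fun p => by positivity : 0 ≤ ∫ p, f n p ^ 4 ∂(μ.prod μ)))
    linarith
  have n11 : ∀ n, 0 ≤ ∫ p, contr11 μ (f n) (f n) p ^ 2 ∂(μ.prod μ) := fun n =>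
    integral_nonneg fun _ => sq_nonneg _
  have n21 : ∀ n, 0 ≤ ∫ x, contr21 μ (f n) (f n) x ^ 2 ∂μ := fun n =>
    integral_nonneg fun _ => sq_nonneg _
  rw [contractionsVanish_iff hN hf]
  exact ⟨squeeze_zero' (Eventually.of_forall n11)
      (hle.mono fun n hn => by linarith [n21 n]) l,
    squeeze_zero' (Eventually.of_forall n21) (hle.mono fun n hn => by linarith [n11 n]) l⟩

end Limit

end PoissonCLT

open PoissonCLT
theorem theorem16 {Z Ω : Type*} [MeasurableSpace Z] [StandardBorelSpace Z] [MeasurableSpace Ω]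
    (μ : Measure Z) [SigmaFinite μ] [NullSingletonClass μ]
    (P : Measure Ω) [IsProbabilityMeasure P]
    (M : Set Z → Ω → ℝ) (hM : IsCompensatedPoisson μ P M)
    (f : ℕ → Z × Z → ℝ) (hf : ∀ n, MemL2SymmZero μ (f n))
    (F : ℕ → Ω → ℝ) (hF : ∀ n, IsDoubleIntegral μ P M (f n) (F n))
    (hN : AssumptionN μ f) :
    (∀ n, MemLp (contr10 (f n) (f n)) 2 (μ.prod (μ.prod μ)) ∧
      MemL2Symm μ (contr11 μ (f n) (f n))) ∧
    (ContractionsVanish μ f →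
      TendstoInDistribution F atTop (id : ℝ → ℝ) (fun _ => P) (gaussianReal 0 1)) ∧
    ((∀ n, MemLp (F n) 4 P) → Tendsto (fun n => ∫ ω, F n ω ^ 4 ∂P) atTop (𝓝 3) →
      ContractionsVanish μ f) ∧
    (UniformIntegrable (fun n ω => F n ω ^ 4) 1 P →
      List.TFAE [ContractionsVanish μ f,
        TendstoInDistribution F atTop (id : ℝ → ℝ) (fun _ => P) (gaussianReal 0 1),
        Tendsto (fun n => ∫ ω, F n ω ^ 4 ∂P) atTop (𝓝 3)]) := by
  have hf' : ∀ n, MemL2Symm μ (f n) := fun n => (hf n).1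
  refine ⟨fun n => ⟨memLp_contr10 (hf' n) (hN.memLp_contr21 n), memL2Symm_contr11 (hf' n).1⟩,
    fun hG => hG.tendstoInDistribution hM hf' hF hN,
    fun _ hm => contractionsVanish_of_tendsto_integral_pow_four hM hf' hF hN hm, fun hU => ?_⟩
  tfae_have 1 → 2 := fun hG => hG.tendstoInDistribution hM hf' hF hN
  tfae_have 2 → 3 := fun h => tendsto_integral_pow_four_of_tendstoInDistribution h hU
  tfae_have 3 → 1 := contractionsVanish_of_tendsto_integral_pow_four hM hf' hF hN
  tfae_finish
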